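/- Let $k$ be an algebraically closed field of characteristic $0$. For $\theta\in k^\times$, let $Q(\theta)$ (the quantum torus determined by $\theta$) be the unital associative $k$-algebra presented by generators $x_1,x_2,x_1^{-1},x_2^{-1}$ subject to the relations $x_1x_1^{-1}=x_1^{-1}x_1=1$, $x_2x_2^{-1}=x_2^{-1}x_2=1$ and $x_1x_2=\theta x_2x_1$. For a unital associative $k$-algebra $A$ and an integer $g\ge 1$, let $\mathrm{Mat}_g(A)$ be the associative $k$-algebra of $g\times g$ matrices over $A$, let $\mathfrak{gl}_g(A)$ be the Lie algebra over $k$ on $\mathrm{Mat}_g(A)$ with bracket $[x,y]=xy-yx$, and let $\mathfrak{sl}_g(A)=[\mathfrak{gl}_g(A),\mathfrak{gl}_g(A)]$ be its derived algebra. Let $g_1,g_2$ be positive integers and let $\theta_1,\theta_2$ be elements of finite order in $k^\times$. Then the following statements are equivalent: (a) $\mathfrak{sl}_{g_1}(Q(\theta_1))\simeq\mathfrak{sl}_{g_2}(Q(\theta_2))$ as Lie algebras over $k$; (b) $g_1=g_2$, and $\theta_1=\theta_2$ or $\theta_1=\theta_2^{-1}$; (c) $\mathrm{Mat}_{g_1}(Q(\theta_1))\simeq\mathrm{Mat}_{g_2}(Q(\theta_2))$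 as associative $k$-algebras. -/

import Mathlib

/-- The four distinguished generators `x₁, x₂, x₁⁻¹, x₂⁻¹` of a quantum torus in two variables. -/
inductive QuantumTorus.Gen : Type
  | x₁ | x₂ | x₁inv | x₂inv

/-- The defining relations of the quantum torus `Q(θ)`: `x₁ x₁⁻¹ = x₁⁻¹ x₁ = 1`,
`x₂ x₂⁻¹ = x₂⁻¹ x₂ = 1` and `x₁ x₂ = θ x₂ x₁`. -/
inductive QuantumTorus.Rel {k : Type*} [Field k] (θ : kˣ) :
    FreeAlgebra k QuantumTorus.Gen → FreeAlgebra k QuantumTorus.Gen → Prop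
  | x₁_mul_inv :
      QuantumTorus.Rel θ
        (FreeAlgebra.ι k QuantumTorus.Gen.x₁ * FreeAlgebra.ι k QuantumTorus.Gen.x₁inv) 1
  | x₁_inv_mul :
      QuantumTorus.Rel θ
        (FreeAlgebra.ι k QuantumTorus.Gen.x₁inv * FreeAlgebra.ι k QuantumTorus.Gen.x₁) 1
  | x₂_mul_inv :
      QuantumTorus.Rel θ
        (FreeAlgebra.ι k QuantumTorus.Gen.x₂ * FreeAlgebra.ι k QuantumTorus.Gen.x₂inv) 1
  | x₂_inv_mul :
      QuantumTorus.Rel θ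
        (FreeAlgebra.ι k QuantumTorus.Gen.x₂inv * FreeAlgebra.ι k QuantumTorus.Gen.x₂) 1
  | x₁_mul_x₂ :
      QuantumTorus.Rel θ
        (FreeAlgebra.ι k QuantumTorus.Gen.x₁ * FreeAlgebra.ι k QuantumTorus.Gen.x₂)
        ((θ : k) • (FreeAlgebra.ι k QuantumTorus.Gen.x₂ * FreeAlgebra.ι k QuantumTorus.Gen.x₁))

/-- The quantum torus `Q(θ)`: the unital associative `k`-algebra presented by the generators
`x₁, x₂, x₁⁻¹, x₂⁻¹` subject to the relations above. -/
def QuantumTorus {k : Type*} [Field k] (θ : kˣ) : Type _ :=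
  RingQuot (QuantumTorus.Rel θ)

noncomputable instance QuantumTorus.instRing {k : Type*} [Field k] (θ : kˣ) :
    Ring (QuantumTorus θ) :=
  inferInstanceAs (Ring (RingQuot (QuantumTorus.Rel θ)))

noncomputable instance QuantumTorus.instAlgebra {k : Type*} [Field k] (θ : kˣ) :
    Algebra k (QuantumTorus θ) :=
  inferInstanceAs (Algebra k (RingQuot (QuantumTorus.Rel θ)))

attribute [local instance 100] LieRing.ofAssociativeRing

/-- `sl_g(A)` for a unital associative `k`-algebra `A`: the derived algebra of the Lie `k`-algebra
`gl_g(A)`, which is `Mat_g(A)` under the commutator bracket. -/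
noncomputable abbrev specialLinear (k : Type*) [Field k] (g : ℕ) (A : Type*) [Ring A]
    [Algebra k A] : LieIdeal k (Matrix (Fin g) (Fin g) A) :=
  ⁅(⊤ : LieIdeal k (Matrix (Fin g) (Fin g) A)), (⊤ : LieIdeal k (Matrix (Fin g) (Fin g) A))⁆

/-! For (a) ⇒ (b), a Lie isomorphism is first upgraded to an associative isomorphism or
anti-isomorphism of the matrix algebras, and then `g` and `θ` are recovered from the matrix algebra.

Both `Q(θ)` and `Mat_g(Q(θ))` have a basis of invertible elements `u γ`, indexed by an abelian
group, with `u α * u β` a scalar multiple of `u (α + β)`; for matrices these are clock and shift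
matrices times monomials. Let `rad` be the set of exponents `γ` for which `u γ` is central. The `u
γ` with `γ ∈ rad` span the center `Z`, the others span `[A, A]`, so `A = Z ⊕ [A, A]`. Finite order
of `θ` makes `A` free of finite rank over `Z`.

The centroid of `[A, A]` is `Z` (`exists_center_of_centroid`), so a Lie isomorphism `φ` induces an
isomorphism `σ` of centers. Gluing `σ` with `φ`, and `σ` with `-φ`, gives semilinear bijections `G`
and `G'`. Over an algebraic closure of `Frac Z` the algebra becomes simple
(`isSimpleRing_baseChange`), hence a matrix algebra, to which `G` transports the product of the
target. A product on matrices with the usual unit and commutators is the usual one or the twist of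
the opposite one by `negOp` (`Matrix.mul_or_negOp_of_commutator`). Accordingly `G` is multiplicative
or `G'` is antimultiplicative (`map_mul_or_map_mul_rev`). Since `Q(θ)` is isomorphic to its
opposite, the matrix algebras are isomorphic in either case. If `[A, A] = 0`, then `g = 1` and `θ =
1` on both sides.

Given an isomorphism of matrix algebras, ranks over the center give `g₁ = g₂`. The image of the
idempotent `E₀₀` acts on a line, up to central denominators, which yields `p, q ∈ Q(θ₂)` with `p q =
θ₁ q p` (`exists_elements`). Leading exponents in the lexicographically ordered `ℤ²` turn this into
`θ₁ = θ₂ ^ d`, where `d` is, modulo the order, the determinant of the map induced on exponents of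
central units, so `d ≡ ±1` (`eq_or_eq_inv_of_algEquiv`). Conversely, exchanging the generators
inverts `θ`. -/

/-- A basis `u` of a `k`-algebra `A`, indexed by a commutative group `Γ`, which multiplies through a
bimultiplicative cocycle `c`. -/
structure TwistedBasis (k Γ A : Type*) [Field k] [AddCommGroup Γ] [Ring A] [Algebra k A] where
  /-- The underlying basis. -/
  u : Module.Basis Γ k A
  /-- The cocycle. -/
  c : Γ → Γ → k
  c_ne_zero : ∀ α β, c α β ≠ 0
  c_add_left : ∀ α β γ, c (α + β) γ = c α γ * c β γ
  c_add_right : ∀ α β γ, c α (β + γ) = c α β * c α γ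
  u_mul_u : ∀ α β, u α * u β = c α β • u (α + β)

/-! ### Coefficients, center and commutators in a twisted basis. -/

namespace TwistedBasis

variable {k Γ A : Type*} [Field k] [AddCommGroup Γ] [Ring A] [Algebra k A]
  (T : TwistedBasis k Γ A)

lemma c_zero_left (γ : Γ) : T.c 0 γ = 1 := by
  have h := T.c_add_left 0 0 γ
  rw [add_zero] at h
  exact (mul_eq_left₀ (T.c_ne_zero 0 γ)).1 h.symm

lemma c_zero_right (γ : Γ) : T.c γ 0 = 1 := by
  have h := T.c_add_right γ 0 0
  rw [add_zero] at h
  exact (mul_eq_left₀ (T.c_ne_zero γ 0)).1 h.symm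

lemma c_nsmul_left (n : ℕ) (γ δ : Γ) : T.c (n • γ) δ = T.c γ δ ^ n := by
  induction n with
  | zero => simp [T.c_zero_left]
  | succ n ih => rw [succ_nsmul, T.c_add_left, ih, pow_succ]

lemma c_nsmul_right (n : ℕ) (γ δ : Γ) : T.c γ (n • δ) = T.c γ δ ^ n := by
  induction n with
  | zero => simp [T.c_zero_right]
  | succ n ih => rw [succ_nsmul, T.c_add_right, ih, pow_succ]

lemma u_zero : T.u 0 = 1 := by
  have h : LinearMap.mulLeft k (T.u 0) = LinearMap.id := by
    refine T.u.ext fun γ => ?_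
    simp [T.u_mul_u, T.c_zero_left]
  simpa using LinearMap.congr_fun h 1

lemma c_neg_left (γ δ : Γ) : T.c (-γ) δ = (T.c γ δ)⁻¹ := by
  refine eq_inv_of_mul_eq_one_left ?_
  rw [← T.c_add_left, neg_add_cancel, T.c_zero_left]

lemma c_neg_right (γ δ : Γ) : T.c γ (-δ) = (T.c γ δ)⁻¹ := by
  refine eq_inv_of_mul_eq_one_left ?_
  rw [← T.c_add_right, neg_add_cancel, T.c_zero_right]

lemma u_mul_u_neg (γ : Γ) : T.u γ * (T.c γ γ • T.u (-γ)) = 1 := by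
  rw [mul_smul_comm, T.u_mul_u, T.c_neg_right, add_neg_cancel, T.u_zero, smul_smul,
    mul_inv_cancel₀ (T.c_ne_zero _ _), one_smul]

lemma u_neg_mul_u (γ : Γ) : (T.c γ γ • T.u (-γ)) * T.u γ = 1 := by
  rw [smul_mul_assoc, T.u_mul_u, T.c_neg_left, neg_add_cancel, T.u_zero, smul_smul,
    mul_inv_cancel₀ (T.c_ne_zero _ _), one_smul]

lemma isUnit_u (γ : Γ) : IsUnit (T.u γ) :=
  ⟨⟨_, _, T.u_mul_u_neg γ, T.u_neg_mul_u γ⟩, rfl⟩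

lemma nontrivial (T : TwistedBasis k Γ A) : Nontrivial A := nontrivial_of_ne (T.u 0) 0 (T.u.ne_zero 0)

/-- Multiplication by a basis element translates exponents injectively, so each coefficient is only
moved and rescaled. -/
lemma repr_u_mul (γ η : Γ) (x : A) : T.u.repr (T.u γ * x) (γ + η) = T.c γ η * T.u.repr x η := by
  have h : (Finsupp.lapply (γ + η) ∘ₗ T.u.repr.toLinearMap) ∘ₗ LinearMap.mulLeft k (T.u γ) =
      T.c γ η • (Finsupp.lapply η ∘ₗ T.u.repr.toLinearMap) := by
    refine T.u.ext fun δ => ?_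
    by_cases h : δ = η
    · subst h; simp [T.u_mul_u]
    · simp [T.u_mul_u, h]
  simpa using LinearMap.congr_fun h x

lemma repr_mul_u (γ η : Γ) (x : A) : T.u.repr (x * T.u γ) (η + γ) = T.c η γ * T.u.repr x η := by
  have h : (Finsupp.lapply (η + γ) ∘ₗ T.u.repr.toLinearMap) ∘ₗ LinearMap.mulRight k (T.u γ) =
      T.c η γ • (Finsupp.lapply η ∘ₗ T.u.repr.toLinearMap) := by
    refine T.u.ext fun δ => ?_
    by_cases h : δ = η
    · subst h; simp [T.u_mul_u]
    · simp [T.u_mul_u, h]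
  simpa using LinearMap.congr_fun h x

lemma repr_mul (x y : A) (γ : Γ) : T.u.repr (x * y) γ =
    (T.u.repr x).sum fun α a => a * T.c α (γ - α) * T.u.repr y (γ - α) := by
  conv_lhs => rw [← T.u.linearCombination_repr x]
  rw [Finsupp.linearCombination_apply, Finsupp.sum_mul, Finsupp.sum, map_sum,
    Finsupp.finsetSum_apply]
  refine Finset.sum_congr rfl fun α _ => ?_
  have := T.repr_u_mul α (γ - α) y
  rw [add_sub_cancel] at this
  simp only [smul_mul_assoc, map_smul, Finsupp.smul_apply, this, smul_eq_mul, mul_assoc]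

/-- The radical of the commutation pairing of the basis elements. -/
def rad : AddSubgroup Γ where
  carrier := {γ | ∀ δ, T.c γ δ = T.c δ γ}
  zero_mem' δ := by rw [T.c_zero_left, T.c_zero_right]
  add_mem' {α β} hα hβ δ := by rw [T.c_add_left, T.c_add_right, hα, hβ]
  neg_mem' {α} hα δ := by rw [T.c_neg_left, T.c_neg_right, hα]

lemma mem_rad {γ : Γ} : γ ∈ T.rad ↔ ∀ δ, T.c γ δ = T.c δ γ := Iff.rfl

/-- Commuting with `u δ` is a condition on each coefficient separately, so the center is a graded
subspace. -/
lemma mem_center_iff {x : A} :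
    x ∈ Subalgebra.center k A ↔ ∀ γ, T.u.repr x γ ≠ 0 → γ ∈ T.rad := by
  rw [Subalgebra.mem_center_iff]
  constructor
  · intro h γ hγ δ
    have h1 := T.repr_u_mul δ γ x
    rw [h, add_comm, T.repr_mul_u] at h1
    exact mul_right_cancel₀ hγ h1
  · intro h y
    have : LinearMap.mulRight k x = LinearMap.mulLeft k x := by
      refine T.u.ext fun γ => ?_
      refine T.u.repr.injective (Finsupp.ext fun δ => ?_)
      obtain ⟨η, rfl⟩ : ∃ η, δ = γ + η := ⟨δ - γ, by abel⟩
      rw [LinearMap.mulRight_apply, LinearMap.mulLeft_apply, T.repr_u_mul, add_comm,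
        T.repr_mul_u]
      by_cases hη : T.u.repr x η = 0
      · rw [hη, mul_zero, mul_zero]
      · rw [h η hη γ]
    exact LinearMap.congr_fun this y

lemma u_mem_center_iff {γ : Γ} : T.u γ ∈ Subalgebra.center k A ↔ γ ∈ T.rad := by
  rw [T.mem_center_iff]
  constructor
  · intro h
    exact h γ (by simp)
  · intro h δ hδ
    by_cases hd : γ = δ
    · exact hd ▸ h
    · simp [hd] at hδ

lemma u_mul_u_sub (α β : Γ) :
    T.u α * T.u β - T.u β * T.u α = (T.c α β - T.c β α) • T.u (α + β) := by
  rw [T.u_mul_u, T.u_mul_u, add_comm β α, sub_smul]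

/-- If `α + β` is radical, pairing it with `β` and cancelling `c β β` gives `c α β = c β α`, so `u
α` and `u β` commute. -/
lemma repr_mul_sub_eq_zero {γ : Γ} (h : γ ∈ T.rad) (x y : A) :
    T.u.repr (x * y - y * x) γ = 0 := by
  have key : (LinearMap.mul k A - (LinearMap.mul k A).flip).compr₂
      (Finsupp.lapply γ ∘ₗ T.u.repr.toLinearMap) = 0 := by
    refine T.u.ext fun α => T.u.ext fun β => ?_
    have := T.u_mul_u_sub α β
    simp only [LinearMap.compr₂_apply, LinearMap.sub_apply, LinearMap.flip_apply,
      LinearMap.mul_apply', this, LinearMap.comp_apply, LinearEquiv.coe_coe, map_smul,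
      Finsupp.lapply_apply, Module.Basis.repr_self, LinearMap.zero_apply, smul_eq_mul]
    by_cases hab : α + β = γ
    · subst hab
      have h1 := h β
      rw [T.c_add_left, T.c_add_right] at h1
      rw [mul_right_cancel₀ (T.c_ne_zero β β) h1, sub_self, zero_mul]
    · simp [hab]
  simpa using LinearMap.congr_fun (LinearMap.congr_fun key x) y

/-- For `δ` not commuting with `γ`, the commutator of `u (γ - δ)` and `u δ` is a nonzero multiple of
`u γ`. -/
lemma exists_u_eq_sub {γ : Γ} (h : γ ∉ T.rad) : ∃ x y : A, T.u γ = x * y - y * x := by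
  rw [mem_rad] at h
  push Not at h
  obtain ⟨δ, hδ⟩ := h
  have hne : T.c (γ - δ) δ - T.c δ (γ - δ) ≠ 0 := by
    rw [sub_eq_add_neg γ, T.c_add_left, T.c_add_right, T.c_neg_left, T.c_neg_right, ← sub_mul]
    exact mul_ne_zero (sub_ne_zero.2 hδ) (inv_ne_zero (T.c_ne_zero _ _))
  refine ⟨(T.c (γ - δ) δ - T.c δ (γ - δ))⁻¹ • T.u (γ - δ), T.u δ, ?_⟩
  rw [smul_mul_assoc, mul_smul_comm, ← smul_sub, T.u_mul_u_sub, smul_smul, inv_mul_cancel₀ hne,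
    one_smul, sub_add_cancel]

/-- Two proper subgroups do not cover a group. -/
lemma exists_not_commute {α β : Γ} (hα : α ∉ T.rad) (hβ : β ∉ T.rad) :
    ∃ δ, T.c α δ ≠ T.c δ α ∧ T.c β δ ≠ T.c δ β := by
  rw [mem_rad] at hα hβ
  push Not at hα hβ
  obtain ⟨δ₁, h₁⟩ := hα
  obtain ⟨δ₂, h₂⟩ := hβ
  by_cases h₃ : T.c β δ₁ = T.c δ₁ β
  · by_cases h₄ : T.c α δ₂ = T.c δ₂ α
    · refine ⟨δ₁ + δ₂, ?_, ?_⟩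
      · rw [T.c_add_left, T.c_add_right, h₄]
        exact fun h => h₁ (mul_right_cancel₀ (T.c_ne_zero _ _) h)
      · rw [T.c_add_left, T.c_add_right, h₃]
        exact fun h => h₂ (mul_left_cancel₀ (T.c_ne_zero _ _) h)
    · exact ⟨δ₂, h₄, h₂⟩
  · exact ⟨δ₁, h₁, h₃⟩

lemma isUnit_u_mul_u_sub {α β : Γ} (h : T.c α β ≠ T.c β α) :
    IsUnit (T.u α * T.u β - T.u β * T.u α) := by
  rw [T.u_mul_u_sub, ← Units.smul_mk0 (sub_ne_zero.2 h)]
  exact (T.isUnit_u _).smul _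

/-! ### The centroid of the derived algebra. -/

variable [CharZero k]

/-- The support condition for a function satisfying the centroid identity. -/
lemma sub_mem_rad_of_centroid (F : Γ → A) (hF : ∀ γ ∉ T.rad, ∀ η ∈ T.rad, T.u.repr (F γ) η = 0)
    (h : ∀ γ ∉ T.rad, ∀ δ ∉ T.rad,
      F γ * T.u δ - T.u δ * F γ = T.u γ * F δ - F δ * T.u γ)
    {γ η : Γ} (hγ : γ ∉ T.rad) (hη : T.u.repr (F γ) η ≠ 0) : η - γ ∈ T.rad := by
  -- The centroid identity read off at the exponent `η + δ`.
  have coef : ∀ γ ∉ T.rad, ∀ δ ∉ T.rad, ∀ η, T.u.repr (F γ) η * (T.c η δ - T.c δ η) =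
      T.u.repr (F δ) (η + δ - γ) * (T.c γ (η + δ - γ) - T.c (η + δ - γ) γ) := by
    intro γ hγ δ hδ η
    have h1 := congrArg (fun x => T.u.repr x (η + δ)) (h γ hγ δ hδ)
    simp only [map_sub, Finsupp.sub_apply] at h1
    rw [T.repr_mul_u, add_comm η δ, T.repr_u_mul] at h1
    have h2 : δ + η = γ + (η + δ - γ) := by abel
    have h3 : δ + η = (η + δ - γ) + γ := by abel
    rw [h2, T.repr_u_mul, ← h2, h3, T.repr_mul_u] at h1
    linear_combination h1
  -- Taking `δ = γ` equates a quantity with its negative, and `2` is invertible.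
  have comm : ∀ γ ∉ T.rad, ∀ η, T.u.repr (F γ) η ≠ 0 → T.c η γ = T.c γ η := by
    intro γ hγ η hη
    have h1 := coef γ hγ γ hγ η
    rw [add_sub_cancel_right] at h1
    have h2 : (2 * T.u.repr (F γ) η) * (T.c η γ - T.c γ η) = 0 := by linear_combination h1
    have := (mul_eq_zero.1 h2).resolve_left (mul_ne_zero two_ne_zero hη)
    exact sub_eq_zero.1 this
  by_contra hε
  have hη' : η ∉ T.rad := fun hr => hη (hF γ hγ η hr)
  -- With `δ` commuting neither with `η - γ` nor with `η`, `comm` kills the right side of `coef`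
  -- while the left side is nonzero.
  obtain ⟨δ, h1, h2⟩ := T.exists_not_commute hε hη'
  have hδ : δ ∉ T.rad := fun hr => h1 (hr _).symm
  have h3 := coef γ hγ δ hδ η
  have h4 : T.u.repr (F δ) (η + δ - γ) = 0 := by
    by_contra h5
    have h6 := comm δ hδ _ h5
    rw [show η + δ - γ = (η - γ) + δ by abel, T.c_add_left, T.c_add_right] at h6
    exact h1 (mul_right_cancel₀ (T.c_ne_zero _ _) h6)
  rw [h4, zero_mul] at h3
  exact h2 (sub_eq_zero.1 ((mul_eq_zero.1 h3).resolve_left hη))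

/-- The centroid of the derived Lie algebra consists of multiplications by central elements. -/
lemma exists_center_of_centroid (F : Γ → A)
    (hF : ∀ γ ∉ T.rad, ∀ η ∈ T.rad, T.u.repr (F γ) η = 0)
    (h : ∀ γ ∉ T.rad, ∀ δ ∉ T.rad,
      F γ * T.u δ - T.u δ * F γ = T.u γ * F δ - F δ * T.u γ) :
    ∃ z ∈ Subalgebra.center k A, ∀ γ ∉ T.rad, F γ = z * T.u γ := by
  by_cases hne : ∃ γ₀, γ₀ ∉ T.rad
  swap
  · push Not at hne
    exact ⟨0, zero_mem _, fun γ hγ => absurd (hne γ) hγ⟩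
  obtain ⟨γ₀, hγ₀⟩ := hne
  -- The support of `F γ` lies in `γ + rad`, so dividing by `u γ` leaves a central element.
  have hz : ∀ γ ∉ T.rad, ∃ z ∈ Subalgebra.center k A, F γ = z * T.u γ := by
    intro γ hγ
    refine ⟨F γ * (T.c γ γ • T.u (-γ)), ?_, by rw [mul_assoc, T.u_neg_mul_u, mul_one]⟩
    rw [T.mem_center_iff]
    intro ε hε
    rw [mul_smul_comm, map_smul, Finsupp.smul_apply, smul_eq_mul] at hε
    rw [show ε = (ε + γ) + -γ by abel, T.repr_mul_u] at hε
    have := T.sub_mem_rad_of_centroid F hF h hγ (right_ne_zero_of_mul (right_ne_zero_of_mul hε))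
    rwa [add_sub_cancel_right] at this
  -- When `u γ` and `u δ` do not commute, their commutator is a unit, and cancelling it identifies
  -- the two central factors.
  have heq : ∀ γ ∉ T.rad, ∀ δ, T.c γ δ ≠ T.c δ γ → ∀ z ∈ Subalgebra.center k A,
      F γ = z * T.u γ → F δ = z * T.u δ := by
    intro γ hγ δ hγδ z hz1 hz2
    have hδ : δ ∉ T.rad := fun hr => hγδ (hr _).symm
    obtain ⟨w, hw1, hw2⟩ := hz δ hδ
    have h1 := h γ hγ δ hδ
    rw [Subalgebra.mem_center_iff] at hz1 hw1
    have h2 : z * (T.u γ * T.u δ - T.u δ * T.u γ) = w * (T.u γ * T.u δ - T.u δ * T.u γ) := by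
      calc z * (T.u γ * T.u δ - T.u δ * T.u γ) = F γ * T.u δ - T.u δ * F γ := by
            rw [hz2, mul_sub, ← mul_assoc, ← mul_assoc, ← mul_assoc, hz1 (T.u δ)]
        _ = _ := by rw [h1, hw2, mul_sub, ← mul_assoc, ← mul_assoc, ← mul_assoc, hw1 (T.u γ)]
    rw [hw2, (T.isUnit_u_mul_u_sub hγδ).mul_right_cancel h2]
  obtain ⟨z, hz1, hz2⟩ := hz γ₀ hγ₀
  refine ⟨z, hz1, fun γ hγ => ?_⟩
  -- Any two nonradical exponents are linked through a third that commutes with neither.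
  obtain ⟨δ, h1, h2⟩ := T.exists_not_commute hγ₀ hγ
  exact heq δ (fun hr => h1 (hr _).symm) γ h2.symm z hz1 (heq γ₀ hγ₀ δ h1 z hz1 hz2)

end TwistedBasis

/-! ### Freeness over the center and simplicity after base change to a field. -/

open scoped TensorProduct

namespace TwistedBasis

lemma algebraMap_mem_center {k A Z : Type*} [Field k] [Ring A] [Algebra k A] [CommRing Z]
    [Algebra Z A] (z : Z) : algebraMap Z A z ∈ Subalgebra.center k A :=
  Subalgebra.mem_center_iff.2 fun x => (Algebra.commutes z x).symm

lemma exists_algebraMap_eq {k A Z : Type*} [Field k] [Ring A] [Algebra k A] [CommRing Z]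
    [Algebra Z A] [Algebra.IsCentral Z A] {x : A} (hx : x ∈ Subalgebra.center k A) :
    ∃ z : Z, algebraMap Z A z = x := by
  have h : x ∈ Subalgebra.center Z A :=
    Subalgebra.mem_center_iff.2 (Subalgebra.mem_center_iff.1 hx)
  exact Algebra.mem_bot.1 (Algebra.IsCentral.out h)

variable {k Γ A : Type*} [Field k] [AddCommGroup Γ] [Ring A] [Algebra k A]
  {Z : Type*} [CommRing Z] [Algebra Z A]

lemma isUnit_one_tmul_u (K : Type*) [Field K] [Algebra Z K] (T : TwistedBasis k Γ A) (γ : Γ) :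
    IsUnit ((1 : K) ⊗ₜ[Z] T.u γ) :=
  (T.isUnit_u γ).map (Algebra.TensorProduct.includeRight : A →ₐ[Z] K ⊗[Z] A)

lemma u_mul_u_comm [Algebra k Z] [IsScalarTower k Z A] (T : TwistedBasis k Γ A) (γ δ : Γ) :
    T.u δ * T.u γ = algebraMap k Z (T.c δ γ / T.c γ δ) • (T.u γ * T.u δ) := by
  rw [algebraMap_smul, T.u_mul_u, T.u_mul_u, smul_smul, div_mul_cancel₀ _ (T.c_ne_zero _ _),
    add_comm]

variable [FaithfulSMul Z A] [Algebra.IsCentral Z A] [Algebra k Z] [IsScalarTower k Z A]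
  (T : TwistedBasis k Γ A)

-- Central coefficients are supported in `rad`, so terms from different cosets have disjoint
-- supports.
omit [Algebra.IsCentral Z A] [Algebra k Z] [IsScalarTower k Z A] in
lemma linearIndependent_center :
    LinearIndependent Z (fun q : Γ ⧸ T.rad => T.u q.out) := by
  rw [linearIndependent_iff']
  intro S z hz q₀ hq₀
  refine FaithfulSMul.algebraMap_injective Z A (T.u.repr.injective (Finsupp.ext fun η => ?_))
  rw [map_zero, map_zero, Finsupp.zero_apply]
  by_contra hne
  have hη : η ∈ T.rad := T.mem_center_iff.1 (algebraMap_mem_center (z q₀)) η hne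
  have h1 := congrArg (fun x => T.u.repr x (η + q₀.out)) hz
  simp only [map_sum, Finsupp.finsetSum_apply, map_zero, Finsupp.zero_apply] at h1
  rw [Finset.sum_eq_single q₀] at h1
  · rw [Algebra.smul_def, T.repr_mul_u] at h1
    exact mul_ne_zero (T.c_ne_zero _ _) hne h1
  · intro q _ hq
    rw [Algebra.smul_def,
      show η + q₀.out = (η + q₀.out - q.out) + q.out by abel, T.repr_mul_u]
    by_contra h2
    have h3 := T.mem_center_iff.1 (algebraMap_mem_center (z q)) _ (right_ne_zero_of_mul h2)
    rw [add_sub_assoc, AddSubgroup.add_mem_cancel_left _ hη] at h3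
    refine hq ?_
    rw [← QuotientAddGroup.out_eq' q, ← QuotientAddGroup.out_eq' q₀, QuotientAddGroup.eq]
    simpa [neg_add_eq_sub] using h3
  · exact fun h => absurd hq₀ h

lemma out_sub_mem_rad (γ : Γ) : γ - (γ : Γ ⧸ T.rad).out ∈ T.rad := by
  have h : (((γ : Γ ⧸ T.rad).out : Γ) : Γ ⧸ T.rad) = (γ : Γ ⧸ T.rad) :=
    QuotientAddGroup.out_eq' _
  rw [QuotientAddGroup.eq, neg_add_eq_sub] at h
  exact h

omit [FaithfulSMul Z A] in
lemma span_center (T : TwistedBasis k Γ A) :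
    ⊤ ≤ Submodule.span Z (Set.range fun q : Γ ⧸ T.rad => T.u q.out) := by
  intro x _
  have h : (⊤ : Submodule k A) ≤ (Submodule.span Z
      (Set.range fun q : Γ ⧸ T.rad => T.u q.out)).restrictScalars k := by
    rw [← T.u.span_eq, Submodule.span_le]
    rintro _ ⟨γ, rfl⟩
    obtain ⟨z, hz⟩ := exists_algebraMap_eq (Z := Z) <| T.u_mem_center_iff.2 (T.out_sub_mem_rad γ)
    -- Up to a scalar, `u γ` is a central basis element times the one at the chosen representative
    -- of the class of `γ`.
    have h1 : T.u γ = (T.c (γ - (γ : Γ ⧸ T.rad).out) (γ : Γ ⧸ T.rad).out)⁻¹ •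
        z • T.u (γ : Γ ⧸ T.rad).out := by
      rw [Algebra.smul_def z, hz, T.u_mul_u, smul_smul,
        inv_mul_cancel₀ (T.c_ne_zero _ _), one_smul, sub_add_cancel]
    rw [h1]
    refine Submodule.smul_mem _ _ ?_
    exact Submodule.smul_mem (Submodule.span Z _) _
      (Submodule.subset_span ⟨_, rfl⟩)
  exact h trivial

/-- The basis over the center formed by representatives of the classes modulo the radical. -/
noncomputable def centerBasis : Module.Basis (Γ ⧸ T.rad) Z A :=
  Module.Basis.mk T.linearIndependent_center T.span_center

lemma centerBasis_apply (q : Γ ⧸ T.rad) : T.centerBasis (Z := Z) q = T.u q.out := by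
  simp [centerBasis]

section Simple

variable (K : Type*) [Field K] [Algebra Z K]

/-- Conjugation by `u δ` is diagonal in the basis over the center. As `δ` varies, its eigenvalues
separate the classes modulo `rad`, which allows elements of an ideal to be shortened. -/
lemma tmul_u_mul (x : K ⊗[Z] A) (δ : Γ) (q : Γ ⧸ T.rad) :
    (Algebra.TensorProduct.basis K (T.centerBasis (Z := Z))).repr
      ((1 ⊗ₜ T.u δ) * x * (1 ⊗ₜ (T.c δ δ • T.u (-δ)))) q =
    algebraMap Z K (algebraMap k _ (T.c δ q.out / T.c q.out δ)) *
      (Algebra.TensorProduct.basis K (T.centerBasis (Z := Z))).repr x q := by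
  set b := Algebra.TensorProduct.basis K (T.centerBasis (Z := Z))
  have hb : ∀ r, b r = 1 ⊗ₜ T.u r.out := fun r => by
    rw [Algebra.TensorProduct.basis_apply, centerBasis_apply]
  have h : (Finsupp.lapply q ∘ₗ b.repr.toLinearMap) ∘ₗ
      (LinearMap.mulRight K (1 ⊗ₜ (T.c δ δ • T.u (-δ)))) ∘ₗ LinearMap.mulLeft K (1 ⊗ₜ T.u δ) =
      algebraMap Z K (algebraMap k _ (T.c δ q.out / T.c q.out δ)) •
        (Finsupp.lapply q ∘ₗ b.repr.toLinearMap) := by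
    refine b.ext fun r => ?_
    have h1 : (1 ⊗ₜ T.u δ) * b r * (1 ⊗ₜ (T.c δ δ • T.u (-δ))) =
      algebraMap Z K (algebraMap k _ (T.c δ r.out / T.c r.out δ)) • b r := by
      rw [hb, Algebra.TensorProduct.tmul_mul_tmul, Algebra.TensorProduct.tmul_mul_tmul,
        u_mul_u_comm (Z := Z), smul_mul_assoc, mul_assoc (T.u r.out), u_mul_u_neg, mul_one, mul_one, mul_one,
        TensorProduct.tmul_smul, algebraMap_smul K]
    simp only [LinearMap.comp_apply, LinearMap.mulLeft_apply, LinearMap.mulRight_apply, h1,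
      LinearMap.smul_apply, LinearEquiv.coe_coe, map_smul, Module.Basis.repr_self,
      Finsupp.lapply_apply, smul_eq_mul]
    by_cases hr : r = q
    · rw [hr]
    · simp [hr]
  exact LinearMap.congr_fun h x

/-- Induction on the size of the support: an element meeting two classes can be replaced by a
shorter nonzero one in the ideal, and an element supported on one class is a unit. -/
lemma one_mem_of_mem (T : TwistedBasis k Γ A) (I : TwoSidedIdeal (K ⊗[Z] A)) (n : ℕ) :
    ∀ x ∈ I, x ≠ 0 →
      ((Algebra.TensorProduct.basis K (T.centerBasis (Z := Z))).repr x).support.card = n → 1 ∈ I := by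
  classical
  set b := Algebra.TensorProduct.basis K (T.centerBasis (Z := Z))
  induction n using Nat.strong_induction_on with
  | _ n ih =>
  intro x hx hx0 hn
  have hs : (b.repr x).support.Nonempty := by
    rw [Finsupp.support_nonempty_iff]
    simpa using hx0
  obtain ⟨q, hq⟩ := hs
  by_cases hex : ∃ q' ∈ (b.repr x).support, q' ≠ q
  · obtain ⟨q', hq', hne⟩ := hex
    have h1 : q'.out - q.out ∉ T.rad := by
      intro h
      refine hne ?_
      rw [← QuotientAddGroup.out_eq' q, ← QuotientAddGroup.out_eq' q', eq_comm,
        QuotientAddGroup.eq]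
      simpa [neg_add_eq_sub] using h
    rw [mem_rad] at h1
    push Not at h1
    obtain ⟨δ, hδ⟩ := h1
    set κ : Γ ⧸ T.rad → K := fun r =>
      algebraMap Z K (algebraMap k _ (T.c δ r.out / T.c r.out δ)) with hκ
    have hκne : κ q' ≠ κ q := by
      intro h
      have h2 : T.c δ q'.out / T.c q'.out δ = T.c δ q.out / T.c q.out δ :=
        ((algebraMap Z K).comp
          (algebraMap k Z)).injective h
      rw [div_eq_div_iff (T.c_ne_zero _ _) (T.c_ne_zero _ _)] at h2
      refine hδ ?_
      rw [sub_eq_add_neg, T.c_add_left, T.c_add_right, T.c_neg_left, T.c_neg_right,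
        ← div_eq_mul_inv, ← div_eq_mul_inv, div_eq_div_iff (T.c_ne_zero _ _) (T.c_ne_zero _ _)]
      linear_combination -h2
    -- This combination kills the coefficient at `q` and keeps the one at `q'`.
    set y := (1 ⊗ₜ T.u δ) * x * (1 ⊗ₜ (T.c δ δ • T.u (-δ))) - κ q • x with hy
    have hyr : ∀ r, b.repr y r = (κ r - κ q) * b.repr x r := by
      intro r
      rw [hy, map_sub, map_smul, Finsupp.sub_apply, T.tmul_u_mul, Finsupp.smul_apply, smul_eq_mul,
        sub_mul]
    have hyI : y ∈ I := by
      refine I.sub_mem (I.mul_mem_right _ _ (I.mul_mem_left _ _ hx)) ?_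
      rw [← one_mul x, ← smul_mul_assoc]
      exact I.mul_mem_left _ _ hx
    refine ih _ ?_ y hyI ?_ rfl
    · rw [← hn]
      refine Finset.card_lt_card ⟨fun r hr => ?_, fun h => ?_⟩
      · rw [Finsupp.mem_support_iff, hyr] at hr
        exact Finsupp.mem_support_iff.2 (right_ne_zero_of_mul hr)
      · have := h hq
        rw [Finsupp.mem_support_iff, hyr, sub_self, zero_mul] at this
        exact this rfl
    · intro h0
      have := hyr q'
      rw [h0, map_zero, Finsupp.zero_apply] at this
      exact mul_ne_zero (sub_ne_zero.2 hκne) (Finsupp.mem_support_iff.1 hq') this.symm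
  · push Not at hex
    have h1 : x = b.repr x q • b q := by
      conv_lhs => rw [← b.linearCombination_repr x]
      rw [Finsupp.linearCombination_apply, Finsupp.sum,
        Finset.sum_eq_single q (fun r hr hrq => absurd (hex r hr) hrq) (fun h => absurd hq h)]
    have hb : b q = 1 ⊗ₜ T.u q.out := by
      rw [Algebra.TensorProduct.basis_apply, centerBasis_apply]
    have hu : IsUnit x := by
      rw [h1, hb, ← Units.smul_mk0 (Finsupp.mem_support_iff.1 hq)]
      exact (T.isUnit_one_tmul_u K _).smul _
    obtain ⟨v, hv⟩ := hu.exists_left_inv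
    rw [← hv]
    exact I.mul_mem_left _ _ hx

lemma isSimpleRing_baseChange (T : TwistedBasis k Γ A) :
    IsSimpleRing (K ⊗[Z] A) := by
  have hb := Algebra.TensorProduct.basis K (T.centerBasis (Z := Z))
  have hnt : Nontrivial (K ⊗[Z] A) :=
    nontrivial_of_ne (hb 0) 0 (hb.ne_zero 0)
  refine ⟨⟨fun I => ?_⟩⟩
  by_cases h : I = ⊥
  · exact Or.inl h
  · right
    obtain ⟨x, hx, hx0⟩ : ∃ x ∈ I, x ≠ 0 := by
      by_contra hcon
      push Not at hcon
      refine h (le_bot_iff.1 fun x hx => ?_)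
      rw [TwoSidedIdeal.mem_bot]
      exact hcon x hx
    have h1 := T.one_mem_of_mem K I _ x hx hx0 rfl
    rw [← top_le_iff]
    intro y _
    rw [← mul_one y]
    exact I.mul_mem_left _ _ h1

end Simple

end TwistedBasis

/-! ### Associative products on matrices with the usual unit and commutators. -/

namespace Matrix

variable {K ι : Type*} [Field K] [CharZero K] [Fintype ι] [DecidableEq ι]

/-- A subspace containing `E_qp` and stable under the adjoint action of the centralizer of `E_pq`
contains every traceless matrix. -/
lemma mem_of_trace_eq_zero {p q : ι} (hpq : p ≠ q) (S : Submodule K (Matrix ι ι K))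
    (h0 : single q p 1 ∈ S)
    (hS : ∀ z, z * single p q 1 = single p q 1 * z → ∀ y ∈ S, z * y - y * z ∈ S)
    {x : Matrix ι ι K} (hx : x.trace = 0) : x ∈ S := by
  have hqp := hpq.symm
  have hH : single p p 1 - single q q 1 ∈ S := by
    simpa using hS (single p q 1) rfl _ h0
  have hpqS : single p q 1 ∈ S := by
    have h := hS (single p q 1) rfl _ hH
    have h2 : single p q (1 : K) = (-(1 / 2) : K) • (single p q 1 * (single p p 1 - single q q 1) -
        (single p p 1 - single q q 1) * single p q 1) := by
      simp only [mul_sub, sub_mul, single_mul_single_same, single_mul_single_of_ne _ _ _ _ hqp,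
        mul_one]
      module
    rw [h2]
    exact S.smul_mem _ h
  have h1 : ∀ j, j ≠ p → j ≠ q → single q j 1 ∈ S := by
    intro j hjp hjq
    have h := hS (single p j 1) (by simp [hjp, hqp]) _ h0
    simp only [single_mul_single_same, single_mul_single_of_ne _ _ _ _ hjq, mul_one, zero_sub] at h
    simpa using S.neg_mem h
  have h2 : ∀ i, i ≠ p → i ≠ q → single i p 1 ∈ S := by
    intro i hip hiq
    have h := hS (single i q 1) (by simp [hiq.symm, hqp]) _ h0
    simpa only [single_mul_single_same, single_mul_single_of_ne _ _ _ _ hip.symm, mul_one,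
      sub_zero] using h
  -- These matrices span the traceless ones. Each is reached from `E_qp` by brackets with matrix
  -- units commuting with `E_pq`.
  have hF : ∀ i j, single i j 1 - (if i = j then single q q 1 else 0) ∈ S := by
    intro i j
    by_cases hip : i = p
    · subst hip
      by_cases hj : i = j
      · subst hj
        simpa using hH
      rw [if_neg hj, sub_zero]
      by_cases hjq : j = q
      · exact hjq ▸ hpqS
      · have h := hS (single i q 1) rfl _ (h1 j (Ne.symm hj) hjq)
        simpa only [single_mul_single_same, single_mul_single_of_ne _ _ _ _ (Ne.symm hj), mul_one,
          sub_zero] using h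
    by_cases hiq : i = q
    · subst hiq
      by_cases hj : i = j
      · subst hj; simp
      rw [if_neg hj, sub_zero]
      by_cases hjp : j = p
      · exact hjp ▸ h0
      · exact h1 j hjp (Ne.symm hj)
    by_cases hjp : j = p
    · subst hjp
      rw [if_neg hip, sub_zero]
      exact h2 i hip hiq
    by_cases hjq : j = q
    · subst hjq
      have h := hS (single p j 1) rfl _ (h2 i hip hiq)
      simp only [single_mul_single_same, single_mul_single_of_ne _ _ _ _ (Ne.symm hiq), mul_one,
        zero_sub] at h
      rw [if_neg hiq, sub_zero]
      simpa using S.neg_mem h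
    · have h := hS (single i q 1) (by simp [Ne.symm hiq, hqp]) _ (h1 j hjp hjq)
      rw [single_mul_single_same, mul_one] at h
      by_cases hij : i = j
      · subst hij
        simpa using h
      · simpa [hij, single_mul_single_of_ne _ _ _ _ (Ne.symm hij)] using h
  have hx' : x = ∑ i, ∑ j, x i j • (single i j 1 - (if i = j then single q q (1 : K) else 0)) := by
    simp only [smul_sub, Finset.sum_sub_distrib, smul_ite, smul_zero, Finset.sum_ite_eq,
      Finset.mem_univ, if_true, ← Finset.sum_smul]
    rw [show ∑ i, x i i = 0 from hx, zero_smul, sub_zero]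
    conv_lhs => rw [matrix_eq_sum_single x]
    simp
  rw [hx']
  exact S.sum_mem fun i _ => S.sum_mem fun j _ => S.smul_mem _ (hF i j)

/-- A bilinear map, equivariant for the adjoint action and vanishing on `(E_pq, E_qp)`, vanishes on
traceless matrices. -/
lemma bilin_eq_zero_of_equivariant {p q : ι} (hpq : p ≠ q)
    (f : Matrix ι ι K →ₗ[K] Matrix ι ι K →ₗ[K] Matrix ι ι K)
    (hf : ∀ z x y, z * f x y - f x y * z = f (z * x - x * z) y + f x (z * y - y * z))
    (h0 : f (single p q 1) (single q p 1) = 0) {x y : Matrix ι ι K} (hx : x.trace = 0)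
    (hy : y.trace = 0) : f x y = 0 := by
  -- By equivariance the kernel of `f E_pq` is stable under the centralizer of `E_pq`, and it
  -- contains `E_qp`.
  have h1 : ∀ y : Matrix ι ι K, y.trace = 0 → f (single p q 1) y = 0 := by
    intro y hy
    refine mem_of_trace_eq_zero hpq (LinearMap.ker (f (single p q 1))) h0 ?_ hy
    intro z hz y hy
    rw [LinearMap.mem_ker] at hy ⊢
    have := hf z (single p q 1) y
    rw [hz, sub_self, hy, map_zero, mul_zero, zero_mul, sub_zero, LinearMap.zero_apply,
      zero_add] at this
    exact this.symm
  let S : Submodule K (Matrix ι ι K) :=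
    { carrier := {x | ∀ y : Matrix ι ι K, y.trace = 0 → f x y = 0}
      add_mem' := fun {a b} ha hb y hy => by
        rw [map_add, LinearMap.add_apply, ha y hy, hb y hy, add_zero]
      zero_mem' := fun y _ => by simp
      smul_mem' := fun c a ha y hy => by
        rw [map_smul, LinearMap.smul_apply, ha y hy, smul_zero] }
  have hS : ∀ z, ∀ x ∈ S, z * x - x * z ∈ S := by
    intro z x hx y hy
    have h2 := hf z x y
    rw [hx y hy, hx (z * y - y * z) (by rw [trace_sub, trace_mul_comm, sub_self])] at h2
    simpa using h2.symm
  have hqp := hpq.symm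
  have hpqS : single p q 1 ∈ S := h1
  -- Bracketing `E_pq` twice with `E_qp` gives `-2 E_qp`.
  have hqpS : single q p 1 ∈ S := by
    have h := hS (single q p 1) _ (hS (single q p 1) _ hpqS)
    have h2 : single q p (1 : K) = (-(1 / 2) : K) • (single q p 1 * (single q p 1 * single p q 1 -
        single p q 1 * single q p 1) - (single q p 1 * single p q 1 -
        single p q 1 * single q p 1) * single q p 1) := by
      simp only [mul_sub, sub_mul, single_mul_single_same, single_mul_single_of_ne _ _ _ _ hpq,
        mul_one]
      module
    rw [h2]
    exact S.smul_mem _ h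
  exact mem_of_trace_eq_zero hpq S hqpS (fun z _ y hy => hS z y hy) hx y hy

-- Commuting with the `E_ii` forces `h` to be diagonal, and commuting with the `E_ij` away from `p,
-- q` makes the remaining diagonal entries equal. If `p, q` are the only indices, `E_pp`, `E_qq` and
-- `1` are dependent, and `β = 0` is a normalisation.
omit [CharZero K] in
lemma exists_diag_of_commute {p q : ι} (hpq : p ≠ q) (h : Matrix ι ι K)
    (hd : ∀ i, single i i 1 * h = h * single i i 1)
    (hc : ∀ i j, i ≠ p → i ≠ q → j ≠ p → j ≠ q → single i j 1 * h = h * single i j 1) :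
    ∃ α β γ : K, h = α • single p p 1 + β • single q q 1 + γ • 1 ∧
      ((∀ r, r = p ∨ r = q) → β = 0) := by
  have hoff : ∀ i j, i ≠ j → h i j = 0 := by
    intro i j hij
    have := congrFun (congrFun (hd i) i) j
    simpa [mul_single_apply_of_ne (hbj := hij.symm)] using this
  by_cases hr : ∃ r, r ≠ p ∧ r ≠ q
  · obtain ⟨r, hrp, hrq⟩ := hr
    refine ⟨h p p - h r r, h q q - h r r, h r r, ?_, fun H => (H r).elim (absurd · hrp) (absurd · hrq)⟩
    ext i j
    by_cases hij : i = j
    · subst hij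
      by_cases hip : i = p
      · subst hip; simp [hpq.symm]
      by_cases hiq : i = q
      · subst hiq; simp [hpq]
      have := congrFun (congrFun (hc r i hrp hrq hip hiq) r) i
      simp only [single_mul_apply_same, mul_single_apply_same, one_mul, mul_one] at this
      simp [Ne.symm hip, Ne.symm hiq, this]
    · rw [hoff i j hij]
      simp only [add_apply, smul_apply, one_apply_ne hij, single_apply, smul_eq_mul]
      rw [if_neg (fun h => hij (h.1.symm.trans h.2)), if_neg (fun h => hij (h.1.symm.trans h.2))]
      simp
  · push Not at hr
    refine ⟨h p p - h q q, 0, h q q, ?_, fun _ => rfl⟩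
    ext i j
    by_cases hij : i = j
    · subst hij
      by_cases hip : i = p
      · subst hip; simp
      obtain rfl := hr i hip
      simp [hpq]
    · rw [hoff i j hij]
      simp only [add_apply, smul_apply, one_apply_ne hij, single_apply, smul_eq_mul]
      rw [if_neg (fun h => hij (h.1.symm.trans h.2)), if_neg (fun h => hij (h.1.symm.trans h.2))]
      simp

/-- An equivariant bilinear product of traceless matrices is a combination of the two
multiplications and the trace form. -/
lemma exists_bilin_eq {p q : ι} (hpq : p ≠ q)
    (m : Matrix ι ι K →ₗ[K] Matrix ι ι K →ₗ[K] Matrix ι ι K)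
    (hm : ∀ z x y, z * m x y - m x y * z = m (z * x - x * z) y + m x (z * y - y * z)) :
    ∃ α β γ : K, (∀ x y : Matrix ι ι K, x.trace = 0 → y.trace = 0 →
      m x y = α • (x * y) + β • (y * x) + (γ * (x * y).trace) • 1) ∧
      ((∀ r, r = p ∨ r = q) → β = 0) := by
  have hqp := hpq.symm
  -- Each `E_ii` acts on `E_pq` and `E_qp` with opposite weights, so the two contributions to the
  -- equivariance identity cancel.
  obtain ⟨α, β, γ, h1, h2⟩ := exists_diag_of_commute hpq (m (single p q 1) (single q p 1))
    (by
      intro i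
      rw [← sub_eq_zero, hm]
      by_cases hip : i = p
      · subst hip; simp [hpq, hqp]
      by_cases hiq : i = q
      · subst hiq; simp [hpq, hqp]
      simp [hip, hiq, Ne.symm hip, Ne.symm hiq])
    (by
      intro i j hip hiq hjp hjq
      rw [← sub_eq_zero, hm]
      simp [hjp, hjq, Ne.symm hip, Ne.symm hiq])
  refine ⟨α, β, γ, fun x y hx hy => ?_, h2⟩
  -- The equivariant products `xy`, `yx` and `tr(xy) 1` take the values `E_pp`, `E_qq` and `1` at
  -- `(E_pq, E_qp)`, so this difference vanishes there.
  let f : Matrix ι ι K →ₗ[K] Matrix ι ι K →ₗ[K] Matrix ι ι K :=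
    m - α • LinearMap.mul K _ - β • (LinearMap.mul K _).flip -
      γ • (LinearMap.mul K (Matrix ι ι K)).compr₂
        ((LinearMap.toSpanSingleton K (Matrix ι ι K) 1) ∘ₗ traceLinearMap ι K K)
  have hf : ∀ x y, f x y = m x y - α • (x * y) - β • (y * x) - γ • (x * y).trace • 1 :=
    fun x y => rfl
  have := bilin_eq_zero_of_equivariant hpq f ?_ ?_ hx hy
  · rw [hf] at this
    rw [mul_smul, ← sub_eq_zero, ← this]
    abel
  · intro z x y
    have ht : ((z * x - x * z) * y).trace = - (x * (z * y - y * z)).trace := by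
      rw [sub_mul, mul_sub, trace_sub, trace_sub, mul_assoc, trace_mul_comm z, mul_assoc, mul_assoc]
      ring
    simp only [hf]
    rw [ht, eq_sub_of_add_eq (hm z x y).symm]
    simp only [mul_sub, sub_mul, smul_sub, mul_smul_comm, smul_mul_assoc, mul_one, one_mul,
      neg_smul, smul_neg, mul_assoc]
    abel
  · rw [hf, h1]
    simp
    abel

variable (m : Matrix ι ι K →ₗ[K] Matrix ι ι K →ₗ[K] Matrix ι ι K)

/-- An associative product on matrices, with the usual unit and commutators, is either the usual
product or comes from the opposite product. -/
theorem mul_or_op_of_commutator (h1l : ∀ x, m 1 x = x) (h1r : ∀ x, m x 1 = x)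
    (ha : ∀ x y z, m (m x y) z = m x (m y z)) (hc : ∀ x y, m x y - m y x = x * y - y * x) :
    (∀ x y, m x y = x * y) ∨ (∀ x y : Matrix ι ι K, x.trace = 0 → y.trace = 0 →
      m x y = - (y * x) + (2 / (Fintype.card ι : K) * (x * y).trace) • 1) := by
  by_cases hs : ∃ p q : ι, p ≠ q
  swap
  · push Not at hs
    left
    intro x y
    have hx : ∃ a : K, x = a • 1 := by
      by_cases hne : Nonempty ι
      · obtain ⟨i⟩ := hne
        refine ⟨x i i, ?_⟩
        ext j l
        rw [hs j i, hs l i]; simp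
      · refine ⟨0, ?_⟩
        ext j; exact absurd ⟨j⟩ hne
    obtain ⟨a, rfl⟩ := hx
    simp [h1l]
  obtain ⟨p, q, hpq⟩ := hs
  have hqp := hpq.symm
  -- The bracket with `z` is also the commutator for `m`, hence a derivation of the associative
  -- product `m`.
  have hm : ∀ z x y, z * m x y - m x y * z = m (z * x - x * z) y + m x (z * y - y * z) := by
    intro z x y
    rw [← hc, ← hc, ← hc, map_sub, map_sub, LinearMap.sub_apply, ha, ha, ha]
    abel
  obtain ⟨α, β, γ, h, hβ⟩ := exists_bilin_eq hpq m hm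
  have htr : ∀ i j : ι, i ≠ j → (single i j (1 : K)).trace = 0 := fun i j hij => by
    simp [hij]
  have hn0 : (Fintype.card ι : K) ≠ 0 := by
    have : Nonempty ι := ⟨p⟩
    exact_mod_cast Fintype.card_ne_zero
  have hαβ1 : α - β = 1 := by
    have h1 := hc (single p q 1) (single q p 1)
    rw [h _ _ (htr _ _ hpq) (htr _ _ hqp), h _ _ (htr _ _ hqp) (htr _ _ hpq)] at h1
    have h2 := congrFun (congrFun h1 p) p
    simpa [single_apply, hpq, hqp] using h2
  -- With a third index `r`, this is the `(r, r)` entry of associativity on `E_pq, E_qr, E_rp`.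
  have hαβ : α * β = 0 := by
    by_cases hr : ∀ r, r = p ∨ r = q
    · rw [hβ hr, mul_zero]
    push Not at hr
    obtain ⟨r, hrp, hrq⟩ := hr
    have h1 := ha (single p q 1) (single q r 1) (single r p 1)
    rw [h _ _ (htr _ _ hpq) (htr _ _ hrq.symm), h _ _ (htr _ _ hrq.symm) (htr _ _ hrp)] at h1
    simp only [single_mul_single_same, single_mul_single_of_ne _ _ _ _ hrp,
      single_mul_single_of_ne _ _ _ _ hpq, htr _ _ hrp.symm, htr _ _ hqp, mul_one, smul_zero,
      add_zero, mul_zero, zero_smul, map_smul, LinearMap.smul_apply] at h1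
    rw [h _ _ (htr _ _ hrp.symm) (htr _ _ hrp), h _ _ (htr _ _ hpq) (htr _ _ hqp)] at h1
    have h2 := congrFun (congrFun h1 r) r
    simpa [single_apply, hrp, hrq, Ne.symm hrp, Ne.symm hrq, mul_add] using h2
  have hdec : ∀ x : Matrix ι ι K, ∃ x₀ : Matrix ι ι K, x₀.trace = 0 ∧
      x = x₀ + (x.trace / (Fintype.card ι : K)) • 1 := by
    intro x
    refine ⟨x - (x.trace / (Fintype.card ι : K)) • 1, ?_, by abel⟩
    rw [trace_sub, trace_smul, trace_one, smul_eq_mul, div_mul_cancel₀ _ hn0, sub_self]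
  -- This is the `(p, q)` entry of associativity on `E_pq, E_pq, E_qp`. There `m` meets diagonal
  -- matrices with nonzero trace, which `hdiag` splits into traceless and scalar parts.
  have hγ : γ = 2 * β ^ 2 / (Fintype.card ι : K) := by
    have hdiag : ∀ i, m (single p q 1) (single i i 1) =
        α • (single p q 1 * single i i 1) + β • (single i i 1 * single p q 1) +
          ((1 - α - β) / (Fintype.card ι : K)) • single p q 1 := by
      intro i
      obtain ⟨x₀, hx₀, hx⟩ := hdec (single i i (1 : K))
      rw [trace_single_eq_same] at hx
      have hx' := sub_eq_iff_eq_add.2 hx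
      have htx : (single p q 1 * x₀).trace = 0 := by
        rw [← hx']
        by_cases hqi : q = i
        · subst hqi; simp [mul_sub, hpq]
        · simp [mul_sub, hqi, hpq]
      conv_lhs => rw [hx]
      rw [map_add, map_smul, h1r, h _ _ (htr _ _ hpq) hx₀, htx, ← hx']
      simp only [mul_sub, sub_mul, mul_smul_comm, smul_mul_assoc, mul_one, one_mul]
      module
    have h1 := ha (single p q 1) (single p q 1) (single q p 1)
    rw [h _ _ (htr _ _ hpq) (htr _ _ hpq), h _ _ (htr _ _ hpq) (htr _ _ hqp)] at h1
    simp only [single_mul_single_same, single_mul_single_of_ne _ _ _ _ hqp, trace_zero, mul_one,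
      smul_zero, add_zero, mul_zero, zero_smul, map_smul, map_add, map_zero, LinearMap.zero_apply,
      h1r, hdiag, trace_single_eq_same] at h1
    have h2 := congrFun (congrFun h1 p) q
    simp at h2
    have h3 : 1 - α - β = - 2 * β := by linear_combination -hαβ1
    rw [h3] at h2
    field_simp at h2 ⊢
    linear_combination -h2 + (2 - 2 * Fintype.card ι : K) * hαβ
  rcases mul_eq_zero.1 hαβ with h0 | h0
  · right
    have hb : β = -1 := by linear_combination h0 - hαβ1
    intro x y hx hy
    rw [h x y hx hy, h0, hγ, hb]
    simp
  · left
    have hb : α = 1 := by linear_combination h0 + hαβ1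
    intro x y
    have hγ0 : γ = 0 := by rw [hγ, h0]; simp
    obtain ⟨x₀, hx₀, hx⟩ := hdec x
    obtain ⟨y₀, hy₀, hy⟩ := hdec y
    rw [hx, hy]
    simp only [map_add, LinearMap.add_apply, map_smul, LinearMap.smul_apply, h1l, h1r,
      h _ _ hx₀ hy₀, h0, hb, hγ0, mul_add, add_mul, smul_mul_assoc, mul_smul_comm, mul_one, one_mul]
    simp

/-- The negated opposite of a matrix, normalised to fix scalar matrices. -/
noncomputable def negOp (K ι : Type*) [Field K] [Fintype ι] [DecidableEq ι] :
    Matrix ι ι K →ₗ[K] Matrix ι ι K :=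
  (2 / (Fintype.card ι : K)) • (LinearMap.toSpanSingleton K (Matrix ι ι K) 1) ∘ₗ
    traceLinearMap ι K K - LinearMap.id

omit [CharZero K] in
lemma negOp_apply (x : Matrix ι ι K) :
    negOp K ι x = (2 / (Fintype.card ι : K)) • x.trace • 1 - x := rfl

lemma negOp_one [Nonempty ι] : negOp K ι 1 = 1 := by
  have hn0 : (Fintype.card ι : K) ≠ 0 := by exact_mod_cast Fintype.card_ne_zero
  rw [negOp_apply, trace_one, smul_smul, div_mul_cancel₀ _ hn0]
  module

/-- `negOp` is `-1` on traceless matrices and the identity on scalars, like the map glued from `σ`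
and `-φ`. In the second case it carries the opposite product to `m`. -/
theorem mul_or_negOp_of_commutator [Nonempty ι] (h1l : ∀ x, m 1 x = x) (h1r : ∀ x, m x 1 = x)
    (ha : ∀ x y z, m (m x y) z = m x (m y z)) (hc : ∀ x y, m x y - m y x = x * y - y * x) :
    (∀ x y, m x y = x * y) ∨
      (∀ x y : Matrix ι ι K, m (negOp K ι y) (negOp K ι x) = negOp K ι (x * y)) := by
  refine (mul_or_op_of_commutator m h1l h1r ha hc).imp_right fun h x y => ?_
  have hn0 : (Fintype.card ι : K) ≠ 0 := by exact_mod_cast Fintype.card_ne_zero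
  have hdec : ∀ x : Matrix ι ι K, ∃ (x₀ : Matrix ι ι K) (s : K), x₀.trace = 0 ∧
      x = x₀ + s • 1 := by
    intro x
    refine ⟨x - (x.trace / (Fintype.card ι : K)) • 1, x.trace / (Fintype.card ι : K), ?_, by abel⟩
    rw [trace_sub, trace_smul, trace_one, smul_eq_mul, div_mul_cancel₀ _ hn0, sub_self]
  obtain ⟨x₀, s, hx₀, rfl⟩ := hdec x
  obtain ⟨y₀, t, hy₀, rfl⟩ := hdec y
  have e : ∀ (z : Matrix ι ι K), z.trace = 0 → negOp K ι z = - z := fun z hz => by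
    rw [negOp_apply, hz]; simp
  simp only [map_add, map_smul, negOp_one, e _ hx₀, e _ hy₀, add_mul, mul_add, smul_mul_assoc,
    mul_smul_comm, mul_one, one_mul, LinearMap.add_apply, LinearMap.smul_apply, h1l, h1r, map_neg,
    LinearMap.neg_apply, h _ _ hy₀ hx₀]
  rw [negOp_apply, trace_mul_comm y₀]
  module

end Matrix

/-! ### From matrices back to the twisted algebra. -/

namespace TwistedBasis

/-- A linear bijection preserving commutators and the unit, out of an algebra that becomes a matrix
algebra over an algebraically closed field, is multiplicative or the negative of an
antimultiplicative map on commutators. -/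
theorem map_mul_or_map_mul_rev {k Γ A Z B : Type*} [Field k] [CharZero k] [AddCommGroup Γ] [Ring A]
    [Algebra k A] [CommRing Z] [IsDomain Z] [Algebra Z A] [FaithfulSMul Z A] [Algebra.IsCentral Z A]
    [Algebra k Z] [IsScalarTower k Z A] (T : TwistedBasis k Γ A) [Finite (Γ ⧸ T.rad)]
    [Ring B] [Algebra Z B] [Module.Flat Z B] (Φ : A ≃ₗ[Z] B) (h1 : Φ 1 = 1)
    (hΦ : ∀ x y, Φ (x * y - y * x) = Φ x * Φ y - Φ y * Φ x)
    (Φ' : A →ₗ[Z] B) (h1' : Φ' 1 = 1) (hΦ' : ∀ x y, Φ' (x * y - y * x) = - Φ (x * y - y * x)) :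
    (∀ x y, Φ (x * y) = Φ x * Φ y) ∨ (∀ x y, Φ' (x * y) = Φ' y * Φ' x) := by
  let K := AlgebraicClosure (FractionRing Z)
  have hinj : Function.Injective (algebraMap Z K) := by
    rw [IsScalarTower.algebraMap_eq Z (FractionRing Z) K]
    exact (algebraMap (FractionRing Z) K).injective.comp (IsFractionRing.injective Z _)
  have : CharZero K :=
    charZero_of_injective_ringHom (f := (algebraMap Z K).comp (algebraMap k Z))
      (RingHom.injective _)
  have := T.isSimpleRing_baseChange (Z := Z) K
  have : FiniteDimensional K (K ⊗[Z] A) :=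
    Module.Finite.of_basis (Algebra.TensorProduct.basis K (T.centerBasis (Z := Z)))
  -- Wedderburn over the algebraically closed field `K`.
  obtain ⟨n, hn, ⟨e⟩⟩ := IsSimpleRing.exists_algEquiv_matrix_of_isAlgClosed K (K ⊗[Z] A)
  let Ψ : (K ⊗[Z] A) ≃ₗ[K] (K ⊗[Z] B) := Φ.baseChange Z K A B
  have hΨt : ∀ a x, Ψ (a ⊗ₜ x) = a ⊗ₜ Φ x := fun a x => rfl
  have hΨ1 : Ψ 1 = 1 := by
    rw [Algebra.TensorProduct.one_def, hΨt, h1, Algebra.TensorProduct.one_def]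
  have hΨ : ∀ x y, Ψ (x * y - y * x) = Ψ x * Ψ y - Ψ y * Ψ x := by
    intro x y
    induction x using TensorProduct.induction_on with
    | zero => simp
    | add x₁ x₂ hx₁ hx₂ =>
      rw [add_mul, mul_add, add_sub_add_comm, map_add, hx₁, hx₂, map_add, add_mul, mul_add]
      abel
    | tmul a x =>
      induction y using TensorProduct.induction_on with
      | zero => simp
      | add y₁ y₂ hy₁ hy₂ =>
        rw [add_mul, mul_add, add_sub_add_comm, map_add, hy₁, hy₂, map_add, add_mul, mul_add]
        abel
      | tmul b y =>
        simp only [Algebra.TensorProduct.tmul_mul_tmul, hΨt]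
        rw [mul_comm b a, ← TensorProduct.tmul_sub, ← TensorProduct.tmul_sub, hΨt, hΦ]
  -- The product of `K ⊗ B`, transported to matrices through `Ψ` and `e`.
  let m : Matrix (Fin n) (Fin n) K →ₗ[K] Matrix (Fin n) (Fin n) K →ₗ[K] Matrix (Fin n) (Fin n) K :=
    ((LinearMap.mul K (K ⊗[Z] B)).compl₁₂ (Ψ.toLinearMap ∘ₗ e.symm.toLinearMap)
      (Ψ.toLinearMap ∘ₗ e.symm.toLinearMap)).compr₂ (e.toLinearMap ∘ₗ Ψ.symm.toLinearMap)
  have hm : ∀ x y, m x y = e (Ψ.symm (Ψ (e.symm x) * Ψ (e.symm y))) := fun x y => rfl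
  have hne : Nonempty (Fin n) := ⟨0⟩
  -- Flatness of `B` lets identities proved over `K` descend.
  have hinjB : Function.Injective (fun b : B => (1 : K) ⊗ₜ[Z] b) :=
    Algebra.TensorProduct.includeRight_injective (R := Z) (A := K) (B := B) hinj
  rcases Matrix.mul_or_negOp_of_commutator m (fun x => by simp [hm, hΨ1])
    (fun x => by simp [hm, hΨ1]) (fun x y z => by simp [hm, mul_assoc])
    (fun x y => by rw [hm, hm, ← map_sub, ← map_sub, ← hΨ]; simp) with h | h
  · left
    intro x y
    have h2 := h (e (1 ⊗ₜ x)) (e (1 ⊗ₜ y))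
    rw [hm, ← map_mul e, e.injective.eq_iff, LinearEquiv.symm_apply_eq] at h2
    simp only [AlgEquiv.symm_apply_apply, hΨt, Algebra.TensorProduct.tmul_mul_tmul, mul_one] at h2
    exact (hinjB h2).symm
  · right
    let Ψ' : (K ⊗[Z] A) →ₗ[K] (K ⊗[Z] B) := Φ'.baseChange K
    have hΨ't : ∀ a x, Ψ' (a ⊗ₜ x) = a ⊗ₜ Φ' x := fun a x => rfl
    -- A central basis element becomes a scalar matrix, which `negOp` fixes. A noncentral one is a
    -- commutator, hence traceless, and both sides change its sign.
    have hΨ' : Ψ' = Ψ.toLinearMap ∘ₗ e.symm.toLinearMap ∘ₗ Matrix.negOp K (Fin n) ∘ₗ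
        e.toLinearMap := by
      refine (Algebra.TensorProduct.basis K (T.centerBasis (Z := Z))).ext fun q => ?_
      rw [Algebra.TensorProduct.basis_apply, centerBasis_apply, hΨ't]
      simp only [LinearMap.comp_apply, AlgEquiv.toLinearMap_apply, LinearEquiv.coe_coe]
      by_cases hq : q.out ∈ T.rad
      · obtain ⟨z, hz⟩ := exists_algebraMap_eq (Z := Z) (T.u_mem_center_iff.2 hq)
        rw [← hz, Algebra.algebraMap_eq_smul_one, map_smul, h1', TensorProduct.tmul_smul,
          TensorProduct.tmul_smul, ← Algebra.TensorProduct.one_def,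
          ← Algebra.TensorProduct.one_def, ← algebraMap_smul K z, ← algebraMap_smul K z,
          map_smul, map_smul, map_one, Matrix.negOp_one, map_smul, map_smul, map_one, hΨ1]
      · obtain ⟨x, y, hxy⟩ := T.exists_u_eq_sub hq
        have h3 : (e (1 ⊗ₜ T.u q.out)).trace = 0 := by
          have h4 : (1 : K) ⊗ₜ[Z] T.u q.out =
              (1 ⊗ₜ x) * (1 ⊗ₜ y) - (1 ⊗ₜ y) * (1 ⊗ₜ x) := by
            rw [hxy, TensorProduct.tmul_sub, Algebra.TensorProduct.tmul_mul_tmul,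
              Algebra.TensorProduct.tmul_mul_tmul, mul_one]
          rw [h4, map_sub, map_mul, map_mul, Matrix.trace_sub, Matrix.trace_mul_comm, sub_self]
        rw [Matrix.negOp_apply, h3, zero_smul, smul_zero, zero_sub, map_neg, map_neg,
          AlgEquiv.symm_apply_apply, hΨt, hxy, hΦ', TensorProduct.tmul_neg]
    intro x y
    have h2 := h (e (1 ⊗ₜ x)) (e (1 ⊗ₜ y))
    have h3 : ∀ x, Ψ' (1 ⊗ₜ x) = Ψ (e.symm (Matrix.negOp K (Fin n) (e (1 ⊗ₜ x)))) := fun x => by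
      rw [hΨ']; rfl
    refine hinjB ?_
    calc (1 : K) ⊗ₜ[Z] Φ' (x * y) = Ψ' (1 ⊗ₜ (x * y)) := rfl
      _ = Ψ (e.symm (Matrix.negOp K (Fin n) (e (1 ⊗ₜ x) * e (1 ⊗ₜ y)))) := by
        rw [h3, ← map_mul e, Algebra.TensorProduct.tmul_mul_tmul, mul_one]
      _ = Ψ' (1 ⊗ₜ y) * Ψ' (1 ⊗ₜ x) := by
        rw [← h2, hm, e.symm_apply_apply, Ψ.apply_symm_apply, h3, h3]
      _ = 1 ⊗ₜ (Φ' y * Φ' x) := by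
        rw [hΨ't, hΨ't, Algebra.TensorProduct.tmul_mul_tmul, mul_one]

end TwistedBasis

/-! ### The splitting into center and derived algebra, and the action of a Lie isomorphism on
centers. -/

/-- The derived Lie algebra of an associative algebra under the commutator bracket. -/
noncomputable abbrev derivedLie (k A : Type*) [Field k] [Ring A] [Algebra k A] : LieIdeal k A :=
  ⁅(⊤ : LieIdeal k A), (⊤ : LieIdeal k A)⁆

lemma mem_derivedLie_iff_mem_span {k A : Type*} [Field k] [Ring A] [Algebra k A] {x : A} :
    x ∈ derivedLie k A ↔ x ∈ Submodule.span k {w : A | ∃ a b : A, a * b - b * a = w} := by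
  rw [← LieSubmodule.mem_toSubmodule, LieSubmodule.lieIdeal_oper_eq_linear_span']
  simp [LieRing.of_associative_ring_bracket]

lemma mul_sub_mul_mem_derivedLie (k : Type*) {A : Type*} [Field k] [Ring A] [Algebra k A]
    (x y : A) : x * y - y * x ∈ derivedLie k A :=
  mem_derivedLie_iff_mem_span.2 (Submodule.subset_span ⟨x, y, rfl⟩)

lemma center_mul_mem_derivedLie {k A : Type*} [Field k] [Ring A] [Algebra k A] {z x : A}
    (hz : z ∈ Subalgebra.center k A) (hx : x ∈ derivedLie k A) : z * x ∈ derivedLie k A := by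
  rw [mem_derivedLie_iff_mem_span] at hx
  induction hx using Submodule.span_induction with
  | mem x hx =>
    obtain ⟨a, b, rfl⟩ := hx
    rw [Subalgebra.mem_center_iff] at hz
    rw [mul_sub, ← mul_assoc, ← mul_assoc, ← hz b, mul_assoc b]
    exact mul_sub_mul_mem_derivedLie k _ _
  | zero => rw [mul_zero]; exact zero_mem _
  | add x y _ _ hx hy => rw [mul_add]; exact add_mem hx hy
  | smul c x _ hx => rw [mul_smul_comm]; exact (derivedLie k A).smul_mem c hx

/-- Multiplication by a central element on the derived Lie algebra. -/
noncomputable def centerMul {k A : Type*} [Field k] [Ring A] [Algebra k A]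
    (z : Subalgebra.center k A) (x : derivedLie k A) : derivedLie k A :=
  ⟨z * x, center_mul_mem_derivedLie z.2 x.2⟩

lemma coe_centerMul {k A : Type*} [Field k] [Ring A] [Algebra k A]
    (z : Subalgebra.center k A) (x : derivedLie k A) : (centerMul z x : A) = z * x := rfl

namespace TwistedBasis

section

variable {k Γ A : Type*} [Field k] [AddCommGroup Γ] [Ring A] [Algebra k A]
  (T : TwistedBasis k Γ A)

lemma u_mem_derivedLie {γ : Γ} (h : γ ∉ T.rad) : T.u γ ∈ derivedLie k A := by
  obtain ⟨x, y, hxy⟩ := T.exists_u_eq_sub h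
  rw [hxy]
  exact mul_sub_mul_mem_derivedLie k x y

lemma repr_eq_zero_of_mem_derivedLie {x : A} (hx : x ∈ derivedLie k A) {γ : Γ} (h : γ ∈ T.rad) :
    T.u.repr x γ = 0 := by
  rw [mem_derivedLie_iff_mem_span] at hx
  induction hx using Submodule.span_induction with
  | mem x hx =>
    obtain ⟨a, b, rfl⟩ := hx
    exact T.repr_mul_sub_eq_zero h a b
  | zero => simp
  | add x y _ _ hx hy => rw [map_add, Finsupp.add_apply, hx, hy, add_zero]
  | smul c x _ hx => rw [map_smul, Finsupp.smul_apply, hx, smul_zero]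

lemma derivedLie_induction {p : derivedLie k A → Prop}
    (hu : ∀ γ (h : γ ∉ T.rad), p ⟨T.u γ, T.u_mem_derivedLie h⟩) (h0 : p 0)
    (hadd : ∀ x y, p x → p y → p (x + y)) (hsmul : ∀ (c : k) x, p x → p (c • x))
    (x : derivedLie k A) : p x := by
  classical
  have h1 : x = ∑ γ ∈ (T.u.repr x).support, if h : γ ∉ T.rad then
      T.u.repr x γ • (⟨T.u γ, T.u_mem_derivedLie h⟩ : derivedLie k A) else 0 := by
    refine Subtype.ext ?_
    conv_lhs => rw [← T.u.linearCombination_repr (x : A), Finsupp.linearCombination_apply,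
      Finsupp.sum]
    rw [AddSubmonoidClass.coe_finsetSum]
    refine Finset.sum_congr rfl fun γ _ => ?_
    by_cases h : γ ∈ T.rad
    · rw [T.repr_eq_zero_of_mem_derivedLie x.2 h, zero_smul, dif_neg (not_not.2 h)]; rfl
    · rw [dif_pos h]; rfl
  rw [h1]
  refine Finset.sum_induction _ p hadd h0 fun γ _ => ?_
  by_cases h : γ ∈ T.rad
  · rwa [dif_neg (not_not.2 h)]
  · rw [dif_pos h]
    exact hsmul _ _ (hu γ h)

lemma exists_eq_center_add (T : TwistedBasis k Γ A) (x : A) :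
    ∃ (z : Subalgebra.center k A) (y : derivedLie k A), x = (z : A) + (y : A) := by
  have h : ∀ x ∈ Submodule.span k (Set.range T.u), ∃ (z : Subalgebra.center k A)
      (y : derivedLie k A), x = (z : A) + (y : A) := by
    intro x hx
    induction hx using Submodule.span_induction with
    | mem x hx =>
      obtain ⟨γ, rfl⟩ := hx
      by_cases h : γ ∈ T.rad
      · exact ⟨⟨_, T.u_mem_center_iff.2 h⟩, 0, by simp⟩
      · exact ⟨0, ⟨_, T.u_mem_derivedLie h⟩, by simp⟩
    | zero => exact ⟨0, 0, by simp⟩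
    | add x y _ _ hx hy =>
      obtain ⟨z, x, rfl⟩ := hx
      obtain ⟨w, y, rfl⟩ := hy
      exact ⟨z + w, x + y, by push_cast; abel⟩
    | smul c x _ hx =>
      obtain ⟨z, x, rfl⟩ := hx
      exact ⟨c • z, c • x, by simp⟩
  exact h x (by rw [T.u.span_eq]; trivial)

/-- Glue linear maps on the center and on the derived Lie algebra. -/
noncomputable def glue {B : Type*} [AddCommGroup B] [Module k B]
    (S : Subalgebra.center k A →ₗ[k] B) (f : derivedLie k A →ₗ[k] B) : A →ₗ[k] B :=
  open Classical in
  T.u.constr k fun γ => if h : γ ∈ T.rad then S ⟨T.u γ, T.u_mem_center_iff.2 h⟩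
    else f ⟨T.u γ, T.u_mem_derivedLie h⟩

lemma glue_derivedLie {B : Type*} [AddCommGroup B] [Module k B]
    (S : Subalgebra.center k A →ₗ[k] B) (f : derivedLie k A →ₗ[k] B) (x : derivedLie k A) :
    T.glue S f x = f x := by
  induction x using T.derivedLie_induction with
  | hu γ h => simp [glue, h]
  | h0 => simp
  | hadd x y hx hy => rw [map_add, ← hx, ← hy, ← map_add]; rfl
  | hsmul c x hx => rw [map_smul, ← hx, ← map_smul]; rfl

lemma glue_center {B : Type*} [AddCommGroup B] [Module k B]
    (S : Subalgebra.center k A →ₗ[k] B) (f : derivedLie k A →ₗ[k] B) (z : Subalgebra.center k A) :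
    T.glue S f z = S z := by
  classical
  have h1 : z = ∑ γ ∈ (T.u.repr z).support, if h : γ ∈ T.rad then
      T.u.repr z γ • (⟨T.u γ, T.u_mem_center_iff.2 h⟩ : Subalgebra.center k A) else 0 := by
    refine Subtype.ext ?_
    conv_lhs => rw [← T.u.linearCombination_repr (z : A), Finsupp.linearCombination_apply,
      Finsupp.sum]
    rw [AddSubmonoidClass.coe_finsetSum]
    refine Finset.sum_congr rfl fun γ hγ => ?_
    rw [dif_pos (T.mem_center_iff.1 z.2 γ (Finsupp.mem_support_iff.1 hγ))]
    rfl
  conv_lhs => rw [← T.u.linearCombination_repr (z : A), Finsupp.linearCombination_apply,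
      Finsupp.sum]
  conv_rhs => rw [h1]
  rw [map_sum, map_sum]
  refine Finset.sum_congr rfl fun γ hγ => ?_
  have := T.mem_center_iff.1 z.2 γ (Finsupp.mem_support_iff.1 hγ)
  rw [dif_pos this, map_smul, map_smul]
  simp [glue, this]

end

variable {k Γ₁ Γ₂ A₁ A₂ : Type*} [Field k] [AddCommGroup Γ₁] [AddCommGroup Γ₂]
  [Ring A₁] [Ring A₂] [Algebra k A₁] [Algebra k A₂]
  (T₁ : TwistedBasis k Γ₁ A₁) (T₂ : TwistedBasis k Γ₂ A₂)

/-- The derived algebra contains a unit of `A₁`, which can be cancelled. -/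
lemma center_ext (hne : T₁.rad ≠ ⊤) {z w : A₁}
    (h : ∀ x : derivedLie k A₁, z * x = w * x) : z = w := by
  obtain ⟨γ, hγ⟩ : ∃ γ, γ ∉ T₁.rad := by
    by_contra hcon
    push Not at hcon
    exact hne (eq_top_iff.2 fun γ _ => hcon γ)
  exact (T₁.isUnit_u γ).mul_right_cancel (h ⟨_, T₁.u_mem_derivedLie hγ⟩)

lemma rad_ne_top (φ : derivedLie k A₁ ≃ₗ⁅k⁆ derivedLie k A₂) (h : T₁.rad ≠ ⊤) : T₂.rad ≠ ⊤ := by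
  intro hcon
  obtain ⟨γ, hγ⟩ : ∃ γ, γ ∉ T₁.rad := by
    by_contra hcon
    push Not at hcon
    exact h (eq_top_iff.2 fun γ _ => hcon γ)
  have h0 : ∀ y : derivedLie k A₂, y = 0 := by
    intro y
    induction y using T₂.derivedLie_induction with
    | hu γ h => exact absurd (hcon ▸ AddSubgroup.mem_top γ) h
    | h0 => rfl
    | hadd x y hx hy => rw [hx, hy, add_zero]
    | hsmul c x hx => rw [hx, smul_zero]
  have h1 := h0 (φ ⟨_, T₁.u_mem_derivedLie hγ⟩)
  have h2 : (⟨_, T₁.u_mem_derivedLie hγ⟩ : derivedLie k A₁) = 0 :=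
    φ.injective (h1.trans (map_zero φ).symm)
  exact T₁.u.ne_zero γ (congrArg Subtype.val h2)

variable [CharZero k]

/-- A Lie isomorphism of derived algebras is semilinear over the centers. -/
lemma exists_center_map (T₂ : TwistedBasis k Γ₂ A₂) (φ : derivedLie k A₁ ≃ₗ⁅k⁆ derivedLie k A₂)
    (z : Subalgebra.center k A₁) : ∃ w : Subalgebra.center k A₂, ∀ x : derivedLie k A₁,
      (φ (centerMul z x) : A₂) = w * φ x := by
  classical
  let f : derivedLie k A₂ →ₗ[k] derivedLie k A₁ :=
    { toFun := fun y => ⟨z * φ.symm y, center_mul_mem_derivedLie z.2 (φ.symm y).2⟩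
      map_add' := fun x y => Subtype.ext (by simp [mul_add])
      map_smul' := fun c x => Subtype.ext (by simp) }
  let F : Γ₂ → A₂ := fun γ => if h : γ ∉ T₂.rad then φ (f ⟨_, T₂.u_mem_derivedLie h⟩) else 0
  have hFd : ∀ γ (h : γ ∉ T₂.rad), F γ = φ (f ⟨_, T₂.u_mem_derivedLie h⟩) := fun γ h => by
    simp only [F, dif_pos h]
  -- Multiplication by a central element can be moved across the bracket, so its conjugate by `φ`
  -- lies in the centroid of the target.
  have hbr : ∀ x y : derivedLie k A₂, ⁅φ (f x), y⁆ = ⁅x, φ (f y)⁆ := by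
    intro x y
    have h1 : ⁅f x, φ.symm y⁆ = ⁅φ.symm x, f y⁆ := by
      have hz := Subalgebra.mem_center_iff.1 z.2
      refine Subtype.ext ?_
      change (z : A₁) * φ.symm x * φ.symm y - φ.symm y * (z * φ.symm x) =
        φ.symm x * (z * φ.symm y) - z * φ.symm y * φ.symm x
      simp only [← mul_assoc, hz]
    have h2 := congrArg φ h1
    rwa [LieEquiv.map_lie, LieEquiv.map_lie, LieEquiv.apply_symm_apply,
      LieEquiv.apply_symm_apply] at h2
  obtain ⟨w, hw, hF⟩ := T₂.exists_center_of_centroid F (by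
      intro γ hγ η hη
      rw [hFd γ hγ]
      exact T₂.repr_eq_zero_of_mem_derivedLie (φ _).2 hη)
    (by
      intro γ hγ δ hδ
      rw [hFd γ hγ, hFd δ hδ]
      exact congrArg Subtype.val (hbr ⟨_, T₂.u_mem_derivedLie hγ⟩ ⟨_, T₂.u_mem_derivedLie hδ⟩))
  have key : ∀ y : derivedLie k A₂, (φ (f y) : A₂) = w * y := by
    intro y
    induction y using T₂.derivedLie_induction with
    | hu γ h => rw [← hF γ h, hFd γ h]
    | h0 => simp
    | hadd x y hx hy => simp [mul_add, hx, hy]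
    | hsmul c x hx => simp [hx]
  refine ⟨⟨w, hw⟩, fun x => ?_⟩
  have := key (φ x)
  simpa [f, centerMul] using this

/-- The isomorphism of centers attached to a Lie isomorphism of derived algebras. -/
lemma exists_center_equiv (T₁ : TwistedBasis k Γ₁ A₁) (T₂ : TwistedBasis k Γ₂ A₂)
    (φ : derivedLie k A₁ ≃ₗ⁅k⁆ derivedLie k A₂) (h : T₁.rad ≠ ⊤) :
    ∃ σ : Subalgebra.center k A₁ ≃ₐ[k] Subalgebra.center k A₂, ∀ (z : Subalgebra.center k A₁)
      (x : derivedLie k A₁),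
      (φ (centerMul z x) : A₂) = σ z * φ x := by
  choose σ hσ using T₂.exists_center_map φ
  choose τ hτ using T₁.exists_center_map φ.symm
  have h₂ := T₁.rad_ne_top T₂ φ h
  -- The center acts faithfully, so the identities for `σ` may be checked on the derived algebra.
  have hu : ∀ {z w : Subalgebra.center k A₂}, (∀ x : derivedLie k A₁,
      (z * φ x : A₂) = w * φ x) → z = w := by
    intro z w hzw
    refine Subtype.ext (T₂.center_ext h₂ fun y => ?_)
    have := hzw (φ.symm y)
    rwa [φ.apply_symm_apply] at this
  have hmul : ∀ z w, σ (z * w) = σ z * σ w := fun z w => hu fun x => by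
    have h1 : centerMul (z * w) x = centerMul z (centerMul w x) :=
      Subtype.ext (mul_assoc _ _ _)
    rw [← hσ, h1, hσ, hσ, Subalgebra.coe_mul, mul_assoc]
  have hadd : ∀ z w, σ (z + w) = σ z + σ w := fun z w => hu fun x => by
    have h1 : centerMul (z + w) x = centerMul z x + centerMul w x :=
      Subtype.ext (add_mul _ _ _)
    rw [← hσ, h1, map_add, LieSubmodule.coe_add, hσ, hσ, Subalgebra.coe_add, add_mul]
  have hcomm : ∀ c : k, σ (algebraMap k _ c) = algebraMap k _ c := fun c => hu fun x => by
    have h1 : centerMul (algebraMap k _ c) x = c • x := Subtype.ext (Algebra.smul_def _ _).symm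
    rw [← hσ, h1, map_smul, LieSubmodule.coe_smul, Algebra.smul_def]
    rfl
  have hτσ : ∀ z, τ (σ z) = z := fun z => Subtype.ext (T₁.center_ext h fun x => by
    have h1 : centerMul (σ z) (φ x) = φ (centerMul z x) := Subtype.ext (hσ z x).symm
    have h2 := hτ (σ z) (φ x)
    rw [h1, φ.symm_apply_apply, φ.symm_apply_apply] at h2
    exact h2.symm)
  have hστ : ∀ z, σ (τ z) = z := fun z => hu fun x => by
    have h1 : centerMul (τ z) x = φ.symm (centerMul z (φ x)) :=
      Subtype.ext (by rw [hτ, φ.symm_apply_apply]; rfl)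
    rw [← hσ, h1, φ.apply_symm_apply]
    rfl
  exact ⟨AlgEquiv.ofRingEquiv (f := ⟨⟨σ, τ, hτσ, hστ⟩, hmul, hadd⟩) hcomm, hσ⟩

end TwistedBasis

/-! ### Extending a Lie isomorphism, and its negative, to the associative algebras. -/

namespace TwistedBasis

variable {k Γ₁ Γ₂ A₁ A₂ : Type*} [Field k] [AddCommGroup Γ₁] [AddCommGroup Γ₂]
  [Ring A₁] [Ring A₂] [Algebra k A₁] [Algebra k A₂]

/-- Extend a linear map of derived Lie algebras by an isomorphism of centers. -/
noncomputable def extend (T₁ : TwistedBasis k Γ₁ A₁)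
    (σ : Subalgebra.center k A₁ ≃ₐ[k] Subalgebra.center k A₂)
    (f : derivedLie k A₁ →ₗ[k] derivedLie k A₂) : A₁ →ₗ[k] A₂ :=
  T₁.glue ((Subalgebra.center k A₂).val.toLinearMap ∘ₗ σ.toLinearMap)
    ((derivedLie k A₂).toSubmodule.subtype ∘ₗ f)

section extend

variable (T₁ : TwistedBasis k Γ₁ A₁) (T₂ : TwistedBasis k Γ₂ A₂)
  (σ : Subalgebra.center k A₁ ≃ₐ[k] Subalgebra.center k A₂)
  (f : derivedLie k A₁ →ₗ[k] derivedLie k A₂)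

lemma extend_center (z : Subalgebra.center k A₁) : T₁.extend σ f z = σ z :=
  T₁.glue_center _ _ _

lemma extend_derivedLie (x : derivedLie k A₁) : T₁.extend σ f x = f x :=
  T₁.glue_derivedLie _ _ _

lemma extend_one : T₁.extend σ f 1 = 1 := by
  simpa using T₁.extend_center σ f 1

lemma extend_mul (hf : ∀ z x, (f (centerMul z x) : A₂) = σ z * f x)
    (z : Subalgebra.center k A₁) (x : A₁) : T₁.extend σ f (z * x) = σ z * T₁.extend σ f x := by
  obtain ⟨w, y, rfl⟩ := T₁.exists_eq_center_add x
  rw [mul_add, map_add, map_add, mul_add, ← Subalgebra.coe_mul, ← coe_centerMul, extend_center,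
    extend_center, extend_derivedLie, extend_derivedLie, hf, map_mul, Subalgebra.coe_mul]

lemma extend_extend (e : derivedLie k A₁ ≃ₗ[k] derivedLie k A₂) (x : A₁) :
    T₂.extend σ.symm e.symm.toLinearMap (T₁.extend σ e.toLinearMap x) = x := by
  obtain ⟨w, y, rfl⟩ := T₁.exists_eq_center_add x
  rw [map_add, extend_center, extend_derivedLie, map_add, extend_center, extend_derivedLie]
  simp

lemma bijective_extend (T₂ : TwistedBasis k Γ₂ A₂) (e : derivedLie k A₁ ≃ₗ[k] derivedLie k A₂) :
    Function.Bijective (T₁.extend σ e.toLinearMap) :=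
  Function.bijective_iff_has_inverse.2
    ⟨_, T₁.extend_extend T₂ σ e, T₂.extend_extend T₁ σ.symm e.symm⟩

/-- Central summands drop out of commutators. -/
lemma exists_commutator_eq (T₁ : TwistedBasis k Γ₁ A₁) (x y : A₁) :
    ∃ (x' y' : derivedLie k A₁) (z w : Subalgebra.center k A₁),
      x = z + x' ∧ y = w + y' ∧ x * y - y * x = (⁅x', y'⁆ : derivedLie k A₁) := by
  obtain ⟨z, x', rfl⟩ := T₁.exists_eq_center_add x
  obtain ⟨w, y', rfl⟩ := T₁.exists_eq_center_add y
  refine ⟨x', y', z, w, rfl, rfl, ?_⟩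
  change _ = (x' : A₁) * y' - y' * x'
  have hz := Subalgebra.mem_center_iff.1 z.2
  have hw := Subalgebra.mem_center_iff.1 w.2
  rw [add_mul, mul_add, mul_add, add_mul, mul_add, mul_add, hz w, hz y', hw x']
  abel

lemma extend_commutator (hf : ∀ x y, f ⁅x, y⁆ = ⁅f x, f y⁆) (x y : A₁) :
    T₁.extend σ f (x * y - y * x) =
      T₁.extend σ f x * T₁.extend σ f y - T₁.extend σ f y * T₁.extend σ f x := by
  obtain ⟨x', y', z, w, rfl, rfl, h⟩ := T₁.exists_commutator_eq x y
  rw [h, map_add, map_add, extend_derivedLie, extend_derivedLie, extend_derivedLie, extend_center,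
    extend_center]
  have h1 : (f ⁅x', y'⁆ : A₂) = (f x' : A₂) * f y' - f y' * f x' := congrArg Subtype.val (hf x' y')
  have hz := Subalgebra.mem_center_iff.1 (σ z).2
  have hw := Subalgebra.mem_center_iff.1 (σ w).2
  rw [h1, add_mul, mul_add, mul_add, add_mul, mul_add, mul_add, hz (σ w), hz (f y'), hw (f x')]
  abel

end extend

variable [CharZero k]

/-- A Lie isomorphism of derived algebras and its negative extend to linear bijections of the
associative algebras, semilinear over the centers. -/
lemma exists_extensions (T₁ : TwistedBasis k Γ₁ A₁) (T₂ : TwistedBasis k Γ₂ A₂)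
    (hne : T₁.rad ≠ ⊤) (φ : derivedLie k A₁ ≃ₗ⁅k⁆ derivedLie k A₂) :
    ∃ (σ : Subalgebra.center k A₁ ≃ₐ[k] Subalgebra.center k A₂) (G G' : A₁ ≃ₗ[k] A₂),
      G 1 = 1 ∧ G' 1 = 1 ∧
      (∀ (z : Subalgebra.center k A₁) x, G (z * x) = σ z * G x) ∧
      (∀ (z : Subalgebra.center k A₁) x, G' (z * x) = σ z * G' x) ∧
      (∀ x y, G (x * y - y * x) = G x * G y - G y * G x) ∧
      (∀ x y, G' (x * y - y * x) = - G (x * y - y * x)) := by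
  obtain ⟨σ, hσ⟩ := T₁.exists_center_equiv T₂ φ hne
  obtain ⟨e, he⟩ : ∃ e : derivedLie k A₁ ≃ₗ[k] derivedLie k A₂, ∀ x, e x = φ x :=
    ⟨φ.toLinearEquiv, fun _ => rfl⟩
  have hlie : ∀ x y, e ⁅x, y⁆ = ⁅e x, e y⁆ := fun x y => by rw [he, he, he, φ.map_lie]
  -- The negative is no longer a Lie map, but it is what an anti-isomorphism restricts to.
  obtain ⟨e', he'⟩ : ∃ e' : derivedLie k A₁ ≃ₗ[k] derivedLie k A₂, ∀ x, e' x = - e x :=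
    ⟨e.trans (LinearEquiv.neg k), fun _ => rfl⟩
  refine ⟨σ, LinearEquiv.ofBijective _ (T₁.bijective_extend σ T₂ e),
    LinearEquiv.ofBijective _ (T₁.bijective_extend σ T₂ e'), T₁.extend_one σ _, T₁.extend_one σ _,
    T₁.extend_mul σ _ fun z x => ?_, T₁.extend_mul σ _ fun z x => ?_,
    T₁.extend_commutator σ _ hlie, fun x y => ?_⟩
  · rw [LinearEquiv.coe_coe, he, he, hσ]
  · rw [LinearEquiv.coe_coe, he', he', he, he, LieSubmodule.coe_neg, LieSubmodule.coe_neg, hσ,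
      mul_neg]
  · obtain ⟨x', y', z, w, rfl, rfl, h⟩ := T₁.exists_commutator_eq x y
    rw [h, LinearEquiv.ofBijective_apply, LinearEquiv.ofBijective_apply, extend_derivedLie,
      extend_derivedLie, LinearEquiv.coe_coe, LinearEquiv.coe_coe, he', LieSubmodule.coe_neg]

lemma nonempty_algEquiv_or_op_of_extensions {Z : Type*} [CommRing Z] [IsDomain Z] [Algebra k Z]
    [Algebra Z A₁] [Algebra Z A₂] [IsScalarTower k Z A₁] [IsScalarTower k Z A₂]
    [FaithfulSMul Z A₁] [FaithfulSMul Z A₂] [Algebra.IsCentral Z A₁] [Algebra.IsCentral Z A₂]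
    (T₁ : TwistedBasis k Γ₁ A₁) (T₂ : TwistedBasis k Γ₂ A₂) [Finite (Γ₁ ⧸ T₁.rad)]
    (G G' : A₁ ≃ₗ[k] A₂) (h1 : G 1 = 1) (h1' : G' 1 = 1)
    (hsm : ∀ (z : Z) x, G (z • x) = z • G x) (hsm' : ∀ (z : Z) x, G' (z • x) = z • G' x)
    (hG : ∀ x y, G (x * y - y * x) = G x * G y - G y * G x)
    (hG' : ∀ x y, G' (x * y - y * x) = - G (x * y - y * x)) :
    Nonempty (A₁ ≃ₐ[k] A₂) ∨ Nonempty (A₁ ≃ₐ[k] A₂ᵐᵒᵖ) := by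
  have : Module.Free Z A₂ := Module.Free.of_basis T₂.centerBasis
  let Φ : A₁ ≃ₗ[Z] A₂ :=
    { G with map_smul' := hsm }
  let Φ' : A₁ →ₗ[Z] A₂ :=
    { G' with map_smul' := hsm' }
  rcases T₁.map_mul_or_map_mul_rev Φ h1 hG Φ' h1' hG' with h | h
  · exact Or.inl ⟨AlgEquiv.ofLinearEquiv G h1 h⟩
  · exact Or.inr ⟨AlgEquiv.ofLinearEquiv (G'.trans (MulOpposite.opLinearEquiv k))
      (congrArg MulOpposite.op h1') fun x y => congrArg MulOpposite.op (h x y)⟩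

/-- One domain `Z` acts on `A₁` through `e` and on `A₂` through `e` followed by `σ`; the semilinear
extensions thereby become `Z`-linear. -/
lemma nonempty_algEquiv_or_op_of_center (T₁ : TwistedBasis k Γ₁ A₁) (T₂ : TwistedBasis k Γ₂ A₂)
    [Finite (Γ₁ ⧸ T₁.rad)] {Z : Type*} [CommRing Z] [IsDomain Z] [Algebra k Z]
    (e : Z ≃ₐ[k] Subalgebra.center k A₁)
    (hne : T₁.rad ≠ ⊤) (φ : derivedLie k A₁ ≃ₗ⁅k⁆ derivedLie k A₂) :
    Nonempty (A₁ ≃ₐ[k] A₂) ∨ Nonempty (A₁ ≃ₐ[k] A₂ᵐᵒᵖ) := by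
  obtain ⟨σ, G, G', h1, h1', hsm, hsm', hG, hG'⟩ := T₁.exists_extensions T₂ hne φ
  let : Algebra Z A₁ := ((Subalgebra.center k A₁).val.comp e.toAlgHom).toRingHom.toAlgebra'
    fun z x => (Subalgebra.mem_center_iff.1 (e z).2 x).symm
  let : Algebra Z A₂ :=
    ((Subalgebra.center k A₂).val.comp (e.trans σ).toAlgHom).toRingHom.toAlgebra'
    fun z x => (Subalgebra.mem_center_iff.1 (σ (e z)).2 x).symm
  have : FaithfulSMul Z A₁ :=
    (faithfulSMul_iff_algebraMap_injective _ _).2 (Subtype.val_injective.comp e.injective)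
  have : FaithfulSMul Z A₂ := (faithfulSMul_iff_algebraMap_injective _ _).2
    (Subtype.val_injective.comp (e.trans σ).injective)
  have : IsScalarTower k Z A₁ := IsScalarTower.of_algebraMap_eq fun c =>
    (((Subalgebra.center k A₁).val.comp e.toAlgHom).commutes c).symm
  have : IsScalarTower k Z A₂ := IsScalarTower.of_algebraMap_eq fun c =>
    (((Subalgebra.center k A₂).val.comp (e.trans σ).toAlgHom).commutes c).symm
  have : Algebra.IsCentral Z A₁ := ⟨fun x hx => Algebra.mem_bot.2
    ⟨e.symm ⟨x, Subalgebra.mem_center_iff.2 (Subalgebra.mem_center_iff.1 hx)⟩,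
      congrArg Subtype.val (e.apply_symm_apply _)⟩⟩
  have : Algebra.IsCentral Z A₂ := ⟨fun x hx => Algebra.mem_bot.2
    ⟨(e.trans σ).symm ⟨x, Subalgebra.mem_center_iff.2 (Subalgebra.mem_center_iff.1 hx)⟩,
      congrArg Subtype.val ((e.trans σ).apply_symm_apply _)⟩⟩
  exact T₁.nonempty_algEquiv_or_op_of_extensions (Z := Z) T₂ G G' h1 h1'
    (fun z => hsm (e z)) (fun z => hsm' (e z)) hG hG'

/-- A Lie isomorphism of derived algebras comes from an isomorphism or from an antiisomorphism of
the associative algebras. -/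
theorem nonempty_algEquiv_or_op (T₁ : TwistedBasis k Γ₁ A₁) (T₂ : TwistedBasis k Γ₂ A₂)
    [Finite (Γ₁ ⧸ T₁.rad)] [IsDomain (Subalgebra.center k A₁)]
    (hne : T₁.rad ≠ ⊤) (φ : derivedLie k A₁ ≃ₗ⁅k⁆ derivedLie k A₂) :
    Nonempty (A₁ ≃ₐ[k] A₂) ∨ Nonempty (A₁ ≃ₐ[k] A₂ᵐᵒᵖ) :=
  T₁.nonempty_algEquiv_or_op_of_center T₂ AlgEquiv.refl hne φ

end TwistedBasis

/-! ### The monomial basis of the quantum torus. -/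

/-- Commutation of powers of two group elements which commute up to a central element. -/
lemma zpow_mul_zpow_of_commutator {G : Type*} [Group G] {x y t : G} (ht : ∀ g, t * g = g * t)
    (h : x * y = t * (y * x)) (a b : ℤ) : x ^ a * y ^ b = t ^ (a * b) * (y ^ b * x ^ a) := by
  have htz : ∀ (n : ℤ) (g : G), Commute (t ^ n) g := fun n g =>
    Commute.zpow_left (show Commute t g from ht g) n
  have h1 : y * x * y⁻¹ = t⁻¹ * x := by
    rw [mul_inv_eq_iff_eq_mul, eq_comm, mul_assoc, inv_mul_eq_iff_eq_mul, h]
  have h2 : y * x ^ a * y⁻¹ = t ^ (-a) * x ^ a := by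
    rw [← conj_zpow, h1, (show Commute t x from ht x).inv_left.mul_zpow, inv_zpow, zpow_neg]
  have h3 : x ^ a * y * (x ^ a)⁻¹ = t ^ a * y := by
    rw [mul_inv_eq_iff_eq_mul]
    rw [mul_inv_eq_iff_eq_mul] at h2
    rw [mul_assoc, h2, ← mul_assoc, ← mul_assoc, ← zpow_add, add_neg_cancel, zpow_zero, one_mul]
  have h4 : x ^ a * y ^ b * (x ^ a)⁻¹ = t ^ (a * b) * y ^ b := by
    rw [← conj_zpow, h3, (htz a y).mul_zpow, zpow_mul]
  rw [mul_inv_eq_iff_eq_mul] at h4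
  rw [h4, mul_assoc]

namespace QuantumTorus

variable {k : Type*} [Field k] {θ : kˣ}

/-- The quotient map from the free algebra. -/
noncomputable def mk (θ : kˣ) : FreeAlgebra k Gen →ₐ[k] QuantumTorus θ :=
  RingQuot.mkAlgHom k (Rel θ)

lemma mk_surjective : Function.Surjective (mk θ) := RingQuot.mkAlgHom_surjective k (Rel θ)

lemma mk_eq_mk {x y : FreeAlgebra k Gen} (h : Rel θ x y) : mk θ x = mk θ y :=
  RingQuot.mkAlgHom_rel k h

/-- The generator `x₁` as a unit. -/
noncomputable def X₁ (θ : kˣ) : (QuantumTorus θ)ˣ where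
  val := mk θ (FreeAlgebra.ι k Gen.x₁)
  inv := mk θ (FreeAlgebra.ι k Gen.x₁inv)
  val_inv := by rw [← map_mul, mk_eq_mk Rel.x₁_mul_inv, map_one]
  inv_val := by rw [← map_mul, mk_eq_mk Rel.x₁_inv_mul, map_one]

/-- The generator `x₂` as a unit. -/
noncomputable def X₂ (θ : kˣ) : (QuantumTorus θ)ˣ where
  val := mk θ (FreeAlgebra.ι k Gen.x₂)
  inv := mk θ (FreeAlgebra.ι k Gen.x₂inv)
  val_inv := by rw [← map_mul, mk_eq_mk Rel.x₂_mul_inv, map_one]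
  inv_val := by rw [← map_mul, mk_eq_mk Rel.x₂_inv_mul, map_one]

lemma X₁_mul_X₂ : (X₁ θ * X₂ θ : QuantumTorus θ) = (θ : k) • (X₂ θ * X₁ θ : QuantumTorus θ) := by
  change mk θ _ * mk θ _ = (θ : k) • (mk θ _ * mk θ _)
  rw [← map_mul, mk_eq_mk Rel.x₁_mul_x₂, map_smul, map_mul]

/-- The universal property of the quantum torus. -/
noncomputable def lift {B : Type*} [Ring B] [Algebra k B] (a b : Bˣ)
    (h : (a * b : B) = (θ : k) • (b * a : B)) : QuantumTorus θ →ₐ[k] B :=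
  RingQuot.liftAlgHom k (s := Rel θ) ⟨FreeAlgebra.lift k (fun
    | Gen.x₁ => (a : B)
    | Gen.x₂ => (b : B)
    | Gen.x₁inv => ((a⁻¹ : Bˣ) : B)
    | Gen.x₂inv => ((b⁻¹ : Bˣ) : B)), by
      intro x y hxy
      cases hxy <;> simp [h]⟩

lemma lift_X₁ {B : Type*} [Ring B] [Algebra k B] (a b : Bˣ)
    (h : (a * b : B) = (θ : k) • (b * a : B)) : lift a b h (X₁ θ) = a := by
  refine (RingQuot.liftAlgHom_mkAlgHom_apply k _ _ _).trans ?_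
  simp

lemma lift_X₂ {B : Type*} [Ring B] [Algebra k B] (a b : Bˣ)
    (h : (a * b : B) = (θ : k) • (b * a : B)) : lift a b h (X₂ θ) = b := by
  refine (RingQuot.liftAlgHom_mkAlgHom_apply k _ _ _).trans ?_
  simp

lemma induction_on {p : QuantumTorus θ → Prop} (halg : ∀ c : k, p (algebraMap k _ c))
    (h₁ : p (X₁ θ)) (h₂ : p (X₂ θ)) (h₁' : p ((X₁ θ)⁻¹ : (QuantumTorus θ)ˣ))
    (h₂' : p ((X₂ θ)⁻¹ : (QuantumTorus θ)ˣ)) (hmul : ∀ x y, p x → p y → p (x * y))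
    (hadd : ∀ x y, p x → p y → p (x + y)) (x : QuantumTorus θ) : p x := by
  obtain ⟨x, rfl⟩ := mk_surjective x
  induction x using FreeAlgebra.induction with
  | grade0 c => rw [AlgHom.commutes]; exact halg c
  | grade1 g =>
    cases g with
    | x₁ => exact h₁
    | x₂ => exact h₂
    | x₁inv => exact h₁'
    | x₂inv => exact h₂'
  | mul x y hx hy => rw [map_mul]; exact hmul _ _ hx hy
  | add x y hx hy => rw [map_add]; exact hadd _ _ hx hy

lemma algHom_ext {B : Type*} [Ring B] [Algebra k B] {f g : QuantumTorus θ →ₐ[k] B}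
    (h₁ : f (X₁ θ) = g (X₁ θ)) (h₂ : f (X₂ θ) = g (X₂ θ)) : f = g := by
  have hinv : ∀ u : (QuantumTorus θ)ˣ, f u = g u →
      f (u⁻¹ : (QuantumTorus θ)ˣ) = g (u⁻¹ : (QuantumTorus θ)ˣ) := by
    intro u hu
    have h3 : Units.map (f : QuantumTorus θ →* B) u = Units.map (g : QuantumTorus θ →* B) u :=
      Units.ext hu
    have h4 := congrArg (fun v : Bˣ => ((v⁻¹ : Bˣ) : B)) h3
    simpa using h4
  refine AlgHom.ext fun x => ?_
  induction x using induction_on with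
  | halg c => rw [AlgHom.commutes, AlgHom.commutes]
  | h₁ => exact h₁
  | h₂ => exact h₂
  | h₁' => exact hinv _ h₁
  | h₂' => exact hinv _ h₂
  | hmul x y hx hy => rw [map_mul, map_mul, hx, hy]
  | hadd x y hx hy => rw [map_add, map_add, hx, hy]

/-- The monomials in the generators. -/
noncomputable def monomial (θ : kˣ) (α : ℤ ×ₗ ℤ) : (QuantumTorus θ)ˣ :=
  X₁ θ ^ (ofLex α).1 * X₂ θ ^ (ofLex α).2

/-- The cocycle of the quantum torus. -/
def cocycle (θ : kˣ) (α β : ℤ ×ₗ ℤ) : k :=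
  ((θ ^ (-((ofLex β).1 * (ofLex α).2)) : kˣ) : k)

/-- Reordering moves the power of `x₂` in the first factor past the power of `x₁` in the second,
with a factor `θ⁻¹` for each exchange. -/
lemma monomial_mul_monomial (α β : ℤ ×ₗ ℤ) :
    (monomial θ α * monomial θ β : QuantumTorus θ) =
      cocycle θ α β • (monomial θ (α + β) : QuantumTorus θ) := by
  let t : (QuantumTorus θ)ˣ := Units.map (algebraMap k (QuantumTorus θ)).toMonoidHom θ
  have htv : ∀ n : ℤ, ((t ^ n : (QuantumTorus θ)ˣ) : QuantumTorus θ) =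
      algebraMap k _ ((θ ^ n : kˣ) : k) := fun n => by
    rw [← map_zpow]; rfl
  have ht : ∀ g, t * g = g * t := fun g => Units.ext (Algebra.commutes _ _)
  have h : X₁ θ * X₂ θ = t * (X₂ θ * X₁ θ) := Units.ext (by
    rw [Units.val_mul, X₁_mul_X₂, Algebra.smul_def]; rfl)
  have h1 := zpow_mul_zpow_of_commutator ht h (ofLex β).1 (ofLex α).2
  have h2 : monomial θ α * monomial θ β =
      t ^ (-((ofLex β).1 * (ofLex α).2)) * monomial θ (α + β) := by
    have htz : ∀ (n : ℤ) (g : (QuantumTorus θ)ˣ), t ^ n * g = g * t ^ n := fun n g =>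
      (Commute.zpow_left (show Commute t g from ht g) n).eq
    have h3 : X₂ θ ^ (ofLex α).2 * X₁ θ ^ (ofLex β).1 = t ^ (-((ofLex β).1 * (ofLex α).2)) *
        (X₁ θ ^ (ofLex β).1 * X₂ θ ^ (ofLex α).2) := by
      rw [h1, ← mul_assoc, ← zpow_add, neg_add_cancel, zpow_zero, one_mul]
    calc monomial θ α * monomial θ β = X₁ θ ^ (ofLex α).1 * (X₂ θ ^ (ofLex α).2 *
          X₁ θ ^ (ofLex β).1) * X₂ θ ^ (ofLex β).2 := by simp only [monomial, mul_assoc]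
      _ = t ^ (-((ofLex β).1 * (ofLex α).2)) * (X₁ θ ^ (ofLex α).1 * X₁ θ ^ (ofLex β).1 *
          (X₂ θ ^ (ofLex α).2 * X₂ θ ^ (ofLex β).2)) := by
        rw [h3, ← mul_assoc (X₁ θ ^ (ofLex α).1), ← htz]
        simp only [mul_assoc]
      _ = _ := by rw [← zpow_add, ← zpow_add]; rfl
  have h4 := congrArg Units.val h2
  rw [Units.val_mul, Units.val_mul, htv, ← Algebra.smul_def] at h4
  exact h4

lemma cocycle_add_left (α β γ : ℤ ×ₗ ℤ) :
    cocycle θ (α + β) γ = cocycle θ α γ * cocycle θ β γ := by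
  simp only [cocycle]
  rw [← Units.val_mul, ← zpow_add, ofLex_add, Prod.snd_add]
  congr 2
  ring

lemma cocycle_add_right (α β γ : ℤ ×ₗ ℤ) :
    cocycle θ α (β + γ) = cocycle θ α β * cocycle θ α γ := by
  simp only [cocycle]
  rw [← Units.val_mul, ← zpow_add, ofLex_add, Prod.fst_add]
  congr 2
  ring

section Representation

/-- Shift in the first variable. -/
def shift₁ (k : Type*) [Field k] : (Module.End k (ℤ → ℤ → k))ˣ where
  val := { toFun := fun f a b => f (a - 1) b, map_add' := fun _ _ => rfl,
           map_smul' := fun _ _ => rfl }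
  inv := { toFun := fun f a b => f (a + 1) b, map_add' := fun _ _ => rfl,
           map_smul' := fun _ _ => rfl }
  val_inv := by ext f a b; simp
  inv_val := by ext f a b; simp

/-- Twisted shift in the second variable. -/
def shift₂ (θ : kˣ) : (Module.End k (ℤ → ℤ → k))ˣ where
  val := { toFun := fun f a b => ((θ ^ (-a) : kˣ) : k) * f a (b - 1),
           map_add' := fun _ _ => by ext; simp [mul_add],
           map_smul' := fun _ _ => by ext; simp [mul_left_comm] }
  inv := { toFun := fun f a b => ((θ ^ a : kˣ) : k) * f a (b + 1),
           map_add' := fun _ _ => by ext; simp [mul_add],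
           map_smul' := fun _ _ => by ext; simp [mul_left_comm] }
  val_inv := by ext f a b; simp [inv_mul_cancel_left₀ (zpow_ne_zero a θ.ne_zero)]
  inv_val := by ext f a b; simp [mul_inv_cancel_left₀ (zpow_ne_zero a θ.ne_zero)]

lemma shift₁_zpow (i : ℤ) (f : ℤ → ℤ → k) (a b : ℤ) :
    ((shift₁ k ^ i : (Module.End k (ℤ → ℤ → k))ˣ) : Module.End k (ℤ → ℤ → k)) f a b =
      f (a - i) b := by
  have h1 : ∀ f a b, (shift₁ k : Module.End k (ℤ → ℤ → k)) f a b = f (a - 1) b :=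
    fun _ _ _ => rfl
  have h2 : ∀ f a b, ((shift₁ k)⁻¹ : (Module.End k (ℤ → ℤ → k))ˣ).val f a b = f (a + 1) b :=
    fun _ _ _ => rfl
  induction i using Int.induction_on generalizing f a b with
  | zero => simp
  | succ n ih =>
    rw [zpow_add_one, Units.val_mul, Module.End.mul_apply, ih, h1]
    congr 1; ring
  | pred n ih =>
    rw [zpow_sub_one, Units.val_mul, Module.End.mul_apply, ih, h2]
    congr 1; ring

lemma shift₂_zpow (j : ℤ) (f : ℤ → ℤ → k) (a b : ℤ) :
    ((shift₂ θ ^ j : (Module.End k (ℤ → ℤ → k))ˣ) : Module.End k (ℤ → ℤ → k)) f a b =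
      ((θ ^ (-(a * j)) : kˣ) : k) * f a (b - j) := by
  have h1 : ∀ f a b, (shift₂ θ : Module.End k (ℤ → ℤ → k)) f a b =
    ((θ ^ (-a) : kˣ) : k) * f a (b - 1) := fun _ _ _ => rfl
  have h2 : ∀ f a b, ((shift₂ θ)⁻¹ : (Module.End k (ℤ → ℤ → k))ˣ).val f a b =
    ((θ ^ a : kˣ) : k) * f a (b + 1) := fun _ _ _ => rfl
  induction j using Int.induction_on generalizing f a b with
  | zero => simp
  | succ n ih =>
    rw [zpow_add_one, Units.val_mul, Module.End.mul_apply, ih, h1, ← mul_assoc, ← Units.val_mul,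
      ← zpow_add]
    congr 2 <;> [(congr 2; ring); ring]
  | pred n ih =>
    rw [zpow_sub_one, Units.val_mul, Module.End.mul_apply, ih, h2, ← mul_assoc, ← Units.val_mul,
      ← zpow_add]
    congr 2 <;> [(congr 2; ring); ring]

/-- The representation of the quantum torus on functions on the lattice. -/
noncomputable def rep (θ : kˣ) : QuantumTorus θ →ₐ[k] Module.End k (ℤ → ℤ → k) :=
  lift (shift₁ k) (shift₂ θ) (by
    ext f a b
    change ((θ ^ (-(a - 1)) : kˣ) : k) * f (a - 1) (b - 1) =
      (θ : k) * (((θ ^ (-a) : kˣ) : k) * f (a - 1) (b - 1))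
    rw [← mul_assoc, ← Units.val_mul, ← zpow_one_add]
    congr 3; ring)

lemma rep_monomial (α : ℤ ×ₗ ℤ) (f : ℤ → ℤ → k) (a b : ℤ) :
    rep θ (monomial θ α) f a b =
      ((θ ^ (-((a - (ofLex α).1) * (ofLex α).2)) : kˣ) : k) *
        f (a - (ofLex α).1) (b - (ofLex α).2) := by
  have h : Units.map (rep θ : QuantumTorus θ →* _) (monomial θ α) =
      shift₁ k ^ (ofLex α).1 * shift₂ θ ^ (ofLex α).2 := by
    have e₁ : Units.map (rep θ : QuantumTorus θ →* _) (X₁ θ) = shift₁ k := Units.ext (lift_X₁ _ _ _)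
    have e₂ : Units.map (rep θ : QuantumTorus θ →* _) (X₂ θ) = shift₂ θ := Units.ext (lift_X₂ _ _ _)
    rw [monomial, map_mul, map_zpow, map_zpow, e₁, e₂]
  have h' : rep θ (monomial θ α) = (shift₁ k ^ (ofLex α).1 * shift₂ θ ^ (ofLex α).2 :
    (Module.End k (ℤ → ℤ → k))ˣ).val := congrArg Units.val h
  rw [h', Units.val_mul, Module.End.mul_apply, shift₁_zpow, shift₂_zpow]

end Representation

/-- In the representation on functions on `ℤ²`, the monomial of exponent `α` sends the delta
function at the origin to the one at `α`. -/
lemma linearIndependent_monomial :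
    LinearIndependent k (fun α => (monomial θ α : QuantumTorus θ)) := by
  rw [linearIndependent_iff']
  intro s c hc α hα
  have h := congrArg (fun x => rep θ x (Pi.single 0 (Pi.single 0 1)) (ofLex α).1 (ofLex α).2) hc
  simp only [map_sum, map_smul, map_zero, LinearMap.sum_apply, LinearMap.smul_apply,
    Finset.sum_apply, Pi.smul_apply, rep_monomial, LinearMap.zero_apply, Pi.zero_apply] at h
  rw [Finset.sum_eq_single α] at h
  · simpa using h
  · intro β _ hβ
    have : (ofLex α).1 - (ofLex β).1 ≠ 0 ∨ (ofLex α).2 - (ofLex β).2 ≠ 0 := by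
      by_contra hcon
      push Not at hcon
      refine hβ ?_
      have : ofLex β = ofLex α := Prod.ext (sub_eq_zero.1 hcon.1).symm (sub_eq_zero.1 hcon.2).symm
      exact ofLex_inj.1 this
    rcases this with h1 | h1
    · rw [Pi.single_eq_of_ne h1]; simp
    · by_cases h2 : (ofLex α).1 - (ofLex β).1 = 0
      · rw [h2, Pi.single_eq_same, Pi.single_eq_of_ne h1]; simp
      · rw [Pi.single_eq_of_ne h2]; simp
  · exact fun h' => absurd hα h'

lemma span_monomial :
    ⊤ ≤ Submodule.span k (Set.range fun α => (monomial θ α : QuantumTorus θ)) := by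
  have hm : ∀ α, (monomial θ α : QuantumTorus θ) ∈
      Submodule.span k (Set.range fun α => (monomial θ α : QuantumTorus θ)) :=
    fun α => Submodule.subset_span ⟨α, rfl⟩
  intro x _
  induction x using induction_on with
  | halg c =>
    have h := hm 0
    rw [Algebra.algebraMap_eq_smul_one]
    refine Submodule.smul_mem _ _ ?_
    simpa [monomial] using h
  | h₁ => simpa [monomial] using hm (toLex (1, 0))
  | h₂ => simpa [monomial] using hm (toLex (0, 1))
  | h₁' => simpa [monomial] using hm (toLex (-1, 0))
  | h₂' => simpa [monomial] using hm (toLex (0, -1))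
  | hmul x y hx hy =>
    have h := Submodule.mul_mem_mul (hx trivial) (hy trivial)
    rw [Submodule.span_mul_span] at h
    refine Submodule.span_le.2 ?_ h
    rintro _ ⟨_, ⟨α, rfl⟩, _, ⟨β, rfl⟩, rfl⟩
    change (monomial θ α * monomial θ β : QuantumTorus θ) ∈ _
    rw [monomial_mul_monomial]
    exact Submodule.smul_mem _ _ (hm _)
  | hadd x y hx hy => exact add_mem (hx trivial) (hy trivial)

/-- The basis of monomials of the quantum torus. -/
noncomputable def twistedBasis (θ : kˣ) : TwistedBasis k (ℤ ×ₗ ℤ) (QuantumTorus θ) where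
  u := Module.Basis.mk linearIndependent_monomial span_monomial
  c := cocycle θ
  c_ne_zero _ _ := Units.ne_zero _
  c_add_left := cocycle_add_left
  c_add_right := cocycle_add_right
  u_mul_u α β := by
    simp only [Module.Basis.mk_apply]
    exact monomial_mul_monomial α β

lemma twistedBasis_u (α : ℤ ×ₗ ℤ) : (twistedBasis θ).u α = monomial θ α := by
  simp [twistedBasis]

end QuantumTorus

/-! ### Leading exponents for an ordered index group. -/

namespace TwistedBasis

section Degree

variable {k Γ A : Type*} [Field k] [AddCommGroup Γ] [LinearOrder Γ]
  [Ring A] [Algebra k A] (T : TwistedBasis k Γ A)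

/-- `γ` is the leading exponent of `x`. -/
def IsDeg (x : A) (γ : Γ) : Prop :=
  T.u.repr x γ ≠ 0 ∧ ∀ δ, T.u.repr x δ ≠ 0 → δ ≤ γ

variable {T}

lemma IsDeg.unique {x : A} {γ δ : Γ} (h : T.IsDeg x γ) (h' : T.IsDeg x δ) : γ = δ :=
  le_antisymm (h'.2 _ h.1) (h.2 _ h'.1)

lemma IsDeg.ne_zero {x : A} {γ : Γ} (h : T.IsDeg x γ) : x ≠ 0 := by
  rintro rfl
  exact h.1 (by simp)

variable (T)

lemma exists_isDeg {x : A} (hx : x ≠ 0) : ∃ γ, T.IsDeg x γ := by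
  have hs : (T.u.repr x).support.Nonempty := by
    rw [Finsupp.support_nonempty_iff]
    simpa using hx
  refine ⟨(T.u.repr x).support.max' hs, Finsupp.mem_support_iff.1 (Finset.max'_mem _ _), ?_⟩
  exact fun δ hδ => Finset.le_max' _ _ (Finsupp.mem_support_iff.2 hδ)

lemma isDeg_smul_u {c : k} (hc : c ≠ 0) (γ : Γ) : T.IsDeg (c • T.u γ) γ := by
  refine ⟨by simpa using hc, fun δ hδ => ?_⟩
  by_cases h : γ = δ
  · exact h.ge
  · simp [h] at hδ

lemma isDeg_one : T.IsDeg 1 0 := by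
  simpa [T.u_zero] using T.isDeg_smul_u one_ne_zero 0

variable [IsOrderedAddMonoid Γ] {T}

lemma IsDeg.repr_mul {x y : A} {α β : Γ} (hx : T.IsDeg x α) (hy : T.IsDeg y β) :
    T.u.repr (x * y) (α + β) = T.u.repr x α * T.c α β * T.u.repr y β := by
  rw [TwistedBasis.repr_mul, Finsupp.sum, Finset.sum_eq_single α]
  · rw [add_sub_cancel_left]
  · intro γ hγ hne
    by_contra h
    have h1 := hx.2 γ (Finsupp.mem_support_iff.1 hγ)
    have h2 := hy.2 _ (right_ne_zero_of_mul h)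
    have h3 : α + β ≤ γ + β := by
      rw [sub_le_iff_le_add] at h2
      rwa [add_comm γ]
    exact hne (le_antisymm h1 (le_of_add_le_add_right h3))
  · intro h
    exact absurd (Finsupp.notMem_support_iff.1 h) hx.1

lemma IsDeg.mul {x y : A} {α β : Γ} (hx : T.IsDeg x α) (hy : T.IsDeg y β) :
    T.IsDeg (x * y) (α + β) := by
  refine ⟨?_, fun δ hδ => ?_⟩
  · rw [hx.repr_mul hy]
    exact mul_ne_zero (mul_ne_zero hx.1 (T.c_ne_zero _ _)) hy.1
  · rw [TwistedBasis.repr_mul, Finsupp.sum] at hδ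
    obtain ⟨γ, hγ, h⟩ := Finset.exists_ne_zero_of_sum_ne_zero hδ
    have h1 := hx.2 γ (Finsupp.mem_support_iff.1 hγ)
    have h2 := hy.2 _ (right_ne_zero_of_mul h)
    calc δ = γ + (δ - γ) := by abel
      _ ≤ α + β := add_le_add h1 h2

lemma IsDeg.pow {x : A} {α : Γ} (hx : T.IsDeg x α) (n : ℕ) : T.IsDeg (x ^ n) (n • α) := by
  induction n with
  | zero => simpa using T.isDeg_one
  | succ n ih => rw [pow_succ, succ_nsmul]; exact ih.mul hx

lemma noZeroDivisors (T : TwistedBasis k Γ A) : NoZeroDivisors A := by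
  refine ⟨fun {x y} h => ?_⟩
  by_contra hcon
  push Not at hcon
  obtain ⟨α, hα⟩ := T.exists_isDeg hcon.1
  obtain ⟨β, hβ⟩ := T.exists_isDeg hcon.2
  exact (hα.mul hβ).ne_zero h

lemma isDomain (T : TwistedBasis k Γ A) : IsDomain A :=
  have := T.noZeroDivisors
  have := T.nontrivial
  NoZeroDivisors.to_isDomain A

/-- The same basis with the order of the index group reversed. -/
noncomputable def dual (T : TwistedBasis k Γ A) : TwistedBasis k Γᵒᵈ A where
  u := T.u.reindex OrderDual.toDual
  c α β := T.c (OrderDual.ofDual α) (OrderDual.ofDual β)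
  c_ne_zero _ _ := T.c_ne_zero _ _
  c_add_left _ _ _ := T.c_add_left _ _ _
  c_add_right _ _ _ := T.c_add_right _ _ _
  u_mul_u α β := by simpa using T.u_mul_u _ _

/-- Units are monomials. -/
lemma exists_eq_smul_u_of_isUnit (T : TwistedBasis k Γ A) {x : A} (hx : IsUnit x) :
    ∃ (c : k) (γ : Γ), c ≠ 0 ∧ x = c • T.u γ := by
  obtain ⟨y, hxy⟩ := hx.exists_right_inv
  have hnt := T.nontrivial
  have hx0 : x ≠ 0 := hx.ne_zero
  have hy0 : y ≠ 0 := by rintro rfl; simp at hxy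
  obtain ⟨α, hα⟩ := T.exists_isDeg hx0
  obtain ⟨β, hβ⟩ := T.exists_isDeg hy0
  -- The reversed order provides lowest exponents. Both the highest and the lowest exponents of `x`
  -- and of its inverse add up to zero, which forces the highest and lowest exponents of `x` to
  -- agree.
  obtain ⟨α', hα'⟩ := T.dual.exists_isDeg hx0
  obtain ⟨β', hβ'⟩ := T.dual.exists_isDeg hy0
  have h1 : α + β = 0 := (hα.mul hβ).unique (hxy ▸ T.isDeg_one)
  have h2 : α' + β' = 0 := (hα'.mul hβ').unique (hxy ▸ T.dual.isDeg_one)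
  have hrepr : ∀ (z : A) (γ : Γ), T.dual.u.repr z (OrderDual.toDual γ) = T.u.repr z γ :=
    fun z γ => by simp [dual]
  have hlow : ∀ γ, T.u.repr x γ ≠ 0 → OrderDual.ofDual α' ≤ γ := fun γ hγ =>
    hα'.2 (OrderDual.toDual γ) (by rwa [hrepr])
  have hlowy : OrderDual.ofDual β' ≤ β := hβ'.2 (OrderDual.toDual β) (by rw [hrepr]; exact hβ.1)
  have h2' : OrderDual.ofDual α' + OrderDual.ofDual β' = 0 := h2
  have hle : α ≤ OrderDual.ofDual α' := by
    rw [eq_neg_of_add_eq_zero_left h1, eq_neg_of_add_eq_zero_left h2']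
    exact neg_le_neg hlowy
  refine ⟨T.u.repr x α, α, hα.1, T.u.repr.injective (Finsupp.ext fun γ => ?_)⟩
  by_cases hγ : α = γ
  · subst hγ; simp
  · rw [map_smul, Finsupp.smul_apply, Module.Basis.repr_self, Finsupp.single_eq_of_ne (Ne.symm hγ),
      smul_zero]
    by_contra hne
    exact hγ (le_antisymm (hle.trans (hlow γ hne)) (hα.2 γ hne))

end Degree

section FiniteOrder

variable {k Γ A : Type*} [Field k] [AddCommGroup Γ] [Ring A] [Algebra k A]

/-- `N • Γ` is radical, so the quotient is a finitely generated torsion group. -/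
lemma finite_quotient_rad (T : TwistedBasis k Γ A) [AddGroup.FG Γ] {N : ℕ} (hN : 0 < N)
    (h : ∀ α β, T.c α β ^ N = 1) : Finite (Γ ⧸ T.rad) := by
  refine AddCommGroup.finite_of_fg_isAddTorsion _ fun q => ?_
  obtain ⟨γ, rfl⟩ := QuotientAddGroup.mk_surjective q
  rw [isOfFinAddOrder_iff_nsmul_eq_zero]
  refine ⟨N, hN, ?_⟩
  rw [← QuotientAddGroup.mk_nsmul, QuotientAddGroup.eq_zero_iff]
  intro δ
  rw [T.c_nsmul_left, T.c_nsmul_right, h, h]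

end FiniteOrder

/-- Transport of a twisted basis along an isomorphism. -/
noncomputable def map {k Γ A B : Type*} [Field k] [AddCommGroup Γ] [Ring A] [Algebra k A] [Ring B]
    [Algebra k B] (T : TwistedBasis k Γ A) (e : A ≃ₐ[k] B) : TwistedBasis k Γ B where
  u := T.u.map e.toLinearEquiv
  c := T.c
  c_ne_zero := T.c_ne_zero
  c_add_left := T.c_add_left
  c_add_right := T.c_add_right
  u_mul_u α β := by simp [← map_mul, T.u_mul_u]

/-! ### The clock and shift basis of a matrix algebra. -/

section Matrix

open Matrix

variable {k Γ A : Type*} [Field k] [AddCommGroup Γ] [Ring A] [Algebra k A]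
  (T : TwistedBasis k Γ A) {g : ℕ} [NeZero g] (ψ : AddChar (ZMod g) k)

/-- The product of a clock and a shift matrix with a basis element. -/
noncomputable def clockShift (α : (ZMod g × ZMod g) × Γ) : Matrix (ZMod g) (ZMod g) A :=
  Matrix.of fun r s => if r = s + α.1.2 then ψ (α.1.1 * r) • T.u α.2 else 0

omit [NeZero g] in
lemma clockShift_apply (α : (ZMod g × ZMod g) × Γ) (r s : ZMod g) :
    T.clockShift ψ α r s = if r = s + α.1.2 then ψ (α.1.1 * r) • T.u α.2 else 0 := rfl

/-- The cocycle of the clock and shift basis. -/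
noncomputable def matrixCocycle (α β : (ZMod g × ZMod g) × Γ) : k :=
  ψ (-(β.1.1 * α.1.2)) * T.c α.2 β.2

omit [NeZero g] in
lemma addChar_ne_zero (x : ZMod g) : ψ x ≠ 0 := (ψ.val_isUnit x).ne_zero

lemma clockShift_mul (α β : (ZMod g × ZMod g) × Γ) :
    T.clockShift ψ α * T.clockShift ψ β = T.matrixCocycle ψ α β • T.clockShift ψ (α + β) := by
  ext r s
  rw [mul_apply, Matrix.smul_apply, Finset.sum_eq_single (r - α.1.2)]
  · simp only [clockShift_apply, sub_add_cancel, if_true, Prod.fst_add, Prod.snd_add,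
      matrixCocycle]
    by_cases h : r - α.1.2 = s + β.1.2
    · have h' : r = s + (α.1.2 + β.1.2) := by
        rw [sub_eq_iff_eq_add] at h
        rw [h]; ring
      rw [if_pos h, if_pos h', smul_mul_smul_comm, T.u_mul_u, smul_smul, smul_smul,
        mul_right_comm _ _ (ψ _), ← AddChar.map_add_eq_mul, ← AddChar.map_add_eq_mul]
      congr 3
      ring
    · have h' : ¬ r = s + (α.1.2 + β.1.2) := fun h' => h (by rw [h']; ring)
      rw [if_neg h, if_neg h', mul_zero, smul_zero]
  · intro t _ ht
    rw [clockShift_apply, if_neg, zero_mul]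
    intro h
    exact ht (by rw [h]; ring)
  · exact fun h => absurd (Finset.mem_univ _) h

variable {ψ}

lemma sum_addChar (hψ : ψ.IsPrimitive) (x : ZMod g) :
    ∑ i, ψ (i * x) = if x = 0 then (g : k) else 0 := by
  have h := AddChar.sum_mulShift x hψ
  rw [ZMod.card] at h
  rw [h]
  simp

variable [CharZero k]

lemma linearIndependent_clockShift (hψ : ψ.IsPrimitive) :
    LinearIndependent k (T.clockShift ψ) := by
  classical
  rw [linearIndependent_iff']
  intro S c hc α hα
  -- A dual functional: the Fourier coefficient along the shifted diagonal of `α`, read at the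
  -- exponent `α.2`. Orthogonality of characters makes it `g` on the member `α` and `0` on the
  -- others.
  let D : Matrix (ZMod g) (ZMod g) A →ₗ[k] k :=
    ∑ r, ψ (-(α.1.1 * r)) • (Finsupp.lapply α.2 ∘ₗ T.u.repr.toLinearMap ∘ₗ
      Matrix.entryLinearMap k A r (r - α.1.2))
  have hD : ∀ M, D M = ∑ r, ψ (-(α.1.1 * r)) * T.u.repr (M r (r - α.1.2)) α.2 := fun M => by
    simp [D]
  have hDβ : ∀ β, D (T.clockShift ψ β) = if β = α then (g : k) else 0 := by
    intro β
    rw [hD]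
    by_cases h2 : β.1.2 = α.1.2
    · have h3 : ∀ r, T.clockShift ψ β r (r - α.1.2) = ψ (β.1.1 * r) • T.u β.2 := fun r => by
        rw [clockShift_apply, h2, sub_add_cancel, if_pos rfl]
      simp only [h3, map_smul, Finsupp.smul_apply, smul_eq_mul, Module.Basis.repr_self]
      by_cases h4 : β.2 = α.2
      · rw [h4]
        simp only [Finsupp.single_eq_same, mul_one, ← AddChar.map_add_eq_mul]
        have h5 : ∀ r : ZMod g, -(α.1.1 * r) + β.1.1 * r = r * (β.1.1 - α.1.1) := fun r => by ring
        simp only [h5, sum_addChar hψ, sub_eq_zero]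
        exact if_congr ⟨fun h => Prod.ext (Prod.ext h h2) h4, fun h => by rw [h]⟩ rfl rfl
      · rw [if_neg (fun h => h4 (by rw [h]))]
        simp [Ne.symm h4]
    · rw [if_neg (fun h => h2 (by rw [h]))]
      refine Finset.sum_eq_zero fun r _ => ?_
      rw [clockShift_apply, if_neg, map_zero, Finsupp.zero_apply, mul_zero]
      intro h
      refine h2 ?_
      rw [eq_comm, sub_add_eq_add_sub, sub_eq_iff_eq_add] at h
      exact add_left_cancel h
  have h := congrArg D hc
  rw [map_sum, map_zero] at h
  simp only [map_smul, hDβ, smul_eq_mul, mul_ite, mul_zero, Finset.sum_ite_eq', hα, if_true] at h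
  exact (mul_eq_zero.1 h).resolve_right (Nat.cast_ne_zero.2 (NeZero.ne g))

lemma span_clockShift (hψ : ψ.IsPrimitive) :
    ⊤ ≤ Submodule.span k (Set.range (T.clockShift ψ)) := by
  have hg : (g : k) ≠ 0 := Nat.cast_ne_zero.2 (NeZero.ne g)
  have hs : ∀ r s γ, Matrix.single r s (T.u γ) ∈ Submodule.span k (Set.range (T.clockShift ψ)) := by
    intro r s γ
    -- Fourier inversion along a shifted diagonal.
    have h : Matrix.single r s (T.u γ) =
        (g : k)⁻¹ • ∑ i, ψ (-(i * r)) • T.clockShift ψ ((i, r - s), γ) := by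
      ext r' s'
      rw [Matrix.smul_apply, Matrix.sum_apply]
      simp only [Matrix.smul_apply, clockShift_apply, smul_ite, smul_zero, smul_smul,
        ← AddChar.map_add_eq_mul]
      by_cases h1 : r' = s' + (r - s)
      · simp only [if_pos h1, ← Finset.sum_smul]
        have h5 : ∀ i : ZMod g, -(i * r) + i * r' = i * (r' - r) := fun i => by ring
        simp only [h5, sum_addChar hψ]
        by_cases h2 : r' = r
        · have h3 : s' = s := by
            rw [h2] at h1
            linear_combination -h1
          rw [h2, h3, sub_self, if_pos rfl, smul_smul, inv_mul_cancel₀ hg, one_smul,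
            Matrix.single_apply_same]
        · rw [if_neg (sub_ne_zero.2 h2), zero_smul, smul_zero,
            Matrix.single_apply_of_ne _ _ _ _ _ (fun h => h2 h.1.symm)]
      · simp only [if_neg h1, Finset.sum_const_zero, smul_zero]
        refine Matrix.single_apply_of_ne _ _ _ _ _ (fun h => h1 ?_)
        rw [← h.1, ← h.2]; ring
    rw [h]
    exact Submodule.smul_mem _ _ (Submodule.sum_mem _ fun i _ => Submodule.smul_mem _ _
      (Submodule.subset_span ⟨_, rfl⟩))
  intro M _
  rw [matrix_eq_sum_single M]
  refine Submodule.sum_mem _ fun r _ => Submodule.sum_mem _ fun s _ => ?_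
  have h : (⊤ : Submodule k A) ≤ (Submodule.span k (Set.range (T.clockShift ψ))).comap
      (Matrix.singleLinearMap k r s) := by
    rw [← T.u.span_eq, Submodule.span_le]
    rintro _ ⟨γ, rfl⟩
    exact hs r s γ
  exact h trivial

/-- The clock and shift basis of a matrix algebra. -/
noncomputable def matrixZMod (hψ : ψ.IsPrimitive) :
    TwistedBasis k ((ZMod g × ZMod g) × Γ) (Matrix (ZMod g) (ZMod g) A) where
  u := Module.Basis.mk (T.linearIndependent_clockShift hψ) (T.span_clockShift hψ)
  c := T.matrixCocycle ψ
  c_ne_zero _ _ := mul_ne_zero (addChar_ne_zero _ _) (T.c_ne_zero _ _)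
  c_add_left α β γ := by
    simp only [matrixCocycle, Prod.fst_add, Prod.snd_add, T.c_add_left, mul_add, neg_add,
      AddChar.map_add_eq_mul]
    ring
  c_add_right α β γ := by
    simp only [matrixCocycle, Prod.fst_add, Prod.snd_add, T.c_add_right, add_mul, neg_add,
      AddChar.map_add_eq_mul]
    ring
  u_mul_u α β := by
    simp only [Module.Basis.mk_apply]
    exact T.clockShift_mul ψ α β

/-- The clock and shift basis of a matrix algebra. -/
noncomputable def matrix (hψ : ψ.IsPrimitive) :
    TwistedBasis k ((ZMod g × ZMod g) × Γ) (Matrix (Fin g) (Fin g) A) :=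
  (T.matrixZMod hψ).map (Matrix.reindexAlgEquiv k A (ZMod.finEquiv g).symm.toEquiv)

lemma matrix_c_pow (hψ : ψ.IsPrimitive) {N : ℕ} (hN : ∀ α β, T.c α β ^ N = 1)
    (α β : (ZMod g × ZMod g) × Γ) : (T.matrix hψ).c α β ^ (g * N) = 1 := by
  change (ψ (-(β.1.1 * α.1.2)) * T.c α.2 β.2) ^ (g * N) = 1
  rw [mul_pow, mul_comm g N, pow_mul (T.c _ _), hN, one_pow, mul_one, mul_comm N g, pow_mul,
    ← AddChar.map_nsmul_eq_pow, nsmul_eq_mul, CharP.cast_eq_zero, zero_mul, AddChar.map_zero_eq_one,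
    one_pow]

end Matrix

end TwistedBasis

namespace QuantumTorus

variable {k : Type*} [Field k] {θ : kˣ}

instance : AddGroup.FG (ℤ ×ₗ ℤ) :=
  AddGroup.fg_of_surjective (f := (toLexAddEquiv (ℤ × ℤ)).toAddMonoidHom)
    (toLexAddEquiv (ℤ × ℤ)).surjective

lemma cocycle_pow_orderOf (α β : ℤ ×ₗ ℤ) : cocycle θ α β ^ orderOf θ = 1 := by
  rw [cocycle, ← Units.val_pow_eq_pow_val, ← zpow_natCast, zpow_comm, zpow_natCast, pow_orderOf_eq_one,
    one_zpow, Units.val_one]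

instance : IsDomain (QuantumTorus θ) := (twistedBasis θ).isDomain

instance (g : ℕ) [NeZero g] :
    IsDomain (Subalgebra.center k (Matrix (Fin g) (Fin g) (QuantumTorus θ))) := by
  have h1 : ∀ z : Subalgebra.center k (Matrix (Fin g) (Fin g) (QuantumTorus θ)),
      ∃ q, (z : Matrix (Fin g) (Fin g) (QuantumTorus θ)) = Matrix.scalar (Fin g) q := by
    intro z
    obtain ⟨q, _, hq⟩ := Matrix.subalgebraCenter_eq_scalarAlgHom_map.le z.2
    exact ⟨q, hq.symm⟩
  have : NoZeroDivisors (Subalgebra.center k (Matrix (Fin g) (Fin g) (QuantumTorus θ))) := by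
    refine ⟨fun {z w} h => ?_⟩
    obtain ⟨p, hp⟩ := h1 z
    obtain ⟨q, hq⟩ := h1 w
    have h2 := congrArg Subtype.val h
    rw [Subalgebra.coe_mul, hp, hq, ← map_mul] at h2
    have h3 : p * q = 0 := by
      have := congrFun (congrFun h2 0) 0
      simpa using this
    rcases mul_eq_zero.1 h3 with h4 | h4
    · left; exact Subtype.ext (by rw [hp, h4, map_zero]; rfl)
    · right; exact Subtype.ext (by rw [hq, h4, map_zero]; rfl)
  exact NoZeroDivisors.to_isDomain _

end QuantumTorus

/-! ### Rank arguments over the center. -/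

namespace TwistedBasis

variable {k Γ A : Type*} [Field k] [AddCommGroup Γ] [Ring A] [Algebra k A]

section Rank

variable {Z : Type*} [CommRing Z] [IsDomain Z] [Algebra k Z] [Algebra Z A] [IsScalarTower k Z A]
  [FaithfulSMul Z A] [Algebra.IsCentral Z A]

/-- Right linear combinations of vectors, as a map linear over the center. -/
def rightComb (Z : Type*) [CommRing Z] [Algebra Z A] {n g : ℕ} (a : Fin n → Fin g → A) :
    (Fin n → A) →ₗ[Z] (Fin g → A) where
  toFun q r := ∑ i, a i r * q i
  map_add' p q := by ext r; simp [mul_add, Finset.sum_add_distrib]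
  map_smul' z q := by ext r; simp [Finset.smul_sum]

lemma finrank_pi (T : TwistedBasis k Γ A) [Finite (Γ ⧸ T.rad)] (n : ℕ) :
    Module.finrank Z (Fin n → A) = n * Nat.card (Γ ⧸ T.rad) := by
  have : Module.Free Z A := Module.Free.of_basis T.centerBasis
  have : Module.Finite Z A := Module.Finite.of_basis T.centerBasis
  have : Nontrivial Z := inferInstance
  rw [Module.finrank_pi_fintype]
  simp only [Module.finrank_eq_nat_card_basis (T.centerBasis (Z := Z)), Finset.sum_const,
    Finset.card_univ, Fintype.card_fin, smul_eq_mul]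

/-- Right independence is injectivity of a `Z`-linear map `A^n → A^g`. Comparing ranks and
cancelling the positive rank of `A` gives the bound. -/
lemma card_le_of_right_independent_aux (Z : Type*) [CommRing Z] [IsDomain Z] [Algebra k Z]
    [Algebra Z A] [IsScalarTower k Z A] [FaithfulSMul Z A] [Algebra.IsCentral Z A]
    (T : TwistedBasis k Γ A) [Finite (Γ ⧸ T.rad)] {n g : ℕ}
    (a : Fin n → Fin g → A) (ha : ∀ q : Fin n → A, (∀ r, ∑ i, a i r * q i = 0) → q = 0) :
    n ≤ g := by
  have : Module.Free Z A := Module.Free.of_basis T.centerBasis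
  have : Module.Finite Z A := Module.Finite.of_basis T.centerBasis
  have h : Function.Injective (rightComb Z a) := by
    rw [injective_iff_map_eq_zero]
    exact fun q hq => ha q fun r => congrFun hq r
  have h1 := LinearMap.finrank_le_finrank_of_injective h
  rw [T.finrank_pi, T.finrank_pi] at h1
  exact Nat.le_of_mul_le_mul_right h1 Nat.card_pos

lemma exists_right_comb_aux (Z : Type*) [CommRing Z] [IsDomain Z] [Algebra k Z]
    [Algebra Z A] [IsScalarTower k Z A] [FaithfulSMul Z A] [Algebra.IsCentral Z A]
    (T : TwistedBasis k Γ A) [Finite (Γ ⧸ T.rad)] {g : ℕ}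
    (a : Fin g → Fin g → A) (ha : ∀ q : Fin g → A, (∀ r, ∑ i, a i r * q i = 0) → q = 0)
    (b : Fin g → A) : ∃ (z : A) (q : Fin g → A), z ∈ Subalgebra.center k A ∧ z ≠ 0 ∧
      ∀ r, b r * z = ∑ i, a i r * q i := by
  have : Module.Free Z A := Module.Free.of_basis T.centerBasis
  have : Module.Finite Z A := Module.Finite.of_basis T.centerBasis
  -- The source has rank one more than the target, so there is a kernel element; right independence
  -- makes its `Z`-component nonzero.
  let f : (Fin g → A) × Z →ₗ[Z] (Fin g → A) :=
    (rightComb Z a).coprod (LinearMap.toSpanSingleton Z (Fin g → A) b)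
  have h : ¬ Function.Injective f := by
    intro h
    have h1 := LinearMap.finrank_le_finrank_of_injective h
    rw [Module.finrank_prod, Module.finrank_self] at h1
    omega
  rw [injective_iff_map_eq_zero] at h
  push Not at h
  obtain ⟨⟨q, z⟩, h1, h2⟩ := h
  have h3 : ∀ r, ∑ i, a i r * q i + z • b r = 0 := fun r => congrFun h1 r
  have hz : z ≠ 0 := by
    rintro rfl
    refine h2 ?_
    rw [ha q fun r => by simpa using h3 r]
    rfl
  refine ⟨algebraMap Z A z, -q, algebraMap_mem_center z, ?_, fun r => ?_⟩
  · rwa [Ne, FaithfulSMul.algebraMap_eq_zero_iff]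
  · have h4 := h3 r
    rw [Algebra.smul_def, Algebra.commutes] at h4
    simp only [Pi.neg_apply, mul_neg, Finset.sum_neg_distrib]
    exact eq_neg_of_add_eq_zero_right h4

end Rank

/-- An abstract copy of the center, acting on the algebra. -/
lemma card_le_of_right_independent_of_equiv {Z : Type*} [CommRing Z] [IsDomain Z] [Algebra k Z]
    (e : Z ≃ₐ[k] Subalgebra.center k A) (T : TwistedBasis k Γ A) [Finite (Γ ⧸ T.rad)] {g : ℕ} :
    (∀ (n : ℕ) (a : Fin n → Fin g → A),
      (∀ q : Fin n → A, (∀ r, ∑ i, a i r * q i = 0) → q = 0) → n ≤ g) ∧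
    (∀ (a : Fin g → Fin g → A), (∀ q : Fin g → A, (∀ r, ∑ i, a i r * q i = 0) → q = 0) →
      ∀ b : Fin g → A, ∃ (z : A) (q : Fin g → A), z ∈ Subalgebra.center k A ∧ z ≠ 0 ∧
        ∀ r, b r * z = ∑ i, a i r * q i) := by
  let : Algebra Z A := ((Subalgebra.center k A).val.comp e.toAlgHom).toRingHom.toAlgebra'
    fun z x => (Subalgebra.mem_center_iff.1 (e z).2 x).symm
  have : FaithfulSMul Z A :=
    (faithfulSMul_iff_algebraMap_injective _ _).2 (Subtype.val_injective.comp e.injective)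
  have : IsScalarTower k Z A := IsScalarTower.of_algebraMap_eq fun c =>
    (((Subalgebra.center k A).val.comp e.toAlgHom).commutes c).symm
  have : Algebra.IsCentral Z A := ⟨fun x hx => Algebra.mem_bot.2
    ⟨e.symm ⟨x, Subalgebra.mem_center_iff.2 (Subalgebra.mem_center_iff.1 hx)⟩,
      congrArg Subtype.val (e.apply_symm_apply _)⟩⟩
  exact ⟨fun n a ha => T.card_le_of_right_independent_aux Z a ha,
    fun a ha b => T.exists_right_comb_aux Z a ha b⟩

variable [IsDomain (Subalgebra.center k A)]

/-- A right independent family of vectors has at most as many members as coordinates. -/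
lemma card_le_of_right_independent (T : TwistedBasis k Γ A) [Finite (Γ ⧸ T.rad)] {n g : ℕ}
    (a : Fin n → Fin g → A) (ha : ∀ q : Fin n → A, (∀ r, ∑ i, a i r * q i = 0) → q = 0) :
    n ≤ g :=
  (T.card_le_of_right_independent_of_equiv AlgEquiv.refl).1 n a ha

/-- Every vector is, up to a central denominator, a right combination of a right independent
family of maximal size. -/
lemma exists_right_comb (T : TwistedBasis k Γ A) [Finite (Γ ⧸ T.rad)] {g : ℕ}
    (a : Fin g → Fin g → A) (ha : ∀ q : Fin g → A, (∀ r, ∑ i, a i r * q i = 0) → q = 0)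
    (b : Fin g → A) : ∃ (z : A) (q : Fin g → A), z ∈ Subalgebra.center k A ∧ z ≠ 0 ∧
      ∀ r, b r * z = ∑ i, a i r * q i :=
  (T.card_le_of_right_independent_of_equiv AlgEquiv.refl).2 a ha b

end TwistedBasis

/-! ### Vectors cut out by orthogonal idempotents. -/

namespace Matrix

variable {A : Type*} [Ring A] [NoZeroDivisors A] {n g : ℕ}

omit [NoZeroDivisors A] in
lemma mulVec_mul_right (M : Matrix (Fin g) (Fin g) A) (a : Fin g → A) (q : A) (r : Fin g) :
    (M *ᵥ fun s => a s * q) r = (M *ᵥ a) r * q := by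
  simp [mulVec, dotProduct, Finset.sum_mul, mul_assoc]

/-- Vectors in the ranges of nonzero orthogonal idempotents. -/
lemma exists_right_independent (E : Fin n → Matrix (Fin g) (Fin g) A) (h0 : ∀ i, E i ≠ 0)
    (hE : ∀ i, E i * E i = E i) (hort : ∀ i j, i ≠ j → E i * E j = 0) :
    ∃ a : Fin n → Fin g → A, (∀ i, a i ≠ 0) ∧ (∀ i, E i *ᵥ a i = a i) ∧
      (∀ i j, i ≠ j → E i *ᵥ a j = 0) ∧
      (∀ q : Fin n → A, (∀ r, ∑ i, a i r * q i = 0) → q = 0) := by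
  -- A nonzero column of `E i` serves as the vector `a i`; applying `E j` to a relation then
  -- isolates its `j`-th term.
  have hcol : ∀ i, ∃ s, (fun r => E i r s) ≠ 0 := by
    intro i
    by_contra hcon
    push Not at hcon
    exact h0 i (Matrix.ext fun r s => congrFun (hcon s) r)
  choose s hs using hcol
  have hmul : ∀ i j, E i *ᵥ (fun r => E j r (s j)) = fun r => (E i * E j) r (s j) := fun i j => rfl
  have hdiag : ∀ i, E i *ᵥ (fun r => E i r (s i)) = fun r => E i r (s i) := fun i => by
    rw [hmul, hE]
  have hoff : ∀ i j, i ≠ j → E i *ᵥ (fun r => E j r (s j)) = 0 := fun i j hij => by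
    rw [hmul, hort i j hij]; rfl
  refine ⟨fun i r => E i r (s i), hs, hdiag, hoff, fun q hq => ?_⟩
  funext j
  obtain ⟨r, hr⟩ := Function.ne_iff.1 (hs j)
  have h1 : (E j *ᵥ fun r => ∑ i, E i r (s i) * q i) r = E j r (s j) * q j := by
    have h2 : (fun r => ∑ i, E i r (s i) * q i) = ∑ i, fun r => E i r (s i) * q i := by
      ext r; simp
    rw [h2, mulVec_sum, Finset.sum_apply, Finset.sum_eq_single j]
    · rw [mulVec_mul_right, hdiag]
    · intro i _ hij
      rw [mulVec_mul_right, hoff j i (Ne.symm hij), Pi.zero_apply, zero_mul]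
    · exact fun h => absurd (Finset.mem_univ _) h
  have h3 : (fun r => ∑ i, E i r (s i) * q i) = 0 := funext hq
  rw [h3, mulVec_zero] at h1
  exact (mul_eq_zero.1 h1.symm).resolve_left hr

end Matrix

/-! ### The map of centers induced by an isomorphism of matrix algebras. -/

namespace Matrix

variable {k A B : Type*} [Field k] [Ring A] [Algebra k A] [Ring B] [Algebra k B] {g : ℕ} [NeZero g]

omit [NeZero g] in
lemma exists_scalar_eq_of_center (ψ : Matrix (Fin g) (Fin g) A ≃ₐ[k] Matrix (Fin g) (Fin g) B)
    {z : A} (hz : z ∈ Subalgebra.center k A) :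
    ∃ w ∈ Subalgebra.center k B, ψ (scalar (Fin g) z) = scalar (Fin g) w := by
  have h1 : scalar (Fin g) z ∈ Subalgebra.center k (Matrix (Fin g) (Fin g) A) :=
    subalgebraCenter_eq_scalarAlgHom_map.ge ⟨z, hz, rfl⟩
  have h2 : ψ (scalar (Fin g) z) ∈ Subalgebra.center k (Matrix (Fin g) (Fin g) B) := by
    rw [Subalgebra.mem_center_iff] at h1 ⊢
    intro M
    obtain ⟨N, rfl⟩ := ψ.surjective M
    rw [← map_mul, ← map_mul, h1]
  obtain ⟨w, hw, h⟩ := subalgebraCenter_eq_scalarAlgHom_map.le h2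
  exact ⟨w, hw, h.symm⟩

lemma map_scalar_center (ψ : Matrix (Fin g) (Fin g) A ≃ₐ[k] Matrix (Fin g) (Fin g) B)
    {z : A} (hz : z ∈ Subalgebra.center k A) :
    ψ (scalar (Fin g) z) = scalar (Fin g) (ψ (scalar (Fin g) z) 0 0) := by
  obtain ⟨w, _, h⟩ := exists_scalar_eq_of_center ψ hz
  rw [h]
  simp

/-- The map of centers induced by an isomorphism of matrix algebras. -/
def centerEntry (ψ : Matrix (Fin g) (Fin g) A ≃ₐ[k] Matrix (Fin g) (Fin g) B) :
    Subalgebra.center k A →* B where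
  toFun z := ψ (scalar (Fin g) (z : A)) 0 0
  map_one' := by simp
  map_mul' z w := by
    rw [Subalgebra.coe_mul, map_mul, map_mul, map_scalar_center ψ z.2, map_scalar_center ψ w.2]
    simp

lemma map_scalar_coe (ψ : Matrix (Fin g) (Fin g) A ≃ₐ[k] Matrix (Fin g) (Fin g) B)
    (z : Subalgebra.center k A) : ψ (scalar (Fin g) (z : A)) = scalar (Fin g) (centerEntry ψ z) :=
  map_scalar_center ψ z.2

lemma centerEntry_mem (ψ : Matrix (Fin g) (Fin g) A ≃ₐ[k] Matrix (Fin g) (Fin g) B)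
    (z : Subalgebra.center k A) : centerEntry ψ z ∈ Subalgebra.center k B := by
  obtain ⟨w, hw, h⟩ := exists_scalar_eq_of_center ψ z.2
  rw [map_scalar_coe] at h
  rwa [scalar_inj.1 h]

lemma centerEntry_smul (ψ : Matrix (Fin g) (Fin g) A ≃ₐ[k] Matrix (Fin g) (Fin g) B) (c : k)
    (z : Subalgebra.center k A) : centerEntry ψ (c • z) = c • centerEntry ψ z := by
  have h : scalar (Fin g) ((c • z : Subalgebra.center k A) : A) = c • scalar (Fin g) (z : A) :=
    map_smul (scalarAlgHom (Fin g) k) c (z : A)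
  change ψ (scalar (Fin g) ((c • z : Subalgebra.center k A) : A)) 0 0 = _
  rw [h, map_smul]
  rfl

lemma centerEntry_symm (ψ : Matrix (Fin g) (Fin g) A ≃ₐ[k] Matrix (Fin g) (Fin g) B)
    (z : Subalgebra.center k A) : centerEntry ψ.symm ⟨centerEntry ψ z, centerEntry_mem ψ z⟩ = z := by
  have h := map_scalar_coe ψ.symm ⟨centerEntry ψ z, centerEntry_mem ψ z⟩
  rw [← map_scalar_coe ψ, ψ.symm_apply_apply] at h
  exact (scalar_inj.1 h).symm

end Matrix

/-! ### Recovering the matrix size and a pair of elements with commutation parameter `θ₁`. -/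

namespace QuantumTorus

open Matrix

variable {k : Type*} [Field k] {θ θ₁ θ₂ : kˣ}

lemma finite_quotient_rad (h : IsOfFinOrder θ) : Finite ((ℤ ×ₗ ℤ) ⧸ (twistedBasis θ).rad) :=
  (twistedBasis θ).finite_quotient_rad h.orderOf_pos cocycle_pow_orderOf

instance : IsDomain (Subalgebra.center k (QuantumTorus θ)) :=
  Subalgebra.isDomain _

lemma exists_vectors {g₁ g₂ : ℕ} [NeZero g₁]
    (ψ : Matrix (Fin g₁) (Fin g₁) (QuantumTorus θ₁) ≃ₐ[k]
      Matrix (Fin g₂) (Fin g₂) (QuantumTorus θ₂)) :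
    ∃ a : Fin g₁ → Fin g₂ → QuantumTorus θ₂, (∀ i, a i ≠ 0) ∧
      (∀ i, ψ (single i i 1) *ᵥ a i = a i) ∧
      (∀ i j, i ≠ j → ψ (single i i 1) *ᵥ a j = 0) ∧
      (∀ q : Fin g₁ → QuantumTorus θ₂, (∀ r, ∑ i, a i r * q i = 0) → q = 0) := by
  refine exists_right_independent (fun i => ψ (single i i 1)) (fun i h => ?_) (fun i => ?_)
    (fun i j hij => ?_)
  · rw [map_eq_zero_iff ψ ψ.injective] at h
    have := congrFun (congrFun h i) i
    simp at this
  · rw [← map_mul, single_mul_single_same, one_mul]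
  · rw [← map_mul, single_mul_single_of_ne _ _ _ _ hij, map_zero]

lemma size_le {g₁ g₂ : ℕ} [NeZero g₁] (hθ₂ : IsOfFinOrder θ₂)
    (ψ : Matrix (Fin g₁) (Fin g₁) (QuantumTorus θ₁) ≃ₐ[k]
      Matrix (Fin g₂) (Fin g₂) (QuantumTorus θ₂)) : g₁ ≤ g₂ := by
  have := finite_quotient_rad hθ₂
  obtain ⟨a, _, _, _, ha⟩ := exists_vectors ψ
  exact (twistedBasis θ₂).card_le_of_right_independent a ha

variable {g : ℕ} [NeZero g]

/-- Up to central denominators the range of `ψ E₀₀` is the line spanned by `a 0`, so `ψ (c E₀₀)`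
acts on it as right multiplication by a fraction depending multiplicatively on `c`. The numerators
for `x₁` and `x₂` are `p` and `q`, with denominators `z` and `w`. -/
lemma exists_elements (hθ₂ : IsOfFinOrder θ₂)
    (ψ : Matrix (Fin g) (Fin g) (QuantumTorus θ₁) ≃ₐ[k] Matrix (Fin g) (Fin g) (QuantumTorus θ₂)) :
    ∃ p q z w : QuantumTorus θ₂, z ∈ Subalgebra.center k (QuantumTorus θ₂) ∧
      w ∈ Subalgebra.center k (QuantumTorus θ₂) ∧ z ≠ 0 ∧ w ≠ 0 ∧
      p * q = (θ₁ : k) • (q * p) ∧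
      (∀ (n : ℕ) (x : Subalgebra.center k (QuantumTorus θ₁)), (x : QuantumTorus θ₁) = X₁ θ₁ ^ n →
        p ^ n = centerEntry ψ x * z ^ n) ∧
      (∀ (n : ℕ) (x : Subalgebra.center k (QuantumTorus θ₁)), (x : QuantumTorus θ₁) = X₂ θ₁ ^ n →
        q ^ n = centerEntry ψ x * w ^ n) := by
  have := finite_quotient_rad hθ₂
  obtain ⟨a, ha0, haE, haE', hai⟩ := exists_vectors ψ
  obtain ⟨r₀, hr₀⟩ := Function.ne_iff.1 (ha0 0)
  have hcancel : ∀ {p q : QuantumTorus θ₂}, (∀ r, a 0 r * p = a 0 r * q) → p = q := fun h =>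
    mul_left_cancel₀ hr₀ (h r₀)
  -- Expand in the family `a` up to a central denominator, then apply `ψ E₀₀`, which fixes `a 0` and
  -- kills the other members.
  have hrep : ∀ c : QuantumTorus θ₁, ∃ z p : QuantumTorus θ₂,
      z ∈ Subalgebra.center k (QuantumTorus θ₂) ∧ z ≠ 0 ∧
      ∀ r, (ψ (single 0 0 c) *ᵥ a 0) r * z = a 0 r * p := by
    intro c
    obtain ⟨z, q, hz, hz0, h⟩ := (twistedBasis θ₂).exists_right_comb a hai (ψ (single 0 0 c) *ᵥ a 0)
    refine ⟨z, q 0, hz, hz0, fun r => ?_⟩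
    have h1 : (fun r => (ψ (single 0 0 c) *ᵥ a 0) r * z) = ∑ i, fun r => a i r * q i := by
      funext r
      rw [h r]
      simp
    have h2 := congrArg (fun v => (ψ (single 0 0 1) *ᵥ v) r) h1
    rw [mulVec_mul_right, mulVec_mulVec, ← map_mul, single_mul_single_same, one_mul, mulVec_sum,
      Finset.sum_apply, Finset.sum_eq_single 0] at h2
    · rw [h2, mulVec_mul_right, haE]
    · intro i _ hi
      rw [mulVec_mul_right, haE' 0 i (Ne.symm hi), Pi.zero_apply, zero_mul]
    · exact fun h => absurd (Finset.mem_univ _) h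
  have hmulrep : ∀ {c d : QuantumTorus θ₁} {z w p q : QuantumTorus θ₂},
      w ∈ Subalgebra.center k (QuantumTorus θ₂) → z ∈ Subalgebra.center k (QuantumTorus θ₂) →
      (∀ r, (ψ (single 0 0 c) *ᵥ a 0) r * z = a 0 r * p) →
      (∀ r, (ψ (single 0 0 d) *ᵥ a 0) r * w = a 0 r * q) →
      ∀ r, (ψ (single 0 0 (c * d)) *ᵥ a 0) r * (z * w) = a 0 r * (p * q) := by
    intro c d z w p q hw hz h1 h2 r
    have hzc := Subalgebra.mem_center_iff.1 hz
    have hwc := Subalgebra.mem_center_iff.1 hw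
    calc (ψ (single 0 0 (c * d)) *ᵥ a 0) r * (z * w)
        = (ψ (single 0 0 c) *ᵥ fun s => (ψ (single 0 0 d) *ᵥ a 0) s * w) r * z := by
          rw [mulVec_mul_right, mulVec_mulVec, ← map_mul, single_mul_single_same, mul_assoc, hzc w]
      _ = (ψ (single 0 0 c) *ᵥ a 0) r * q * z := by rw [funext h2, mulVec_mul_right]
      _ = a 0 r * (p * q) := by rw [mul_assoc, hzc q, ← mul_assoc, h1, mul_assoc]
  have hpow : ∀ {c : QuantumTorus θ₁} {z p : QuantumTorus θ₂},
      z ∈ Subalgebra.center k (QuantumTorus θ₂) →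
      (∀ r, (ψ (single 0 0 c) *ᵥ a 0) r * z = a 0 r * p) → ∀ (n : ℕ)
      (x : Subalgebra.center k (QuantumTorus θ₁)), (x : QuantumTorus θ₁) = c ^ n →
      p ^ n = centerEntry ψ x * z ^ n := by
    intro c z p hz h n x hx
    have h1 : ∀ n : ℕ, ∀ r, (ψ (single 0 0 (c ^ n)) *ᵥ a 0) r * z ^ n = a 0 r * p ^ n := by
      intro n
      induction n with
      | zero => intro r; simp [haE]
      | succ n ih =>
        rw [pow_succ, pow_succ, pow_succ]
        exact hmulrep hz (pow_mem hz n) ih h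
    refine hcancel fun r => ?_
    rw [← h1, ← hx]
    -- A central `x` acts through a scalar matrix, which `ψ` sends to the scalar matrix of
    -- `centerEntry ψ x`.
    have h2 : single 0 0 (x : QuantumTorus θ₁) =
        scalar (Fin g) (x : QuantumTorus θ₁) * single 0 0 1 := by
      ext i j
      simp [scalar_apply, single_apply]
    rw [h2, map_mul, map_scalar_coe, ← mulVec_mulVec, haE, ← mul_assoc]
    congr 1
    have h3 := Subalgebra.mem_center_iff.1 (centerEntry_mem ψ x)
    rw [h3]
    simp [scalar_apply, mulVec_diagonal]
  obtain ⟨z, p, hz, hz0, hp⟩ := hrep (X₁ θ₁)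
  obtain ⟨w, q, hw, hw0, hq⟩ := hrep (X₂ θ₁)
  refine ⟨p, q, z, w, hz, hw, hz0, hw0, hcancel fun r => ?_, hpow hz hp, hpow hw hq⟩
  have hzc := Subalgebra.mem_center_iff.1 hz
  rw [← hmulrep hw hz hp hq, mul_smul_comm,
    ← hmulrep hz hw hq hp, X₁_mul_X₂, ← smul_single, map_smul,
    smul_mulVec, Pi.smul_apply, smul_mul_assoc, hzc w]

end QuantumTorus

/-! ### Recovering the parameter from leading exponents. -/

namespace TwistedBasis

variable {k Γ A : Type*} [Field k] [AddCommGroup Γ] [LinearOrder Γ] [IsOrderedAddMonoid Γ]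
  [Ring A] [Algebra k A] {T : TwistedBasis k Γ A}

lemma IsDeg.zpow {x : Aˣ} {α : Γ} (hx : T.IsDeg (x : A) α) (n : ℤ) :
    T.IsDeg ((x ^ n : Aˣ) : A) (n • α) := by
  have hinv : T.IsDeg ((x⁻¹ : Aˣ) : A) (-α) := by
    have := T.nontrivial
    obtain ⟨β, hβ⟩ := T.exists_isDeg (x⁻¹ : Aˣ).ne_zero
    have h := hx.mul hβ
    rw [Units.mul_inv] at h
    rwa [← eq_neg_of_add_eq_zero_right (h.unique T.isDeg_one)]
  cases n with
  | ofNat n => simpa using hx.pow n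
  | negSucc n =>
    rw [zpow_negSucc, ← inv_pow, negSucc_zsmul, ← smul_neg, Units.val_pow_eq_pow_val]
    exact hinv.pow (n + 1)

lemma IsDeg.smul {x : A} {α : Γ} (hx : T.IsDeg x α) {c : k} (hc : c ≠ 0) : T.IsDeg (c • x) α := by
  have h := (T.isDeg_smul_u hc 0).mul hx
  rwa [T.u_zero, smul_mul_assoc, one_mul, zero_add] at h

end TwistedBasis

namespace QuantumTorus

open Matrix

variable {k : Type*} [Field k] {θ θ₁ θ₂ : kˣ}

lemma mem_rad_iff {γ : ℤ ×ₗ ℤ} : γ ∈ (twistedBasis θ).rad ↔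
    (orderOf θ : ℤ) ∣ (ofLex γ).1 ∧ (orderOf θ : ℤ) ∣ (ofLex γ).2 := by
  have hc : ∀ α β, (twistedBasis θ).c α β = ((θ ^ (-((ofLex β).1 * (ofLex α).2)) : kˣ) : k) :=
    fun α β => rfl
  rw [TwistedBasis.mem_rad]
  constructor
  · intro h
    have h1 := h (toLex (0, 1))
    have h2 := h (toLex (1, 0))
    rw [hc, hc, Units.val_inj] at h1 h2
    simp only [ofLex_toLex, zero_mul, neg_zero, zpow_zero, mul_one, one_mul, mul_zero] at h1 h2
    exact ⟨dvd_neg.1 (orderOf_dvd_iff_zpow_eq_one.2 h1.symm),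
      dvd_neg.1 (orderOf_dvd_iff_zpow_eq_one.2 h2)⟩
  · rintro ⟨h1, h2⟩ δ
    rw [hc, hc, orderOf_dvd_iff_zpow_eq_one.1 (dvd_neg.2 (h2.mul_left _)),
      orderOf_dvd_iff_zpow_eq_one.1 (dvd_neg.2 (h1.mul_right _))]

lemma isDeg_monomial (α : ℤ ×ₗ ℤ) :
    (twistedBasis θ).IsDeg (monomial θ α : QuantumTorus θ) α := by
  have h := (twistedBasis θ).isDeg_smul_u one_ne_zero α
  rwa [one_smul, twistedBasis_u] at h

/-- Central monomials as units of the center. -/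
noncomputable def centralMonomial {α : ℤ ×ₗ ℤ} (h : α ∈ (twistedBasis θ).rad) :
    (Subalgebra.center k (QuantumTorus θ))ˣ where
  val := ⟨monomial θ α, by
    rw [← twistedBasis_u]; exact (twistedBasis θ).u_mem_center_iff.2 h⟩
  inv := ⟨((monomial θ α)⁻¹ : (QuantumTorus θ)ˣ), by
    have h1 := (twistedBasis θ).u_mem_center_iff.2 h
    rw [twistedBasis_u] at h1
    rw [Subalgebra.mem_center_iff] at h1 ⊢
    intro x
    exact ((show Commute x (monomial θ α) from h1 x).units_inv_right).eq⟩
  val_inv := Subtype.ext (Units.mul_inv _)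
  inv_val := Subtype.ext (Units.inv_mul _)

lemma coe_centralMonomial {α : ℤ ×ₗ ℤ} (h : α ∈ (twistedBasis θ).rad) :
    (((centralMonomial h : (Subalgebra.center k (QuantumTorus θ))ˣ) :
      Subalgebra.center k (QuantumTorus θ)) : QuantumTorus θ) = monomial θ α := rfl

lemma left_mem_rad : toLex ((orderOf θ : ℤ), (0 : ℤ)) ∈ (twistedBasis θ).rad :=
  mem_rad_iff.2 ⟨dvd_rfl, dvd_zero _⟩

lemma right_mem_rad : toLex ((0 : ℤ), (orderOf θ : ℤ)) ∈ (twistedBasis θ).rad :=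
  mem_rad_iff.2 ⟨dvd_zero _, dvd_rfl⟩

lemma centralMonomial_eq {α : ℤ ×ₗ ℤ} (h : α ∈ (twistedBasis θ).rad) {a b : ℤ}
    (ha : (ofLex α).1 = orderOf θ * a) (hb : (ofLex α).2 = orderOf θ * b) :
    centralMonomial h = centralMonomial left_mem_rad ^ a * centralMonomial right_mem_rad ^ b := by
  have hinj : Function.Injective (Units.map
      (Subalgebra.center k (QuantumTorus θ)).val.toRingHom.toMonoidHom) :=
    Units.map_injective Subtype.val_injective
  apply hinj
  have hm : ∀ {α : ℤ ×ₗ ℤ} (h : α ∈ (twistedBasis θ).rad), Units.map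
      (Subalgebra.center k (QuantumTorus θ)).val.toRingHom.toMonoidHom (centralMonomial h) =
      monomial θ α := fun h => Units.ext rfl
  rw [map_mul, map_zpow, map_zpow, hm, hm, hm]
  simp only [monomial, ofLex_toLex, zpow_zero, mul_one, one_mul, ha, hb, _root_.zpow_mul]

section Degrees

variable {g : ℕ} [NeZero g]
  (ψ : Matrix (Fin g) (Fin g) (QuantumTorus θ₁) ≃ₐ[k] Matrix (Fin g) (Fin g) (QuantumTorus θ₂))

lemma mem_rad_of_isDeg {z : QuantumTorus θ} (hz : z ∈ Subalgebra.center k (QuantumTorus θ))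
    {α : ℤ ×ₗ ℤ} (h : (twistedBasis θ).IsDeg z α) : α ∈ (twistedBasis θ).rad :=
  (twistedBasis θ).mem_center_iff.1 hz α h.1

lemma exists_isDeg_unit {R : Type*} [Monoid R] (f : R →* QuantumTorus θ) (x : Rˣ) :
    ∃ α, (twistedBasis θ).IsDeg (f x) α :=
  (twistedBasis θ).exists_isDeg (Units.map f x).ne_zero

/-- Degrees of the images of central units. -/
lemma isDeg_centerEntry_of_isUnit {α β : ℤ ×ₗ ℤ}
    (hα : (twistedBasis θ₂).IsDeg (centerEntry ψ (centralMonomial left_mem_rad :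
      (Subalgebra.center k (QuantumTorus θ₁))ˣ)) α)
    (hβ : (twistedBasis θ₂).IsDeg (centerEntry ψ (centralMonomial right_mem_rad :
      (Subalgebra.center k (QuantumTorus θ₁))ˣ)) β)
    {x : Subalgebra.center k (QuantumTorus θ₁)} (hx : IsUnit x) :
    ∃ a b : ℤ, (twistedBasis θ₂).IsDeg (centerEntry ψ x) (a • α + b • β) := by
  obtain ⟨c, γ, hc, hxγ⟩ := (twistedBasis θ₁).exists_eq_smul_u_of_isUnit
    (hx.map (Subalgebra.center k (QuantumTorus θ₁)).val)
  change (x : QuantumTorus θ₁) = _ at hxγ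
  have hγ : γ ∈ (twistedBasis θ₁).rad := mem_rad_of_isDeg x.2 (by
    rw [hxγ]; exact (twistedBasis θ₁).isDeg_smul_u hc γ)
  obtain ⟨⟨a, ha⟩, ⟨b, hb⟩⟩ := mem_rad_iff.1 hγ
  have hx' : x = c • (centralMonomial hγ : Subalgebra.center k (QuantumTorus θ₁)) :=
    Subtype.ext (by rw [hxγ, twistedBasis_u]; rfl)
  refine ⟨a, b, ?_⟩
  rw [hx', centerEntry_smul]
  refine TwistedBasis.IsDeg.smul ?_ hc
  have h1 : centerEntry ψ (centralMonomial hγ : Subalgebra.center k (QuantumTorus θ₁)) =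
      ((Units.map (centerEntry ψ) (centralMonomial left_mem_rad) ^ a *
        Units.map (centerEntry ψ) (centralMonomial right_mem_rad) ^ b :
        (QuantumTorus θ₂)ˣ) : QuantumTorus θ₂) := by
    rw [← map_zpow, ← map_zpow, ← map_mul, ← centralMonomial_eq hγ ha hb]
    rfl
  rw [h1, Units.val_mul]
  exact (TwistedBasis.IsDeg.zpow (x := Units.map (centerEntry ψ) (centralMonomial left_mem_rad))
    hα a).mul (TwistedBasis.IsDeg.zpow
      (x := Units.map (centerEntry ψ) (centralMonomial right_mem_rad)) hβ b)

/-- A central monomial of `Q(θ₂)` is the image of a central unit of `Q(θ₁)`, whose image has leading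
exponent an integral combination of `α` and `β`. -/
lemma exists_comb_of_mem_rad {α β : ℤ ×ₗ ℤ}
    (hα : (twistedBasis θ₂).IsDeg (centerEntry ψ (centralMonomial left_mem_rad :
      (Subalgebra.center k (QuantumTorus θ₁))ˣ)) α)
    (hβ : (twistedBasis θ₂).IsDeg (centerEntry ψ (centralMonomial right_mem_rad :
      (Subalgebra.center k (QuantumTorus θ₁))ˣ)) β)
    {γ : ℤ ×ₗ ℤ} (hγ : γ ∈ (twistedBasis θ₂).rad) : ∃ a b : ℤ, γ = a • α + b • β := by
  let y : (Subalgebra.center k (QuantumTorus θ₂))ˣ := centralMonomial hγ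
  let x : Subalgebra.center k (QuantumTorus θ₁) :=
    ⟨centerEntry ψ.symm y, centerEntry_mem ψ.symm y⟩
  have hx : IsUnit x := by
    refine ⟨⟨x, ⟨centerEntry ψ.symm ((y⁻¹ : (Subalgebra.center k (QuantumTorus θ₂))ˣ)),
      centerEntry_mem ψ.symm _⟩, Subtype.ext ?_, Subtype.ext ?_⟩, rfl⟩
    · change centerEntry ψ.symm _ * centerEntry ψ.symm _ = 1
      rw [← map_mul, Units.mul_inv, map_one]
    · change centerEntry ψ.symm _ * centerEntry ψ.symm _ = 1
      rw [← map_mul, Units.inv_mul, map_one]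
  obtain ⟨a, b, h⟩ := isDeg_centerEntry_of_isUnit ψ hα hβ hx
  have h1 : centerEntry ψ x = monomial θ₂ γ := centerEntry_symm ψ.symm y
  rw [h1] at h
  exact ⟨a, b, (isDeg_monomial γ).unique h⟩

/-- The parameters of isomorphic matrix algebras are related through degrees. -/
lemma exists_zpow_eq (hθ₁ : IsOfFinOrder θ₁) (hθ₂ : IsOfFinOrder θ₂) {α β : ℤ ×ₗ ℤ}
    (hα : (twistedBasis θ₂).IsDeg (centerEntry ψ (centralMonomial left_mem_rad :
      (Subalgebra.center k (QuantumTorus θ₁))ˣ)) α)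
    (hβ : (twistedBasis θ₂).IsDeg (centerEntry ψ (centralMonomial right_mem_rad :
      (Subalgebra.center k (QuantumTorus θ₁))ˣ)) β) :
    ∃ δ ε : ℤ ×ₗ ℤ, θ₁ = θ₂ ^ ((ofLex δ).1 * (ofLex ε).2 - (ofLex ε).1 * (ofLex δ).2) ∧
      (∃ ζ ∈ (twistedBasis θ₂).rad, orderOf θ₁ • δ = α + orderOf θ₁ • ζ) ∧
      (∃ ζ ∈ (twistedBasis θ₂).rad, orderOf θ₁ • ε = β + orderOf θ₁ • ζ) := by
  obtain ⟨p, q, z, w, hz, hw, hz0, hw0, hpq, hp, hq⟩ := exists_elements hθ₂ ψ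
  have hp' := hp (orderOf θ₁) (centralMonomial left_mem_rad :
      (Subalgebra.center k (QuantumTorus θ₁))ˣ) (by simp [coe_centralMonomial, monomial])
  have hq' := hq (orderOf θ₁) (centralMonomial right_mem_rad :
      (Subalgebra.center k (QuantumTorus θ₁))ˣ) (by simp [coe_centralMonomial, monomial])
  obtain ⟨ζ, hζ⟩ := (twistedBasis θ₂).exists_isDeg hz0
  obtain ⟨η, hη⟩ := (twistedBasis θ₂).exists_isDeg hw0
  have hpd := hα.mul (hζ.pow (orderOf θ₁))
  have hqd := hβ.mul (hη.pow (orderOf θ₁))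
  rw [← hp'] at hpd
  rw [← hq'] at hqd
  have hn := hθ₁.orderOf_pos.ne'
  have hp0 : p ≠ 0 := by
    rintro rfl
    exact hpd.ne_zero (zero_pow hn)
  have hq0 : q ≠ 0 := by
    rintro rfl
    exact hqd.ne_zero (zero_pow hn)
  obtain ⟨δ, hδ⟩ := (twistedBasis θ₂).exists_isDeg hp0
  obtain ⟨ε, hε⟩ := (twistedBasis θ₂).exists_isDeg hq0
  refine ⟨δ, ε, ?_, ⟨ζ, mem_rad_of_isDeg hz hζ, (hδ.pow _).unique hpd⟩,
    ⟨η, mem_rad_of_isDeg hw hη, (hε.pow _).unique hqd⟩⟩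
  -- Comparing leading coefficients in `p q = θ₁ q p` leaves only the cocycle factors.
  have h1 := congrArg (fun x => (twistedBasis θ₂).u.repr x (δ + ε)) hpq
  simp only [map_smul, Finsupp.smul_apply, smul_eq_mul] at h1
  rw [hδ.repr_mul hε, add_comm δ ε, hε.repr_mul hδ] at h1
  have h2 : (twistedBasis θ₂).c δ ε = (θ₁ : k) * (twistedBasis θ₂).c ε δ := by
    refine mul_left_cancel₀ hδ.1 (mul_right_cancel₀ hε.1 ?_)
    linear_combination h1
  have h3 : θ₂ ^ (-((ofLex ε).1 * (ofLex δ).2)) = θ₁ * θ₂ ^ (-((ofLex δ).1 * (ofLex ε).2)) :=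
    Units.ext h2
  rw [_root_.zpow_neg, _root_.zpow_neg, eq_mul_inv_iff_mul_eq] at h3
  rw [← h3, _root_.zpow_sub, mul_comm]

lemma orderOf_dvd_orderOf
    (ψ : Matrix (Fin g) (Fin g) (QuantumTorus θ₁) ≃ₐ[k] Matrix (Fin g) (Fin g) (QuantumTorus θ₂))
    (hθ₁ : IsOfFinOrder θ₁) (hθ₂ : IsOfFinOrder θ₂) :
    orderOf θ₁ ∣ orderOf θ₂ := by
  obtain ⟨α, hα⟩ := exists_isDeg_unit (centerEntry ψ) (centralMonomial left_mem_rad)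
  obtain ⟨β, hβ⟩ := exists_isDeg_unit (centerEntry ψ) (centralMonomial right_mem_rad)
  obtain ⟨δ, ε, h, _⟩ := exists_zpow_eq ψ hθ₁ hθ₂ hα hβ
  exact orderOf_dvd_of_mem_zpowers ⟨_, h.symm⟩

/-- The parameter of a quantum torus is determined up to inversion by any of its matrix
algebras. -/
theorem eq_or_eq_inv_of_algEquiv
    (ψ : Matrix (Fin g) (Fin g) (QuantumTorus θ₁) ≃ₐ[k] Matrix (Fin g) (Fin g) (QuantumTorus θ₂))
    (hθ₁ : IsOfFinOrder θ₁) (hθ₂ : IsOfFinOrder θ₂) :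
    θ₁ = θ₂ ∨ θ₁ = θ₂⁻¹ := by
  have hord : orderOf θ₁ = orderOf θ₂ := Nat.dvd_antisymm (orderOf_dvd_orderOf ψ hθ₁ hθ₂)
    (orderOf_dvd_orderOf ψ.symm hθ₂ hθ₁)
  obtain ⟨α, hα⟩ := exists_isDeg_unit (centerEntry ψ) (centralMonomial left_mem_rad)
  obtain ⟨β, hβ⟩ := exists_isDeg_unit (centerEntry ψ) (centralMonomial right_mem_rad)
  obtain ⟨⟨a₁, ha₁⟩, a₂, ha₂⟩ := mem_rad_iff.1 (mem_rad_of_isDeg (centerEntry_mem ψ _) hα)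
  obtain ⟨⟨b₁, hb₁⟩, b₂, hb₂⟩ := mem_rad_iff.1 (mem_rad_of_isDeg (centerEntry_mem ψ _) hβ)
  obtain ⟨δ, ε, h, ⟨ζ, hζ, hδ⟩, ⟨η, hη, hε⟩⟩ := exists_zpow_eq ψ hθ₁ hθ₂ hα hβ
  obtain ⟨⟨z₁, hz₁⟩, z₂, hz₂⟩ := mem_rad_iff.1 hζ
  obtain ⟨⟨w₁, hw₁⟩, w₂, hw₂⟩ := mem_rad_iff.1 hη
  obtain ⟨r₁, s₁, hrs₁⟩ := exists_comb_of_mem_rad ψ hα hβ (left_mem_rad (θ := θ₂))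
  obtain ⟨r₂, s₂, hrs₂⟩ := exists_comb_of_mem_rad ψ hα hβ (right_mem_rad (θ := θ₂))
  have hm : (orderOf θ₂ : ℤ) ≠ 0 := by exact_mod_cast hθ₂.orderOf_pos.ne'
  have split : ∀ {x y : ℤ ×ₗ ℤ}, x = y → (ofLex x).1 = (ofLex y).1 ∧ (ofLex x).2 = (ofLex y).2 :=
    fun h => by rw [h]; exact ⟨rfl, rfl⟩
  rw [hord] at hδ hε
  obtain ⟨e1, e2⟩ := split hrs₁
  obtain ⟨e3, e4⟩ := split hrs₂
  obtain ⟨e5, e6⟩ := split hδ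
  obtain ⟨e7, e8⟩ := split hε
  have nsm : ∀ (n : ℕ) (x : ℤ ×ₗ ℤ), (ofLex (n • x)).1 = n * (ofLex x).1 ∧
      (ofLex (n • x)).2 = n * (ofLex x).2 := fun n x => ⟨nsmul_eq_mul n _, nsmul_eq_mul n _⟩
  have zsm : ∀ (n : ℤ) (x : ℤ ×ₗ ℤ), (ofLex (n • x)).1 = n * (ofLex x).1 ∧
      (ofLex (n • x)).2 = n * (ofLex x).2 := fun n x => ⟨smul_eq_mul n _, smul_eq_mul n _⟩
  simp only [ofLex_add, ofLex_toLex, Prod.fst_add, Prod.snd_add, nsm, zsm, ha₁, ha₂, hb₁, hb₂,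
    hz₁, hz₂, hw₁, hw₂] at e1 e2 e3 e4 e5 e6 e7 e8
  set m : ℤ := (orderOf θ₂ : ℤ) with hM
  -- `f1`–`f4` say that `(r, s)` and `(a, b)` are inverse integer matrices. `f5`–`f8` say that `δ`
  -- and `ε` agree with the rows of the latter modulo `m`.
  have f1 : r₁ * a₁ + s₁ * b₁ = 1 := mul_left_cancel₀ hm (by linear_combination -e1)
  have f2 : r₁ * a₂ + s₁ * b₂ = 0 := mul_left_cancel₀ hm (by linear_combination -e2)
  have f3 : r₂ * a₁ + s₂ * b₁ = 0 := mul_left_cancel₀ hm (by linear_combination -e3)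
  have f4 : r₂ * a₂ + s₂ * b₂ = 1 := mul_left_cancel₀ hm (by linear_combination -e4)
  have f5 : (ofLex δ).1 = a₁ + m * z₁ := mul_left_cancel₀ hm (by linear_combination e5)
  have f6 : (ofLex δ).2 = a₂ + m * z₂ := mul_left_cancel₀ hm (by linear_combination e6)
  have f7 : (ofLex ε).1 = b₁ + m * w₁ := mul_left_cancel₀ hm (by linear_combination e7)
  have f8 : (ofLex ε).2 = b₂ + m * w₂ := mul_left_cancel₀ hm (by linear_combination e8)
  have hdet : IsUnit (a₁ * b₂ - b₁ * a₂) := by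
    refine IsUnit.of_mul_eq_one (r₁ * s₂ - s₁ * r₂) ?_
    linear_combination (r₂ * a₂ + s₂ * b₂) * f1 + f4 - (r₂ * a₁ + s₂ * b₁) * f2
  -- The two determinants agree modulo the order `m` of `θ₂`.
  have hmod : θ₂ ^ ((ofLex δ).1 * (ofLex ε).2 - (ofLex ε).1 * (ofLex δ).2) =
      θ₂ ^ (a₁ * b₂ - b₁ * a₂) := by
    rw [zpow_eq_zpow_iff_modEq, ← hM, f5, f6, f7, f8]
    refine (Int.modEq_iff_dvd.2 ⟨-(a₁ * w₂ + z₁ * b₂ + m * z₁ * w₂ - b₁ * z₂ - w₁ * a₂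
      - m * w₁ * z₂), by ring⟩)
  rw [hmod] at h
  rcases Int.isUnit_iff.1 hdet with hd | hd
  · left; rw [h, hd, zpow_one]
  · right; rw [h, hd, _root_.zpow_neg_one]

end Degrees

end QuantumTorus

/-! ### Functoriality of derived algebras, symmetries of the quantum torus, and the conclusion. -/

lemma AlgEquiv.apply_mem_derivedLie {k A₁ A₂ : Type*} [Field k] [Ring A₁] [Ring A₂]
    [Algebra k A₁] [Algebra k A₂] (e : A₁ ≃ₐ[k] A₂) {x : A₁} (hx : x ∈ derivedLie k A₁) :
    e x ∈ derivedLie k A₂ := by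
  rw [mem_derivedLie_iff_mem_span] at hx ⊢
  refine Submodule.span_induction ?_ ?_ ?_ ?_ hx
  · rintro _ ⟨a, b, rfl⟩
    exact Submodule.subset_span ⟨e a, e b, by simp⟩
  · rw [map_zero]; exact Submodule.zero_mem _
  · intro x y _ _ hx hy
    rw [map_add]; exact Submodule.add_mem _ hx hy
  · intro c x _ hx
    rw [map_smul]; exact Submodule.smul_mem _ c hx

/-- Isomorphic associative algebras have isomorphic derived Lie algebras. -/
noncomputable def AlgEquiv.derivedLieEquiv {k A₁ A₂ : Type*} [Field k] [Ring A₁] [Ring A₂]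
    [Algebra k A₁] [Algebra k A₂] (e : A₁ ≃ₐ[k] A₂) : derivedLie k A₁ ≃ₗ⁅k⁆ derivedLie k A₂ where
  toFun x := ⟨e x, e.apply_mem_derivedLie x.2⟩
  invFun x := ⟨e.symm x, e.symm.apply_mem_derivedLie x.2⟩
  map_add' x y := Subtype.ext (map_add e (x : A₁) y)
  map_smul' c x := Subtype.ext (map_smul e c (x : A₁))
  map_lie' := fun {x y} => Subtype.ext (e.toLieEquiv.toLieHom.map_lie (x : A₁) (y : A₁))
  left_inv _ := Subtype.ext (e.symm_apply_apply _)
  right_inv _ := Subtype.ext (e.apply_symm_apply _)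

lemma TwistedBasis.mul_comm_of_rad_eq_top {k Γ A : Type*} [Field k] [AddCommGroup Γ] [Ring A]
    [Algebra k A] (T : TwistedBasis k Γ A) (h : T.rad = ⊤) (x y : A) : x * y = y * x :=
  (Subalgebra.mem_center_iff.1 (T.mem_center_iff.2 fun γ _ => h ▸ AddSubgroup.mem_top γ) x :)

namespace QuantumTorus

variable {k : Type*} [Field k] {θ θ₁ θ₂ : kˣ}

lemma X₂_mul_X₁ : (X₂ θ * X₁ θ : QuantumTorus θ) =
    ((θ⁻¹ : kˣ) : k) • (X₁ θ * X₂ θ : QuantumTorus θ) := by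
  rw [X₁_mul_X₂, smul_smul, Units.inv_mul, one_smul]

/-- Exchanging the generators inverts the parameter. -/
noncomputable def swap (θ : kˣ) : QuantumTorus θ ≃ₐ[k] QuantumTorus θ⁻¹ :=
  AlgEquiv.ofAlgHom
    (lift (X₂ θ⁻¹) (X₁ θ⁻¹) (by rw [X₂_mul_X₁, inv_inv]))
    (lift (X₂ θ) (X₁ θ) X₂_mul_X₁)
    (algHom_ext (by simp [lift_X₁, lift_X₂]) (by simp [lift_X₁, lift_X₂]))
    (algHom_ext (by simp [lift_X₁, lift_X₂]) (by simp [lift_X₁, lift_X₂]))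

/-- The antiautomorphism exchanging the generators. -/
noncomputable def antiSwap (θ : kˣ) : QuantumTorus θ →ₐ[k] (QuantumTorus θ)ᵐᵒᵖ :=
  lift (Units.opEquiv.symm (MulOpposite.op (X₂ θ))) (Units.opEquiv.symm (MulOpposite.op (X₁ θ)))
    (congrArg MulOpposite.op X₁_mul_X₂)

lemma antiSwap_X₁ : antiSwap θ (X₁ θ) = MulOpposite.op (X₂ θ : QuantumTorus θ) := lift_X₁ _ _ _

lemma antiSwap_X₂ : antiSwap θ (X₂ θ) = MulOpposite.op (X₁ θ : QuantumTorus θ) := lift_X₂ _ _ _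

/-- A quantum torus is isomorphic to its opposite. -/
noncomputable def opEquiv (θ : kˣ) : QuantumTorus θ ≃ₐ[k] (QuantumTorus θ)ᵐᵒᵖ :=
  AlgEquiv.ofAlgHom (antiSwap θ) (AlgHom.opComm (antiSwap θ))
    (by
      have h : (AlgHom.opComm (antiSwap θ)).comp (antiSwap θ) = AlgHom.id k _ := by
        refine algHom_ext ?_ ?_ <;> simp [antiSwap_X₁, antiSwap_X₂, AlgHom.opComm]
      refine AlgHom.ext fun x => ?_
      obtain ⟨x, rfl⟩ := MulOpposite.op_surjective x
      exact congrArg MulOpposite.op (DFunLike.congr_fun h x))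
    (algHom_ext (by simp [antiSwap_X₁, antiSwap_X₂, AlgHom.opComm])
      (by simp [antiSwap_X₁, antiSwap_X₂, AlgHom.opComm]))

/-- This settles the degenerate case of zero derived algebra, in which the Lie isomorphism carries
no information about the product. -/
lemma eq_one_of_mul_comm {g : ℕ} (hg : 0 < g)
    (h : ∀ x y : Matrix (Fin g) (Fin g) (QuantumTorus θ), x * y = y * x) : g = 1 ∧ θ = 1 := by
  constructor
  · by_contra hne
    let i : Fin g := ⟨0, hg⟩
    let j : Fin g := ⟨1, by omega⟩
    have hij : i ≠ j := by simp [i, j]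
    have h1 := congrFun₂ (h (Matrix.single i j 1) (Matrix.single j i 1)) i i
    rw [Matrix.single_mul_single_same, Matrix.single_mul_single_same, Matrix.single_apply_same,
      Matrix.single_apply_of_row_ne hij.symm, mul_one] at h1
    exact one_ne_zero h1
  · let i : Fin g := ⟨0, hg⟩
    have h1 := congrFun₂ (h (Matrix.single i i (X₁ θ : QuantumTorus θ))
      (Matrix.single i i (X₂ θ : QuantumTorus θ))) i i
    rw [Matrix.single_mul_single_same, Matrix.single_mul_single_same, Matrix.single_apply_same,
      Matrix.single_apply_same, X₁_mul_X₂] at h1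
    have h2 : ((θ : k) - 1) • ((X₂ θ * X₁ θ : (QuantumTorus θ)ˣ) : QuantumTorus θ) = 0 := by
      rw [sub_smul, one_smul, Units.val_mul, h1, sub_self]
    exact Units.ext (sub_eq_zero.1 ((smul_eq_zero.1 h2).resolve_right (Units.ne_zero _)))

lemma eq_of_matrix_algEquiv {g₁ g₂ : ℕ} [NeZero g₁] [NeZero g₂] (hθ₁ : IsOfFinOrder θ₁)
    (hθ₂ : IsOfFinOrder θ₂)
    (e : Matrix (Fin g₁) (Fin g₁) (QuantumTorus θ₁) ≃ₐ[k]
      Matrix (Fin g₂) (Fin g₂) (QuantumTorus θ₂)) : g₁ = g₂ ∧ (θ₁ = θ₂ ∨ θ₁ = θ₂⁻¹) := by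
  obtain rfl : g₁ = g₂ := le_antisymm (size_le hθ₂ e) (size_le hθ₁ e.symm)
  exact ⟨rfl, eq_or_eq_inv_of_algEquiv e hθ₁ hθ₂⟩

section CharZero

variable [CharZero k]

lemma finite_quotient_rad_matrix {g : ℕ} [NeZero g] (h : IsOfFinOrder θ)
    {ψ : AddChar (ZMod g) k} (hψ : ψ.IsPrimitive) :
    Finite (((ZMod g × ZMod g) × (ℤ ×ₗ ℤ)) ⧸ ((twistedBasis θ).matrix hψ).rad) :=
  ((twistedBasis θ).matrix hψ).finite_quotient_rad
    (mul_pos (Nat.pos_of_neZero g) h.orderOf_pos)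
    ((twistedBasis θ).matrix_c_pow hψ cocycle_pow_orderOf)

lemma eq_of_specialLinear_lieEquiv [IsAlgClosed k] {g₁ g₂ : ℕ} [NeZero g₁] [NeZero g₂]
    (hθ₁ : IsOfFinOrder θ₁) (hθ₂ : IsOfFinOrder θ₂)
    (φ : specialLinear k g₁ (QuantumTorus θ₁) ≃ₗ⁅k⁆ specialLinear k g₂ (QuantumTorus θ₂)) :
    g₁ = g₂ ∧ (θ₁ = θ₂ ∨ θ₁ = θ₂⁻¹) := by
  obtain ⟨ζ₁, h₁⟩ := HasEnoughRootsOfUnity.exists_primitiveRoot k g₁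
  obtain ⟨ζ₂, h₂⟩ := HasEnoughRootsOfUnity.exists_primitiveRoot k g₂
  have hψ₁ := AddChar.zmodChar_primitive_of_primitive_root g₁ h₁
  have hψ₂ := AddChar.zmodChar_primitive_of_primitive_root g₂ h₂
  let T₁ := (twistedBasis θ₁).matrix hψ₁
  let T₂ := (twistedBasis θ₂).matrix hψ₂
  have : Finite (_ ⧸ T₁.rad) := finite_quotient_rad_matrix hθ₁ hψ₁
  by_cases hne : T₁.rad = ⊤
  · have hne₂ : T₂.rad = ⊤ := by
      by_contra hcon
      exact T₂.rad_ne_top T₁ φ.symm hcon hne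
    obtain ⟨rfl, rfl⟩ := eq_one_of_mul_comm (Nat.pos_of_neZero g₁) (T₁.mul_comm_of_rad_eq_top hne)
    obtain ⟨rfl, rfl⟩ := eq_one_of_mul_comm (Nat.pos_of_neZero g₂) (T₂.mul_comm_of_rad_eq_top hne₂)
    exact ⟨rfl, Or.inl rfl⟩
  · rcases T₁.nonempty_algEquiv_or_op T₂ hne φ with h | h
    · obtain ⟨e⟩ := h
      exact eq_of_matrix_algEquiv hθ₁ hθ₂ e
    · obtain ⟨e⟩ := h
      exact eq_of_matrix_algEquiv hθ₁ hθ₂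
        -- Transposition identifies the opposite of the matrix algebra with matrices over the
        -- opposite torus, which is isomorphic to the torus itself.
        ((e.trans AlgEquiv.mopMatrix.symm).trans (opEquiv θ₂).symm.mapMatrix)

end CharZero

end QuantumTorus

theorem theorem10p6 {k : Type*} [Field k] [IsAlgClosed k] [CharZero k]
    (g₁ g₂ : ℕ) (hg₁ : 0 < g₁) (hg₂ : 0 < g₂)
    (θ₁ θ₂ : kˣ) (hθ₁ : IsOfFinOrder θ₁) (hθ₂ : IsOfFinOrder θ₂) :
    List.TFAE [
      Nonempty (specialLinear k g₁ (QuantumTorus θ₁) ≃ₗ⁅k⁆ specialLinear k g₂ (QuantumTorus θ₂)),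
      g₁ = g₂ ∧ (θ₁ = θ₂ ∨ θ₁ = θ₂⁻¹),
      Nonempty (Matrix (Fin g₁) (Fin g₁) (QuantumTorus θ₁) ≃ₐ[k]
        Matrix (Fin g₂) (Fin g₂) (QuantumTorus θ₂))] := by
  have : NeZero g₁ := ⟨hg₁.ne'⟩
  have : NeZero g₂ := ⟨hg₂.ne'⟩
  tfae_have 1 → 2 := fun ⟨φ⟩ => QuantumTorus.eq_of_specialLinear_lieEquiv hθ₁ hθ₂ φ
  tfae_have 2 → 3 := by
    rintro ⟨rfl, rfl | rfl⟩
    · exact ⟨AlgEquiv.refl⟩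
    · exact ⟨(QuantumTorus.swap θ₂).symm.mapMatrix⟩
  tfae_have 3 → 1 := fun ⟨e⟩ => ⟨e.derivedLieEquiv⟩
  tfae_finish
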